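/- Let $(g_n)_{n\ge 1}$ be a sequence of positive numbers with $g_n\to\infty$. Then there exist a probability space and on it a real, strictly stationary, countable-state, irreducible, aperiodic Markov chain $X=(X_k)_{k\in\mathbb Z}$ which is reversible (i.e. $(X_{-k})_{k\in\mathbb Z}$ has the same distribution on $\mathbb R^{\mathbb Z}$ as $X$) and has the following properties, where $S_n=X_1+\dots+X_n$. (i) There is a constant $C>0$ with $P(|X_0|\le C)=1$. (ii) $\alpha(n)\le\beta(n)$ for all $n\ge1$, and $\beta(n)=O(g_n/n)$ as $n\to\infty$. Here $\alpha(n)=\sup|P(A\cap B)-P(A)P(B)|$ over $A\in\sigma(X_k,k\le 0)$ and $B\in\sigma(X_k,k\ge n)$, and $\beta(n)=\sup\frac12\sum_{i}\sum_{j}|P(A_i\cap B_j)-P(A_i)P(B_j)|$ over all pairs of finite partitions $\{A_i\}$, $\{B_j\}$ of the probability space with $A_i\in\sigma(X_k,k\le0)$ and $B_j\in\sigma(X_k,k\ge n)$. (iii) $E[X_0^2]<\infty$, $E[X_0]=0$, $\lim_{n\to\infty}n^{-1}\operatorname{Var}(S_n)=\infty$, and (complete dissipation) for every $c>0$, $$\lim_{n\to\infty}\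 \sup_{r\in\mathbb R}P\bigl(r-c<n^{-1/2}S_n<r+c\bigr)=0.$$ (iv) There are a strictly increasing sequence $(J(n))_{n\ge1}$ of positive integers and positive constants $b_n\to\infty$ such that $b_n^{-1}S_{J(n)}\to\mu_{P1sL}$ in distribution as $n\to\infty$, where $\mu_{P1sL}$ is the law of $\sum_{k=1}^N\eta_k$ (equal to $0$ if $N=0$), with $\eta_1,\eta_2,\dots$ i.i.d. having the Laplace density $\frac12e^{-|x|}$ and $N$ Poisson distributed with mean $1$ and independent of $(\eta_k)_{k\ge1}$. -/

import Mathlib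

open MeasureTheory ProbabilityTheory Filter Topology

noncomputable section

namespace ReversibleChain

/-! ### Measures of dependence and mixing coefficients -/

section Mixing

variable {Ω : Type*} {mΩ : MeasurableSpace Ω}

/-- `α(𝒜, ℬ) = sup |P(A ∩ B) - P(A) P(B)|` over `A ∈ 𝒜`, `B ∈ ℬ`. -/
def alphaDep (P : Measure Ω) (𝒜 ℬ : MeasurableSpace Ω) : ℝ :=
  sSup {x : ℝ | ∃ A B : Set Ω, MeasurableSet[𝒜] A ∧ MeasurableSet[ℬ] B ∧
    x = |P.real (A ∩ B) - P.real A * P.real B|}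

/-- `A 0, …, A (I - 1)` is a finite partition of `Ω` into events of the σ-field `𝒜`. -/
def IsFinitePartition (𝒜 : MeasurableSpace Ω) {I : ℕ} (A : Fin I → Set Ω) : Prop :=
  (∀ i, MeasurableSet[𝒜] (A i)) ∧ Pairwise (fun i i' => Disjoint (A i) (A i')) ∧
    (⋃ i, A i) = Set.univ

/-- `β(𝒜, ℬ) = sup (1/2) ∑ᵢ ∑ⱼ |P(Aᵢ ∩ Bⱼ) - P(Aᵢ) P(Bⱼ)|` over all pairs of finite partitions
of `Ω` into events of `𝒜`, respectively of `ℬ`. -/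
def betaDep (P : Measure Ω) (𝒜 ℬ : MeasurableSpace Ω) : ℝ :=
  sSup {x : ℝ | ∃ (I J : ℕ) (A : Fin I → Set Ω) (B : Fin J → Set Ω),
    IsFinitePartition 𝒜 A ∧ IsFinitePartition ℬ B ∧
    x = (1 / 2 : ℝ) * ∑ i, ∑ j, |P.real (A i ∩ B j) - P.real (A i) * P.real (B j)|}

/-- The σ-field `σ(X_k, k ≤ j)`. -/
abbrev pastSigma (X : ℤ → Ω → ℝ) (j : ℤ) : MeasurableSpace Ω :=
  ⨆ k : {k : ℤ // k ≤ j}, MeasurableSpace.comap (X k) inferInstance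

/-- The σ-field `σ(X_k, k ≥ j)`. -/
abbrev futureSigma (X : ℤ → Ω → ℝ) (j : ℤ) : MeasurableSpace Ω :=
  ⨆ k : {k : ℤ // j ≤ k}, MeasurableSpace.comap (X k) inferInstance

/-- The strong mixing coefficient `α_X(n)` of a strictly stationary sequence. -/
def alphaMix (P : Measure Ω) (X : ℤ → Ω → ℝ) (n : ℕ) : ℝ :=
  alphaDep P (pastSigma X 0) (futureSigma X n)

/-- The absolute regularity coefficient `β_X(n)` of a strictly stationary sequence. -/
def betaMix (P : Measure Ω) (X : ℤ → Ω → ℝ) (n : ℕ) : ℝ :=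
  betaDep P (pastSigma X 0) (futureSigma X n)

end Mixing

/-! ### Stationary countable-state Markov chains indexed by `ℤ` -/

section Chains

variable {Ω : Type*} {mΩ : MeasurableSpace Ω}

/-- The law of the whole sequence on `ℝ^ℤ` is invariant under every time shift. -/
def IsStrictlyStationary (P : Measure Ω) (X : ℤ → Ω → ℝ) : Prop :=
  ∀ m : ℤ, IdentDistrib (fun ω k => X (k + m) ω) (fun ω k => X k ω) P P

/-- The law of the time-reversed sequence on `ℝ^ℤ` is that of the sequence itself. -/
def IsReversible (P : Measure Ω) (X : ℤ → Ω → ℝ) : Prop :=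
  IdentDistrib (fun ω k => X (-k) ω) (fun ω k => X k ω) P P

/-- `X` is a real Markov chain with countable state space `S`. Here `P[A | B]` is elementary
conditional probability, and the Markov property says that
`P(X_{j+1} = t | X_j = s 0, X_{j-1} = s 1, …, X_{j-n} = s n) = P(X_{j+1} = t | X_j = s 0)`
whenever the conditioning event on the left has positive probability. -/
structure IsCountableStateMarkovChain (P : Measure Ω) (X : ℤ → Ω → ℝ) (S : Set ℝ) : Prop where
  measurable : ∀ k, Measurable (X k)
  countable : S.Countable
  mem_states : ∀ k ω, X k ω ∈ S
  markov : ∀ (j : ℤ) (n : ℕ) (s : ℕ → ℝ) (t : ℝ),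
    P {ω | ∀ i : ℕ, i ≤ n → X (j - i) ω = s i} ≠ 0 →
    P[{ω | X (j + 1) ω = t} | {ω | ∀ i : ℕ, i ≤ n → X (j - i) ω = s i}]
      = P[{ω | X (j + 1) ω = t} | {ω | X j ω = s 0}]

/-- The `n`-step transition probability `P(X_n = t | X_0 = s)` of a stationary chain. -/
def stepProb (P : Measure Ω) (X : ℤ → Ω → ℝ) (n : ℕ) (s t : ℝ) : ENNReal :=
  P[{ω | X n ω = t} | {ω | X 0 ω = s}]

/-- Every state leads to every state (in particular every state has positive probability). -/
def IsIrreducibleChain (P : Measure Ω) (X : ℤ → Ω → ℝ) (S : Set ℝ) : Prop :=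
  ∀ s ∈ S, ∀ t ∈ S, ∃ n : ℕ, 1 ≤ n ∧ 0 < stepProb P X n s t

/-- Every state has period one: the greatest common divisor of its return times is `1`. -/
def IsAperiodicChain (P : Measure Ω) (X : ℤ → Ω → ℝ) (S : Set ℝ) : Prop :=
  ∀ s ∈ S, ∀ d : ℕ, (∀ n : ℕ, 1 ≤ n → 0 < stepProb P X n s s → d ∣ n) → d = 1

/-- `S_n = X_1 + ⋯ + X_n`. -/
def partialSum (X : ℤ → Ω → ℝ) (n : ℕ) (ω : Ω) : ℝ :=
  ∑ k ∈ Finset.Icc 1 n, X (k : ℤ) ω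

/-- Complete dissipation of `n^{-1/2} S_n`: its concentration function at every `c > 0` tends
to `0`. -/
def CompletelyDissipates (P : Measure Ω) (X : ℤ → Ω → ℝ) : Prop :=
  ∀ c : ℝ, 0 < c → Tendsto (fun n : ℕ => ⨆ r : ℝ,
    P.real {ω | r - c < (√(n : ℝ))⁻¹ * partialSum X n ω ∧
      (√(n : ℝ))⁻¹ * partialSum X n ω < r + c}) atTop (𝓝 0)

end Chains

/-! ### The law of a Poisson-mean-one number of independent Laplace variables -/

/-- The Laplace distribution, with density `(1/2) e^{-|x|}`. -/
def laplaceLaw : Measure ℝ :=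
  volume.withDensity fun x => ENNReal.ofReal ((1 / 2) * Real.exp (-|x|))

instance instIsProbabilityMeasureLaplaceLaw : IsProbabilityMeasure laplaceLaw := by
  have hint : ∫ x : ℝ, Real.exp (-|x|) = 2 := by
    rw [integral_comp_abs (f := fun x : ℝ => Real.exp (-x)), integral_exp_neg_Ioi_zero, mul_one]
  have hI : Integrable (fun x : ℝ => (1 / 2) * Real.exp (-|x|)) :=
    (Integrable.of_integral_ne_zero (by rw [hint]; norm_num)).const_mul _
  constructor
  rw [laplaceLaw, withDensity_apply _ MeasurableSet.univ, Measure.restrict_univ,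
    ← ofReal_integral_eq_lintegral_ofReal hI (ae_of_all _ fun x => by positivity),
    integral_const_mul, hint]
  norm_num

/-- The random variable `Y = η_1 + ⋯ + η_N` on the space of pairs `(N, (η_1, η_2, …))`
(the sequence is indexed from `0` here). -/
def randomSum (ω : ℕ × (ℕ → ℝ)) : ℝ := ∑ k ∈ Finset.range ω.1, ω.2 k

theorem measurable_randomSum : Measurable randomSum := by
  refine measurable_from_prod_countable_right fun n => ?_
  simp only [randomSum]
  fun_prop

/-- The law `μ_{P1sL}` of `η_1 + ⋯ + η_N`, where `N` is Poisson with mean `1`, the `η_k` are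
i.i.d. Laplace, and `N` is independent of the sequence `(η_k)`. -/
def poissonLaplaceLaw : Measure ℝ :=
  ((poissonMeasure 1).prod (Measure.infinitePi fun _ : ℕ => laplaceLaw)).map randomSum

instance instIsProbabilityMeasurePoissonLaplaceLaw : IsProbabilityMeasure poissonLaplaceLaw :=
  Measure.isProbabilityMeasure_map measurable_randomSum.aemeasurable

end ReversibleChain

end

open ReversibleChain

/-!
The chain codes an infinite family of independent stationary chains on `{-1, 0, 1}`. At each time
step the `i`-th of them is, with probability `q i`, resampled from its stationary law, which puts
mass `ε i / 2` on each of `±1`; otherwise it stays where it is. As `∑ ε i < ∞`, almost surely only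
finitely many of the chains are nonzero at a given time, so that `X k = ∑ᵢ 4⁻ⁱ Vᵢ(k)` takes
countably many values, and this value determines the configuration `V(k)`.
Hence `X` is a bounded Markov chain; each resampling chain is stationary and reversible, and any
configuration of finite support can follow any other in one step, which makes `X` irreducible and
aperiodic. The whole family is a function of independent noise, marks for the resampling times and
candidate values. The chains are run from time `0` in both directions of time, so reversal is a
relabelling of the noise, and the shift is a relabelling that exchanges the values at times `0` and
`1` in the chains that are not resampled in between (`exists_shift`).

Mixing. Exchange the initial values with an independent spare copy. The past and the modified future
are independent, and the modification is visible from time `n` on only through chains that have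
not been resampled by time `n` and have a nonzero initial or spare value. So
`β(n) ≤ ∑ᵢ 2 εᵢ (1 - qᵢ)ⁿ` (`betaMix_le`).

Sums. A chain that is rarely nonzero satisfies a linear recursion for the characteristic function
of its sums, whose solution is `(1 - q ε γ)ⁿ` up to an error `10 ε`, uniformly in `n` and in the
frequency `θ`, where `γ = decay q θ` (`charFun_coordSum_estimate`).
* The `i`-th chain is independent of the others, so it alone makes the modulus of the
  characteristic function of `n^{-1/2} Sₙ` at `t`, in the limit `n → ∞`, at most
  `exp (-t² 16⁻ⁱ εᵢ / (2 qᵢ)) + 10 εᵢ`. As `16⁻ⁱ εᵢ / qᵢ → ∞` and `εᵢ → 0`, complete dissipation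
  follows by smoothing with a Gaussian (`completelyDissipates_X`), and dissipation makes the
  normalized variances tend to infinity.
* At time `J i = 1 / (εᵢ qᵢ)` the `i`-th chain has seen about a Poisson number of excursions from
  zero, of mean one and of lengths nearly exponential of mean `1 / qᵢ`. The same estimate gives the
  limit `exp (-t² / (1 + t²))`, the characteristic function of the Poisson compound of Laplace laws.
  The chains before the `i`-th have negligible variance at this time, and those after it most
  likely have not left zero (`tendstoInDistribution_partialSum`).

Rates. With `εᵢ / qᵢ = 16ⁱ (i!)⁴` the dissipation condition holds and the earlier chains are
negligible. The scale of `εᵢ` is then free, and it is taken, recursively, so small that the later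
chains are negligible and that `n εᵢ (1 - qᵢ)ⁿ ≤ 2^{-i-1} (gₙ + 1)` for all `n`
(`betaMix_rates_le`).
-/

namespace ReversibleChain

noncomputable section

/-! ### Relabelling the coordinates of a product measure -/

section Relabel

variable {ι E : Type*} [MeasurableSpace E]

open Classical in
/-- The configuration that agrees with `p.1` on `A` and with `p.2` off `A`. -/
noncomputable def splice (A : Set ι) (p : (ι → E) × (ι → E)) : ι → E :=
  fun x => if x ∈ A then p.1 x else p.2 x

theorem measurable_splice (A : Set ι) : Measurable (splice (E := E) A) := by
  refine measurable_pi_iff.2 fun x => ?_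
  unfold splice
  split_ifs <;> fun_prop

variable (μ : ι → Measure E) [∀ x, IsProbabilityMeasure (μ x)]

/-- Two independent samples of a product measure may be cut and joined along any set of
coordinates. -/
theorem measurePreserving_splice (A : Set ι) :
    MeasurePreserving (splice A) ((Measure.infinitePi μ).prod (Measure.infinitePi μ))
      (Measure.infinitePi μ) := by
  classical
  refine ⟨measurable_splice A, Measure.eq_infinitePi _ fun s t ht => ?_⟩
  rw [Measure.map_apply (measurable_splice A)
    (MeasurableSet.pi s.countable_toSet fun i _ => ht i)]
  have h : splice A ⁻¹' Set.pi s t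
      = (Set.pi (s.filter (· ∈ A)) t) ×ˢ (Set.pi (s.filter (· ∉ A)) t) := by
    ext p
    simp only [splice, Set.mem_preimage, Set.mem_pi, Finset.mem_coe, Set.mem_prod,
      Finset.mem_filter, and_imp]
    constructor
    · intro h
      exact ⟨fun i hi hA => by simpa [hA] using h i hi, fun i hi hA => by simpa [hA] using h i hi⟩
    · rintro ⟨h1, h2⟩ i hi
      by_cases hA : i ∈ A
      · simpa [hA] using h1 i hi hA
      · simpa [hA] using h2 i hi hA
  rw [h, Measure.prod_prod, Measure.infinitePi_pi _ (fun i _ => ht i),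
    Measure.infinitePi_pi _ (fun i _ => ht i), Finset.prod_filter_mul_prod_filter_not]

theorem indepFun_of_dependsOn {β γ : Type*} [MeasurableSpace β] [MeasurableSpace γ]
    {S T : Set ι} (hST : Disjoint S T) {f : (ι → E) → β} {g : (ι → E) → γ}
    (hf : Measurable f) (hg : Measurable g) (hfS : DependsOn f S) (hgT : DependsOn g T) :
    IndepFun f g (Measure.infinitePi μ) := by
  rw [indepFun_iff_measure_inter_preimage_eq_mul]
  intro s t hs ht
  rw [← (measurePreserving_splice μ S).measure_preimage
    ((hf hs).inter (hg ht)).nullMeasurableSet]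
  have h : splice S ⁻¹' (f ⁻¹' s ∩ g ⁻¹' t) = (f ⁻¹' s) ×ˢ (g ⁻¹' t) := by
    ext p
    have h1 : f (splice S p) = f p.1 := hfS fun i hi => by simp [splice, hi]
    have h2 : g (splice S p) = g p.2 := hgT fun i hi => by
      have : i ∉ S := fun h => Set.disjoint_left.1 hST h hi
      simp [splice, this]
    simp [h1, h2]
  rw [h, Measure.prod_prod]

theorem measure_inter_of_dependsOn {S T : Set ι} (hST : Disjoint S T) {A B : Set (ι → E)}
    (hA : MeasurableSet A) (hB : MeasurableSet B) (hAS : DependsOn (fun ω => ω ∈ A) S)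
    (hBT : DependsOn (fun ω => ω ∈ B) T) : Measure.infinitePi μ (A ∩ B) =
      Measure.infinitePi μ A * Measure.infinitePi μ B := by
  have hm : ∀ {C : Set (ι → E)}, MeasurableSet C → Measurable fun ω => ω ∈ C := fun h =>
    measurableSet_setOfPred.1 h
  have h := indepFun_of_dependsOn μ hST (hm hA) (hm hB) hAS hBT
    |>.measure_inter_preimage_eq_mul {True} {True} (MeasurableSet.singleton _)
    (MeasurableSet.singleton _)
  have e : ∀ C : Set (ι → E), (fun ω => ω ∈ C) ⁻¹' {True} = C := fun C => by ext; simp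
  simpa only [e] using h

theorem measurePreserving_relabel (e : Equiv.Perm ι) (he : ∀ x, μ (e x) = μ x) :
    MeasurePreserving (fun ω : ι → E => fun x => ω (e x)) (Measure.infinitePi μ)
      (Measure.infinitePi μ) := by
  classical
  have hm : Measurable (fun ω : ι → E => fun x => ω (e x)) := by fun_prop
  refine ⟨hm, Measure.eq_infinitePi _ fun s t ht => ?_⟩
  rw [Measure.map_apply hm (MeasurableSet.pi s.countable_toSet fun i _ => ht i)]
  have h : (fun ω : ι → E => fun x => ω (e x)) ⁻¹' Set.pi s t
      = Set.pi (s.map e.toEmbedding) (fun x => t (e.symm x)) := by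
    ext ω
    simp only [Set.mem_preimage, Set.mem_pi, Finset.mem_coe, Finset.mem_map_equiv]
    exact ⟨fun h i hi => by simpa using h _ hi, fun h i hi => by simpa using h (e i) (by simpa)⟩
  rw [h, Measure.infinitePi_pi _ (fun i _ => ht _), Finset.prod_map]
  simp [he]

/-- A relabelling that is chosen by looking only at coordinates which it leaves in place preserves
the product measure: given those coordinates, it is a fixed permutation of the others. -/
theorem measurePreserving_relabel_of_dependsOn (A : Set ι) (e : (ι → E) → Equiv.Perm ι)
    (he : ∀ ω x, μ (e ω x) = μ x) (heA : ∀ ω, ∀ x, e ω x ∈ A ↔ x ∈ A)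
    (hfix : ∀ ω, ∀ x ∈ A, e ω x = x)
    (hdep : DependsOn e A) (hm : Measurable fun ω : ι → E => fun x => ω (e ω x)) :
    MeasurePreserving (fun ω : ι → E => fun x => ω (e ω x)) (Measure.infinitePi μ)
      (Measure.infinitePi μ) := by
  classical
  refine ⟨hm, Measure.ext fun s hs => ?_⟩
  have hsp := measurePreserving_splice μ A
  rw [Measure.map_apply hm hs, ← hsp.measure_preimage (hm hs).nullMeasurableSet,
    ← hsp.measure_preimage hs.nullMeasurableSet,
    Measure.prod_apply (hsp.measurable (hm hs)), Measure.prod_apply (hsp.measurable hs)]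
  refine lintegral_congr fun ω₁ => ?_
  have hpre : Prod.mk ω₁ ⁻¹' (splice A ⁻¹' ((fun ω : ι → E => fun x => ω (e ω x)) ⁻¹' s))
      = (fun ω : ι → E => fun x => ω (e ω₁ x)) ⁻¹' (Prod.mk ω₁ ⁻¹' (splice A ⁻¹' s)) := by
    ext ω₂
    have h1 : e (splice A (ω₁, ω₂)) = e ω₁ := hdep fun i hi => by simp [splice, hi]
    have h2 : (fun x => splice A (ω₁, ω₂) (e ω₁ x))
        = splice A (ω₁, fun x => ω₂ (e ω₁ x)) := by
      funext x
      by_cases hx : x ∈ A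
      · simp [splice, hx, hfix ω₁ x hx]
      · simp [splice, hx, heA]
    simp only [Set.mem_preimage, h1, h2]
  rw [hpre, (measurePreserving_relabel μ (e ω₁) (he ω₁)).measure_preimage
    (measurable_prodMk_left (hsp.measurable hs)).nullMeasurableSet]

end Relabel

/-! ### Independent three-state resampling chains -/

instance : MeasurableSpace SignType := ⊤

instance : DiscreteMeasurableSpace SignType := ⟨fun _ => trivial⟩

/-- The law on `{-1, 0, 1}` with mass `a` at `1` and mass `b` at `-1`. -/
def ternaryLaw (a b : ℝ) : Measure SignType :=
  ENNReal.ofReal a • Measure.dirac 1 + ENNReal.ofReal b • Measure.dirac (-1) +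
    ENNReal.ofReal (1 - a - b) • Measure.dirac 0

theorem isProbabilityMeasure_ternaryLaw {a b : ℝ} (ha : 0 ≤ a) (hb : 0 ≤ b) (hab : a + b ≤ 1) :
    IsProbabilityMeasure (ternaryLaw a b) := by
  constructor
  simp only [ternaryLaw, Measure.add_apply, Measure.smul_apply, measure_univ, smul_eq_mul, mul_one]
  rw [← ENNReal.ofReal_add ha hb, ← ENNReal.ofReal_add (by positivity) (by linarith)]
  simp

theorem integral_ternaryLaw {E : Type*} [NormedAddCommGroup E] [NormedSpace ℝ E] [CompleteSpace E]
    {a b : ℝ} (ha : 0 ≤ a) (hb : 0 ≤ b) (hab : a + b ≤ 1) (f : SignType → E) :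
    ∫ x, f x ∂ternaryLaw a b = a • f 1 + b • f (-1) + (1 - a - b) • f 0 := by
  have hi : ∀ (c : ℝ) (s : SignType), Integrable f (ENNReal.ofReal c • Measure.dirac s) :=
    fun c s => (integrable_dirac (by simp)).smul_measure (by simp)
  rw [ternaryLaw, integral_add_measure ((hi _ _).add_measure (hi _ _)) (hi _ _),
    integral_add_measure (hi _ _) (hi _ _)]
  simp only [integral_smul_measure, integral_dirac]
  rw [ENNReal.toReal_ofReal ha, ENNReal.toReal_ofReal hb, ENNReal.toReal_ofReal (by linarith)]

/-- The parameters of a sequence of independent stationary chains on `{-1, 0, 1}`: at each step the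
`i`-th chain is resampled from its stationary law with probability `q i`, and the stationary law
gives mass `ε i / 2` to each of `1` and `-1`. The bound on `∑ ε i` makes it possible, with
positive probability, that every chain is at zero at two given times. -/
structure Rates where
  q : ℕ → ℝ
  ε : ℕ → ℝ
  q_pos : ∀ i, 0 < q i
  q_le : ∀ i, q i ≤ 1
  ε_pos : ∀ i, 0 < ε i
  ε_le : ∀ i, ε i ≤ 1 / 4
  summable_ε : Summable ε
  tsum_ε_le : ∑' i, ε i ≤ 1 / 4

/-- The index set of the noise: `(i, inl k)` is the mark of the time edge from `k - 1` to `k` in the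
`i`-th chain, `(i, inr (some k))` is the candidate value of that chain at time `k`, and
`(i, inr none)` is a spare value that the chain does not use. -/
abbrev Idx := ℕ × (ℤ ⊕ Option ℤ)

/-- The noise configurations; an edge is marked when its coordinate is `1`. -/
abbrev Noise := Idx → SignType

theorem measurableSet_coord_eq (x : Idx) (s : SignType) : MeasurableSet {ω : Noise | ω x = s} :=
  measurable_pi_apply (X := fun _ : Idx => SignType) x (MeasurableSet.singleton s)

theorem measurableSet_coord_ne (x : Idx) (s : SignType) : MeasurableSet {ω : Noise | ω x ≠ s} :=
  (measurableSet_coord_eq x s).compl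

/-- The law of one noise coordinate. -/
def Rates.noiseLaw (R : Rates) : Idx → Measure SignType
  | (i, Sum.inl _) => ternaryLaw (R.q i) 0
  | (i, Sum.inr _) => ternaryLaw (R.ε i / 2) (R.ε i / 2)

instance (R : Rates) (x : Idx) : IsProbabilityMeasure (R.noiseLaw x) := by
  rcases x with ⟨i, _ | _⟩
  · exact isProbabilityMeasure_ternaryLaw (R.q_pos i).le le_rfl (by simpa using R.q_le i)
  · have := R.ε_pos i
    have := R.ε_le i
    exact isProbabilityMeasure_ternaryLaw (by linarith) (by linarith) (by linarith)

/-- The law of the noise. -/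
def Rates.P (R : Rates) : Measure Noise := Measure.infinitePi R.noiseLaw

instance (R : Rates) : IsProbabilityMeasure R.P := by unfold Rates.P; infer_instance

/-- The chains run forward from time `0`. -/
def fwd (ω : Noise) : ℕ → ℕ → SignType
  | 0 => fun i => ω (i, Sum.inr (some 0))
  | n + 1 => fun i => if ω (i, Sum.inl (n + 1)) = 1 then ω (i, Sum.inr (some (n + 1)))
      else fwd ω n i

/-- Reversal of time on the noise coordinates. -/
def revIdx : Equiv.Perm Idx :=
  (Equiv.refl ℕ).prodCongr ((Equiv.subLeft 1).sumCongr (Equiv.neg ℤ).optionCongr)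

/-- Reversal of time on the noise. -/
def rev (ω : Noise) : Noise := fun x => ω (revIdx x)

/-- The chains, run from time `0` in both directions of time. -/
def chain (ω : Noise) (k : ℤ) : ℕ → SignType :=
  if 0 ≤ k then fwd ω k.toNat else fwd (rev ω) (-k).toNat

theorem chain_natCast (ω : Noise) (n : ℕ) : chain ω n = fwd ω n := by simp [chain]

@[simp] theorem rev_rev (ω : Noise) : rev (rev ω) = ω := by
  funext ⟨i, x⟩
  rcases x with k | _ | k <;> simp [rev, revIdx]

theorem chain_rev (ω : Noise) (k : ℤ) : chain (rev ω) k = chain ω (-k) := by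
  rcases lt_trichotomy k 0 with h | h | h
  · simp [chain, h.not_ge, h.le]
  · subst h
    funext i
    simp [chain, fwd, rev, revIdx]
  · simp [chain, h.not_ge, h.le]

theorem measurePreserving_rev (R : Rates) : MeasurePreserving rev R.P R.P := by
  refine measurePreserving_relabel R.noiseLaw revIdx fun ⟨i, x⟩ => ?_
  rcases x with k | k <;> rfl

theorem chain_zero (ω : Noise) (i : ℕ) : chain ω 0 i = ω (i, Sum.inr (some 0)) := rfl

theorem chain_succ (ω : Noise) {k : ℤ} (hk : 0 ≤ k) (i : ℕ) : chain ω (k + 1) i =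
    if ω (i, Sum.inl (k + 1)) = 1 then ω (i, Sum.inr (some (k + 1))) else chain ω k i := by
  obtain ⟨n, rfl⟩ := Int.eq_ofNat_of_zero_le hk
  rw [chain_natCast, show ((n : ℤ) + 1) = ((n + 1 : ℕ) : ℤ) by push_cast; rfl, chain_natCast]
  simp [fwd]

theorem chain_pred (ω : Noise) {k : ℤ} (hk : k < 0) (i : ℕ) : chain ω k i =
    if ω (i, Sum.inl (k + 1)) = 1 then ω (i, Sum.inr (some k)) else chain ω (k + 1) i := by
  have h := chain_succ (rev ω) (k := -k - 1) (by omega) i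
  rw [chain_rev, chain_rev] at h
  have e1 : -(-k - 1 + 1) = k := by ring
  have e2 : -(-k - 1) = k + 1 := by ring
  rw [e1, e2] at h
  rw [h]
  simp [rev, revIdx, add_comm]

/-- In each chain, exchange the values at times `0` and `1` unless the edge between them is
marked. -/
def swapIdx (ω : Noise) : Equiv.Perm Idx :=
  Function.Involutive.toPerm
    (fun x => match x with
      | (i, Sum.inl k) => (i, Sum.inl k)
      | (i, Sum.inr o) => if ω (i, Sum.inl 1) = 1 then (i, Sum.inr o)
          else (i, Sum.inr (o.map (Equiv.swap (0 : ℤ) 1)))) (by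
    rintro ⟨i, k | o⟩
    · rfl
    · by_cases h : ω (i, Sum.inl 1) = 1
      · simp [h]
      · cases o <;> simp [h])

theorem swapIdx_inl (ω : Noise) (i : ℕ) (k : ℤ) : swapIdx ω (i, Sum.inl k) = (i, Sum.inl k) := rfl

theorem swapIdx_inr (ω : Noise) (i : ℕ) (o : Option ℤ) : swapIdx ω (i, Sum.inr o) =
    if ω (i, Sum.inl 1) = 1 then (i, Sum.inr o)
      else (i, Sum.inr (o.map (Equiv.swap (0 : ℤ) 1))) := rfl

theorem measurable_swap : Measurable fun ω : Noise => fun x => ω (swapIdx ω x) := by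
  refine measurable_pi_iff.2 fun ⟨i, x⟩ => ?_
  rcases x with k | o
  · simp only [swapIdx_inl]; fun_prop
  · simp only [swapIdx_inr, apply_ite]
    refine Measurable.ite ?_ (by fun_prop) (by fun_prop)
    exact measurableSet_coord_eq _ _

theorem measurePreserving_swap (R : Rates) :
    MeasurePreserving (fun ω : Noise => fun x => ω (swapIdx ω x)) R.P R.P := by
  refine measurePreserving_relabel_of_dependsOn R.noiseLaw {x | x.2.isLeft} swapIdx ?_ ?_ ?_ ?_
    measurable_swap
  · rintro ω ⟨i, k | o⟩
    · rfl
    · rw [swapIdx_inr]; split_ifs <;> rfl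
  · rintro ω ⟨i, k | o⟩
    · rfl
    · rw [swapIdx_inr]; split_ifs <;> rfl
  · rintro ω ⟨i, k | o⟩ h
    · rfl
    · simp at h
  · intro ω ω' h
    ext1 ⟨i, x⟩
    rcases x with k | o
    · rfl
    · rw [swapIdx_inr, swapIdx_inr, h (i, Sum.inl 1) (by simp)]

/-- The shift of the noise coordinates by one time unit. -/
def shiftIdx : Equiv.Perm Idx :=
  (Equiv.refl ℕ).prodCongr ((Equiv.addRight 1).sumCongr (Equiv.addRight (1 : ℤ)).optionCongr)

/-- The map of the noise that shifts the chains by one time unit. Since the chains are run from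
time `0` in both directions, the values at times `0` and `1` must exchange their roles in the chains
that are not resampled between these times. -/
def shift (ω : Noise) : Noise := fun x => ω (swapIdx ω (shiftIdx x))

theorem measurePreserving_shift (R : Rates) : MeasurePreserving shift R.P R.P := by
  refine MeasurePreserving.comp (g := fun ω : Noise => fun x => ω (shiftIdx x))
    (measurePreserving_relabel R.noiseLaw shiftIdx fun ⟨i, x⟩ => ?_) (measurePreserving_swap R)
  rcases x with k | k <;> rfl

theorem shift_inl (ω : Noise) (i : ℕ) (k : ℤ) :
    shift ω (i, Sum.inl k) = ω (i, Sum.inl (k + 1)) := rfl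

theorem shift_inr (ω : Noise) (i : ℕ) (k : ℤ) : shift ω (i, Sum.inr (some k)) =
    if ω (i, Sum.inl 1) = 1 then ω (i, Sum.inr (some (k + 1)))
      else ω (i, Sum.inr (some (Equiv.swap 0 1 (k + 1)))) := by
  change ω (swapIdx ω (i, Sum.inr (some (k + 1)))) = _
  rw [swapIdx_inr, apply_ite ω]
  rfl

theorem shift_inr_of_ne (ω : Noise) (i : ℕ) {k : ℤ} (h0 : k ≠ 0) (h1 : k ≠ -1) :
    shift ω (i, Sum.inr (some k)) = ω (i, Sum.inr (some (k + 1))) := by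
  rw [shift_inr, Equiv.swap_apply_of_ne_of_ne (by omega) (by omega), ite_self]

theorem chain_shift (ω : Noise) (k : ℤ) : chain (shift ω) k = chain ω (k + 1) := by
  have h0 : ∀ i, chain (shift ω) 0 i = chain ω 1 i := fun i => by
    rw [chain_zero, shift_inr, show (1 : ℤ) = 0 + 1 by rfl, chain_succ ω le_rfl]
    simp [chain_zero]
  have hneg : ∀ i, chain (shift ω) (-1) i = chain ω 0 i := fun i => by
    rw [chain_pred _ (by norm_num), shift_inr, shift_inl]
    simp only [Int.reduceNeg, neg_add_cancel, zero_add, h0, Equiv.swap_apply_left]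
    rw [show (1 : ℤ) = 0 + 1 by rfl, chain_succ ω le_rfl]
    by_cases h : ω (i, Sum.inl 1) = 1 <;> simp [h, chain_zero]
  funext i
  rcases le_or_gt 0 k with hk | hk
  · induction k, hk using Int.leInduction with
    | base => exact h0 i
    | succ k hk ih =>
      rw [chain_succ _ hk, chain_succ _ (by omega), ih, shift_inl,
        shift_inr_of_ne _ _ (by omega) (by omega)]
  · obtain ⟨m, rfl⟩ : ∃ m : ℕ, k = -1 - m := ⟨(-1 - k).toNat, by omega⟩
    clear hk
    induction m with
    | zero => simpa using hneg i
    | succ m ih =>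
      have e : (-1 - ((m + 1 : ℕ) : ℤ)) + 1 = -1 - m := by push_cast; ring
      rw [chain_pred _ (by omega), e, ih, shift_inl, shift_inr_of_ne _ _ (by omega) (by omega), e]
      rw [chain_pred ω (k := -1 - m) (by omega)]

/-- Every shift of time is realised by a measure-preserving map of the noise. -/
theorem exists_shift (R : Rates) (m : ℤ) : ∃ T : Noise → Noise, MeasurePreserving T R.P R.P ∧
    ∀ ω k, chain (T ω) k = chain ω (k + m) := by
  induction m using Int.induction_on with
  | zero => exact ⟨id, MeasurePreserving.id _, fun ω k => by simp⟩
  | succ m ih =>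
    obtain ⟨T, hT, h⟩ := ih
    refine ⟨T ∘ shift, hT.comp (measurePreserving_shift R), fun ω k => ?_⟩
    rw [Function.comp, h, chain_shift, add_assoc]
  | pred m ih =>
    obtain ⟨T, hT, h⟩ := ih
    refine ⟨T ∘ rev ∘ shift ∘ rev, hT.comp ((measurePreserving_rev R).comp
      ((measurePreserving_shift R).comp (measurePreserving_rev R))), fun ω k => ?_⟩
    simp only [Function.comp, h, chain_rev, chain_shift]
    congr 1
    ring

section

/-! ### Coding the states by real numbers -/

theorem abs_signType_le (s : SignType) : |(s : ℝ)| ≤ 1 := by cases s <;> simp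

/-- The number `∑ᵢ vᵢ / 4ⁱ`. -/
def code (v : ℕ → SignType) : ℝ := ∑' i, (1 / 4 : ℝ) ^ i * (v i : ℝ)

theorem abs_code_term_le (v : ℕ → SignType) (i : ℕ) :
    |(1 / 4 : ℝ) ^ i * (v i : ℝ)| ≤ (1 / 4 : ℝ) ^ i := by
  rw [abs_mul, abs_of_nonneg (by positivity)]
  exact mul_le_of_le_one_right (by positivity) (abs_signType_le _)

theorem summable_code (v : ℕ → SignType) : Summable fun i => (1 / 4 : ℝ) ^ i * (v i : ℝ) :=
  Summable.of_norm_bounded (summable_geometric_of_lt_one (by norm_num) (by norm_num))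
    (abs_code_term_le v)

theorem abs_code_le (v : ℕ → SignType) : |code v| ≤ 4 / 3 := by
  have h : ‖code v‖ ≤ (1 - 1 / 4 : ℝ)⁻¹ := tsum_of_norm_bounded
    (f := fun i => (1 / 4 : ℝ) ^ i * (v i : ℝ))
    (hasSum_geometric_of_lt_one (r := (1 / 4 : ℝ)) (by norm_num) (by norm_num)) (abs_code_term_le v)
  rw [Real.norm_eq_abs] at h
  exact h.trans (by norm_num)

theorem code_eq_add (v : ℕ → SignType) :
    code v = (v 0 : ℝ) + 1 / 4 * code (fun i => v (i + 1)) := by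
  rw [code, (summable_code v).tsum_eq_zero_add, code, ← tsum_mul_left]
  simp only [pow_zero, one_mul, pow_succ]
  congr 1
  exact tsum_congr fun i => by ring

/-- The digit in place `0` can be read off, since the rest of the series is at most `1 / 3` in
absolute value while different digits differ by at least `1`. -/
theorem code_injective : Function.Injective code := by
  have key : ∀ i (v w : ℕ → SignType), code v = code w → v i = w i := by
    have h0 : ∀ v w : ℕ → SignType, code v = code w → v 0 = w 0 := by
      intro v w h
      rw [code_eq_add, code_eq_add w] at h
      have h1 := abs_le.1 (abs_code_le fun i => v (i + 1))
      have h2 := abs_le.1 (abs_code_le fun i => w (i + 1))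
      revert h
      cases v 0 <;> cases w 0 <;> simp <;> intro h <;> linarith
    intro i
    induction i with
    | zero => exact h0
    | succ i ih =>
      intro v w h
      have h' := h0 v w h
      rw [code_eq_add, code_eq_add w, h'] at h
      exact ih (fun i => v (i + 1)) (fun i => w (i + 1)) (by linarith)
  exact fun v w h => funext fun i => key i v w h

theorem measurable_code : Measurable code := by
  refine measurable_of_tendsto_metrizable
    (f := fun (n : ℕ) (v : ℕ → SignType) => ∑ i ∈ Finset.range n, (1 / 4 : ℝ) ^ i * (v i : ℝ))
    (fun n => Finset.measurable_sum _ fun i _ => ?_)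
    (tendsto_pi_nhds.2 fun v => (summable_code v).hasSum.tendsto_sum_nat)
  have h : Measurable fun s : SignType => (s : ℝ) := Measurable.of_discrete
  exact (h.comp (measurable_pi_apply i)).const_mul _

/-- The configurations with finitely many nonzero coordinates. -/
def finSupp : Set (ℕ → SignType) := {v | {i | v i ≠ 0}.Finite}

theorem countable_finSupp : finSupp.Countable := by
  refine (Set.countable_range (fun v : ℕ →₀ SignType => (v : ℕ → SignType))).mono fun v hv => ?_
  exact ⟨Finsupp.ofSupportFinite v (hv), rfl⟩

open Classical in
/-- The real state of a configuration. Configurations of infinite support, which almost surely do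
not occur, are sent to `0`. -/
def obs (v : ℕ → SignType) : ℝ := if v ∈ finSupp then code v else 0

theorem obs_of_mem {v : ℕ → SignType} (hv : v ∈ finSupp) : obs v = code v := if_pos hv

theorem measurable_obs : Measurable obs := by
  classical
  exact Measurable.ite countable_finSupp.measurableSet measurable_code measurable_const

theorem abs_obs_le (v : ℕ → SignType) : |obs v| ≤ 4 / 3 := by
  unfold obs
  split_ifs
  · exact abs_code_le v
  · norm_num

/-- The state space of the chain. -/
def states : Set ℝ := obs '' finSupp

theorem countable_states : states.Countable := countable_finSupp.image _

theorem zero_mem_finSupp : (0 : ℕ → SignType) ∈ finSupp := by simp [finSupp]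

theorem obs_zero : obs 0 = 0 := by
  rw [obs_of_mem zero_mem_finSupp, code]
  simp

theorem obs_mem_states (v : ℕ → SignType) : obs v ∈ states := by
  by_cases hv : v ∈ finSupp
  · exact ⟨v, hv, rfl⟩
  · exact ⟨0, zero_mem_finSupp, by rw [obs_zero, obs, if_neg hv]⟩

theorem obs_injOn : Set.InjOn obs finSupp := fun v hv w hw h => by
  rw [obs_of_mem hv, obs_of_mem hw] at h
  exact code_injective h

/-- The real-valued chain. -/
def X (k : ℤ) (ω : Noise) : ℝ := obs (chain ω k)

/-! ### Dependence of the chains on the noise -/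

theorem fwd_congr {ω ω' : Noise} {i m : ℕ}
    (h1 : ∀ j : ℕ, 1 ≤ j → j ≤ m → ω (i, Sum.inl (j : ℤ)) = ω' (i, Sum.inl (j : ℤ)))
    (h2 : ∀ j : ℕ, j ≤ m → ω (i, Sum.inr (some (j : ℤ))) = ω' (i, Sum.inr (some (j : ℤ)))) :
    fwd ω m i = fwd ω' m i := by
  induction m with
  | zero => exact h2 0 le_rfl
  | succ m ih =>
    have e1 := h1 (m + 1) (by omega) le_rfl
    have e2 := h2 (m + 1) le_rfl
    push_cast at e1 e2
    simp only [fwd, e1, e2]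
    rw [ih (fun j hj hm => h1 j hj (by omega)) (fun j hm => h2 j (by omega))]

theorem exists_ne_zero_of_fwd_ne_zero {ω : Noise} {m i : ℕ} (h : fwd ω m i ≠ 0) :
    ∃ j ≤ m, ω (i, Sum.inr (some (j : ℤ))) ≠ 0 := by
  induction m with
  | zero => exact ⟨0, le_rfl, h⟩
  | succ m ih =>
    simp only [fwd] at h
    split_ifs at h with hm
    · exact ⟨m + 1, le_rfl, by exact_mod_cast h⟩
    · obtain ⟨j, hj, hj'⟩ := ih h
      exact ⟨j, by omega, hj'⟩

/-- The noise coordinates up to time `n`. -/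
def beforeIdx (n : ℤ) : Set Idx := {x | ∃ k ≤ n, x.2 = Sum.inl k ∨ x.2 = Sum.inr (some k)}

theorem inl_mem_beforeIdx {n k : ℤ} {i : ℕ} : ((i, Sum.inl k) : Idx) ∈ beforeIdx n ↔ k ≤ n := by
  simp [beforeIdx]

theorem inr_mem_beforeIdx {n k : ℤ} {i : ℕ} :
    ((i, Sum.inr (some k)) : Idx) ∈ beforeIdx n ↔ k ≤ n := by
  simp [beforeIdx]

theorem dependsOn_chain {n k : ℤ} (hn : 0 ≤ n) (hk : k ≤ n) :
    DependsOn (fun ω => chain ω k) (beforeIdx n) := by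
  intro ω ω' h
  funext i
  rcases le_or_gt 0 k with h0 | h0
  · obtain ⟨m, rfl⟩ := Int.eq_ofNat_of_zero_le h0
    simp only [chain_natCast]
    exact fwd_congr (fun j _ hj => h _ (inl_mem_beforeIdx.2 (by omega)))
      (fun j hj => h _ (inr_mem_beforeIdx.2 (by omega)))
  · simp only [chain, h0.not_ge, if_false]
    refine fwd_congr (fun j h1 hj => ?_) (fun j hj => ?_)
    · exact h (i, Sum.inl (1 - (j : ℤ))) (inl_mem_beforeIdx.2 (by omega))
    · exact h (i, Sum.inr (some (-(j : ℤ)))) (inr_mem_beforeIdx.2 (by omega))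

theorem dependsOn_X {n k : ℤ} (hn : 0 ≤ n) (hk : k ≤ n) : DependsOn (X k) (beforeIdx n) :=
  fun _ _ h => congrArg obs (dependsOn_chain hn hk h)

theorem measurable_chain (k : ℤ) : Measurable fun ω => chain ω k := by
  have hf : ∀ m : ℕ, Measurable fun ω => fwd ω m := by
    intro m
    refine measurable_pi_iff.2 fun i => ?_
    induction m with
    | zero => simp only [fwd]; fun_prop
    | succ m ih =>
      simp only [fwd]
      exact Measurable.ite (measurableSet_coord_eq _ _) (by fun_prop) ih
  have hr : Measurable rev := by unfold rev; fun_prop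
  unfold chain
  split_ifs
  · exact hf _
  · exact (hf _).comp hr

theorem measurable_X (k : ℤ) : Measurable (X k) := measurable_obs.comp (measurable_chain k)

theorem chain_coord_eq_of_eq {ω ω' : Noise} {i : ℕ} (h : ∀ x, ω (i, x) = ω' (i, x)) (k : ℤ) :
    chain ω k i = chain ω' k i := by
  unfold chain
  split_ifs
  · exact fwd_congr (fun _ _ _ => h _) (fun _ _ => h _)
  · exact fwd_congr (fun _ _ _ => h _) (fun _ _ => h _)

/-! ### Probabilities of noise events -/

variable (R : Rates)

theorem P_coord (x : Idx) (s : Set SignType) : R.P {ω | ω x ∈ s} = R.noiseLaw x s :=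
  (measurePreserving_eval_infinitePi R.noiseLaw x).measure_preimage
    (MeasurableSet.of_discrete (s := s)).nullMeasurableSet

theorem P_val_ne_zero (i : ℕ) (o : Option ℤ) :
    R.P {ω | ω (i, Sum.inr o) ≠ 0} = ENNReal.ofReal (R.ε i) := by
  have := P_coord R (i, Sum.inr o) {0}ᶜ
  simp only [Set.mem_compl_iff, Set.mem_singleton_iff] at this
  have hε := (R.ε_pos i).le
  rw [this]
  simp [Rates.noiseLaw, ternaryLaw]
  rw [← ENNReal.ofReal_add (by positivity) (by positivity), add_halves]

theorem P_exists_val_ne_zero_le (i n : ℕ) :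
    R.P {ω | ∃ j ≤ n, ω (i, Sum.inr (some (j : ℤ))) ≠ 0} ≤ (n + 1) * ENNReal.ofReal (R.ε i) := by
  have : {ω : Noise | ∃ j ≤ n, ω (i, Sum.inr (some (j : ℤ))) ≠ 0}
      = ⋃ j ∈ Finset.range (n + 1), {ω | ω (i, Sum.inr (some (j : ℤ))) ≠ 0} := by
    ext ω; simp
  rw [this]
  refine (measure_biUnion_finset_le _ _).trans ?_
  simp [P_val_ne_zero]

/-- By the Borel–Cantelli lemma, only finitely many chains meet a nonzero candidate value up to a
given time. -/
theorem ae_chain_mem_finSupp : ∀ᵐ ω ∂(R.P), ∀ k, chain ω k ∈ finSupp := by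
  have hf : ∀ᵐ ω ∂(R.P), ∀ n : ℕ, chain ω n ∈ finSupp := by
    refine ae_all_iff.2 fun n => ?_
    have h := measure_setOfPred_frequently_eq_zero (μ := R.P)
      (p := fun i (ω : Noise) => ∃ j ≤ n, ω (i, Sum.inr (some (j : ℤ))) ≠ 0) (by
        refine ne_top_of_le_ne_top ?_ (ENNReal.tsum_le_tsum fun i => P_exists_val_ne_zero_le R i n)
        rw [ENNReal.tsum_mul_left]
        refine ENNReal.mul_ne_top (by simp) ?_
        rw [← ENNReal.ofReal_tsum_of_nonneg (fun i => (R.ε_pos i).le) R.summable_ε]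
        simp)
    have h' : ∀ᵐ ω ∂(R.P), ¬ ∃ᶠ i in atTop,
        ∃ j ≤ n, (ω : Noise) (i, Sum.inr (some (j : ℤ))) ≠ 0 := by
      rw [ae_iff]; simpa only [not_not] using h
    filter_upwards [h'] with ω hω
    rw [chain_natCast, finSupp, Set.mem_ofPred_eq, ← Set.not_infinite,
      ← Nat.frequently_atTop_iff_infinite]
    exact fun hc => hω (hc.mono fun i hi => exists_ne_zero_of_fwd_ne_zero hi)
  have hb := (measurePreserving_rev R).quasiMeasurePreserving.ae hf
  filter_upwards [hf, hb] with ω h1 h2 k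
  rcases le_or_gt 0 k with h | h
  · obtain ⟨n, rfl⟩ := Int.eq_ofNat_of_zero_le h
    exact h1 n
  · have := h2 (-k).toNat
    rwa [chain_rev, Int.toNat_of_nonneg (by omega), neg_neg] at this

/-! ### Stationarity and reversibility -/

theorem isStrictlyStationary_X : IsStrictlyStationary R.P X := by
  intro m
  have hm : ∀ m : ℤ, Measurable fun (ω : Noise) (k : ℤ) => X (k + m) ω :=
    fun m => measurable_pi_iff.2 fun k => measurable_X _
  have h0 : Measurable fun (ω : Noise) (k : ℤ) => X k ω := measurable_pi_iff.2 measurable_X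
  obtain ⟨T, hT, h⟩ := exists_shift R m
  refine ⟨(hm m).aemeasurable, h0.aemeasurable, ?_⟩
  have : (fun (ω : Noise) (k : ℤ) => X (k + m) ω) = (fun ω k => X k ω) ∘ T := by
    funext ω k
    simp [X, h]
  rw [this, ← Measure.map_map h0 hT.measurable, hT.map_eq]

theorem isReversible_X : IsReversible R.P X := by
  have h0 : Measurable fun (ω : Noise) (k : ℤ) => X k ω := measurable_pi_iff.2 measurable_X
  have h1 : Measurable fun (ω : Noise) (k : ℤ) => X (-k) ω :=
    measurable_pi_iff.2 fun k => measurable_X _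
  refine ⟨h1.aemeasurable, h0.aemeasurable, ?_⟩
  have : (fun (ω : Noise) (k : ℤ) => X (-k) ω) = (fun ω k => X k ω) ∘ rev := by
    funext ω k
    simp [X, chain_rev]
  rw [this, ← Measure.map_map h0 (measurePreserving_rev R).measurable,
    (measurePreserving_rev R).map_eq]

end

section

variable (R : Rates)

/-! ### The Markov property -/

/-- The configuration at time `n + 1` of chains that are in the configuration `v` at time `n`. -/
def step (v : ℕ → SignType) (n : ℕ) (ω : Noise) : ℕ → SignType :=
  fun i => if ω (i, Sum.inl (n + 1)) = 1 then ω (i, Sum.inr (some (n + 1))) else v i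

theorem measurable_step (v : ℕ → SignType) (n : ℕ) : Measurable (step v n) := by
  refine measurable_pi_iff.2 fun i => ?_
  unfold step
  exact Measurable.ite (measurableSet_coord_eq _ _) (by fun_prop) measurable_const

theorem dependsOn_step (v : ℕ → SignType) (n : ℕ) : DependsOn (step v n) (beforeIdx n)ᶜ := by
  intro ω ω' h
  funext i
  unfold step
  rw [h (i, Sum.inl (n + 1)) (by rw [Set.mem_compl_iff, inl_mem_beforeIdx]; omega),
    h (i, Sum.inr (some (n + 1))) (by rw [Set.mem_compl_iff, inr_mem_beforeIdx]; omega)]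

theorem chain_succ_eq_step (ω : Noise) (n : ℕ) :
    chain ω (n + 1) = step (chain ω n) n ω :=
  funext fun i => chain_succ ω (by omega) i

/-- Given the state at time `n ≥ 0`, the next state is independent of the past: it is a function of
that state and of the noise at time `n + 1`. -/
theorem measure_inter_X_succ {n : ℕ} {A : Set Noise} (hA : MeasurableSet A)
    (hAn : DependsOn (fun ω => ω ∈ A) (beforeIdx n)) {v : ℕ → SignType} (hv : v ∈ finSupp)
    (hAv : ∀ ω ∈ A, X n ω = obs v) (t : ℝ) :
    R.P (A ∩ {ω | X (n + 1) ω = t}) = R.P A * R.P {ω | obs (step v n ω) = t} := by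
  have hB : MeasurableSet {ω | obs (step v n ω) = t} :=
    (measurable_obs.comp (measurable_step v n)) (MeasurableSet.singleton t)
  rw [Rates.P, ← measure_inter_of_dependsOn R.noiseLaw disjoint_compl_right hA hB hAn
    (fun ω ω' h => by simp only [Set.mem_ofPred_eq, dependsOn_step v n h])]
  refine measure_congr ?_
  filter_upwards [ae_chain_mem_finSupp R] with ω hω
  refine propext (and_congr_right fun h => ?_)
  have e : chain ω n = v := obs_injOn (hω n) hv (hAv ω h)
  change obs (chain ω (n + 1)) = t ↔ obs (step v n ω) = t
  rw [chain_succ_eq_step, e]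

theorem isCountableStateMarkovChain_X : IsCountableStateMarkovChain R.P X states where
  measurable := measurable_X
  countable := countable_states
  mem_states k ω := obs_mem_states _
  markov j n s t hpos := by
    have hm : ∀ (k : ℤ) (r : ℝ), MeasurableSet {ω | X k ω = r} := fun k r =>
      measurable_X k (MeasurableSet.singleton r)
    have hmp : ∀ j : ℤ, MeasurableSet {ω | ∀ i : ℕ, i ≤ n → X (j - i) ω = s i} := fun j => by
      have : {ω | ∀ i : ℕ, i ≤ n → X (j - i) ω = s i}
          = ⋂ i : ℕ, ⋂ _ : i ≤ n, {ω | X (j - i) ω = s i} := by ext; simp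
      rw [this]
      exact MeasurableSet.iInter fun i => MeasurableSet.iInter fun _ => hm _ _
    -- The event is moved to the times `0, …, n + 1`, where the chains run forward.
    obtain ⟨T, hT, hTX⟩ := exists_shift R (j - n)
    have hX : ∀ k ω, X k (T ω) = X (k + (j - n)) ω := fun k ω => by simp only [X, hTX]
    have e1 : {ω | ∀ i : ℕ, i ≤ n → X (j - i) ω = s i}
        = T ⁻¹' {ω | ∀ i : ℕ, i ≤ n → X (n - i) ω = s i} := by
      ext ω
      simp only [Set.mem_ofPred_eq, Set.mem_preimage, hX]
      refine forall_congr' fun i => ?_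
      rw [show (n : ℤ) - i + (j - n) = j - i by ring]
    have e2 : ∀ r, {ω | X (j + 1) ω = r} = T ⁻¹' {ω | X (n + 1) ω = r} := fun r => by
      ext ω
      simp only [Set.mem_ofPred_eq, Set.mem_preimage, hX]
      rw [show (n : ℤ) + 1 + (j - n) = j + 1 by ring]
    have e3 : {ω | X j ω = s 0} = T ⁻¹' {ω | X n ω = s 0} := by
      ext ω
      simp only [Set.mem_ofPred_eq, Set.mem_preimage, hX]
      rw [show (n : ℤ) + (j - n) = j by ring]
    rw [cond_apply (hmp j), cond_apply (hm j _), e1, e2, e3, ← Set.preimage_inter,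
      ← Set.preimage_inter, hT.measure_preimage (hmp _).nullMeasurableSet,
      hT.measure_preimage (hm _ _).nullMeasurableSet,
      hT.measure_preimage ((hmp _).inter (hm _ _)).nullMeasurableSet,
      hT.measure_preimage ((hm _ _).inter (hm _ _)).nullMeasurableSet]
    rw [e1, hT.measure_preimage (hmp _).nullMeasurableSet] at hpos
    have hsub : {ω | ∀ i : ℕ, i ≤ n → X ((n : ℤ) - i) ω = s i} ⊆ {ω | X n ω = s 0} :=
      fun ω h => by simpa using h 0 (by omega)
    have hpos' : R.P {ω | X n ω = s 0} ≠ 0 := fun h => hpos (measure_mono_null hsub h)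
    obtain ⟨ω₀, hω₀⟩ := nonempty_of_measure_ne_zero hpos'
    obtain ⟨v, hv, hvs⟩ := obs_mem_states (chain ω₀ n)
    have hvs : obs v = s 0 := hvs.trans hω₀
    rw [measure_inter_X_succ R (hmp n) ?_ hv (fun ω h => (hsub h).trans hvs.symm),
      measure_inter_X_succ R (hm n (s 0)) ?_ hv (fun ω h => Eq.trans h hvs.symm),
      ← mul_assoc, ← mul_assoc, ENNReal.inv_mul_cancel hpos (measure_ne_top _ _),
      ENNReal.inv_mul_cancel hpos' (measure_ne_top _ _)]
    · intro ω ω' h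
      simp only [Set.mem_ofPred_eq, dependsOn_X (n := n) (k := n) (by omega) le_rfl h]
    · intro ω ω' h
      simp only [Set.mem_ofPred_eq]
      refine propext (forall_congr' fun i => ?_)
      rw [dependsOn_X (n := n) (k := n - i) (by omega) (by omega) h]

/-! ### Irreducibility and aperiodicity -/

/-- Any finite pattern of values and marks has positive probability, and independently of it all
the other chains may vanish at times `0` and `1`; so every state leads to every state in one
step. -/
theorem stepProb_one_pos {s t : ℝ} (hs : s ∈ states) (ht : t ∈ states) :
    0 < stepProb R.P X 1 s t := by
  have hm : ∀ (k : ℤ) (r : ℝ), MeasurableSet {ω | X k ω = r} := fun k r =>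
    measurable_X k (MeasurableSet.singleton r)
  rw [stepProb, cond_apply (hm 0 s)]
  refine ENNReal.mul_pos (ENNReal.inv_ne_zero.2 (measure_ne_top _ _)) ?_
  obtain ⟨v, hv, rfl⟩ := hs
  obtain ⟨w, hw, rfl⟩ := ht
  obtain ⟨N, hN⟩ : ∃ N, ∀ i, N ≤ i → v i = 0 ∧ w i = 0 := by
    obtain ⟨N, hN⟩ := (Set.Finite.union hv hw).bddAbove
    refine ⟨N + 1, fun i hi => ?_⟩
    by_contra h
    have : i ≤ N := hN (by
      simp only [Set.mem_union, Set.mem_ofPred_eq]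
      tauto)
    omega
  -- `E₁` prescribes the first `N` chains, and `E₂` lets all the others vanish at times `0` and `1`.
  set target : Idx → Set SignType := fun x => match x with
    | (_, Sum.inl _) => {1}
    | (i, Sum.inr o) => {if o = some 0 then v i else w i} with htarget
  set F : Finset Idx :=
    (Finset.range N) ×ˢ {Sum.inl 1, Sum.inr (some 0), Sum.inr (some 1)} with hF
  set E₁ : Set Noise := Set.pi F target
  set E₂ : Set Noise := ⋂ i : ℕ, ⋂ _ : N ≤ i,
    {ω | ω (i, Sum.inr (some 0)) = 0} ∩ {ω | ω (i, Sum.inr (some 1)) = 0} with hE₂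
  have hE₂m : MeasurableSet E₂ := MeasurableSet.iInter fun i => MeasurableSet.iInter fun _ =>
    (measurableSet_coord_eq _ _).inter (measurableSet_coord_eq _ _)
  have hE₁m : MeasurableSet E₁ :=
    MeasurableSet.pi F.countable_toSet fun _ _ => MeasurableSet.of_discrete
  have hsub : E₁ ∩ E₂ ⊆ {ω | X 0 ω = obs v} ∩ {ω | X ((1 : ℕ) : ℤ) ω = obs w} := by
    rintro ω ⟨h1, h2⟩
    simp only [hE₂, Set.mem_iInter, Set.mem_inter_iff, Set.mem_ofPred_eq] at h2
    have h1' : ∀ i < N, ω (i, Sum.inr (some 0)) = v i ∧ ω (i, Sum.inl 1) = 1 ∧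
        ω (i, Sum.inr (some 1)) = w i := fun i hi =>
      ⟨by simpa [htarget] using h1 (i, Sum.inr (some 0)) (by simp [hF, hi]),
        by simpa [htarget] using h1 (i, Sum.inl 1) (by simp [hF, hi]),
        by simpa [htarget] using h1 (i, Sum.inr (some 1)) (by simp [hF, hi])⟩
    have h0 : chain ω 0 = v := by
      funext i
      rw [chain_zero]
      rcases lt_or_ge i N with hi | hi
      · exact (h1' i hi).1
      · rw [(h2 i hi).1, (hN i hi).1]
    have h1'' : chain ω 1 = w := by
      funext i
      rw [show (1 : ℤ) = 0 + 1 by rfl, chain_succ ω le_rfl, h0, zero_add]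
      rcases lt_or_ge i N with hi | hi
      · rw [if_pos (h1' i hi).2.1, (h1' i hi).2.2]
      · rw [(h2 i hi).2, (hN i hi).1, (hN i hi).2, ite_self]
    exact ⟨congrArg obs h0, congrArg obs h1''⟩
  refine fun h => absurd (measure_mono_null hsub h) ?_
  rw [Rates.P, measure_inter_of_dependsOn R.noiseLaw (S := {x | x.1 < N}) (T := {x | N ≤ x.1})
    (Set.disjoint_left.2 fun x hx hx' => by
      simp only [Set.mem_ofPred_eq] at hx hx'; omega) hE₁m hE₂m ?_ ?_]
  · refine mul_ne_zero ?_ ?_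
    · rw [Measure.infinitePi_pi _ fun _ _ => MeasurableSet.of_discrete]
      refine Finset.prod_ne_zero_iff.2 fun ⟨i, x⟩ hx => ?_
      have hq := R.q_pos i
      have hε := R.ε_pos i
      have hε' := R.ε_le i
      have hε₂ : ¬ 1 - R.ε i / 2 ≤ R.ε i / 2 := by linarith
      rcases x with k | o
      · simp [htarget, Rates.noiseLaw, ternaryLaw, hq]
      · simp only [htarget]
        cases (if o = some 0 then v i else w i) <;>
          simp [Rates.noiseLaw, ternaryLaw, hε, hε₂]
    · have hc : R.P E₂ᶜ ≤ ENNReal.ofReal (1 / 2) := by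
        have hsub : E₂ᶜ ⊆ ⋃ i : ℕ, ({ω : Noise | ω (i, Sum.inr (some 0)) ≠ 0} ∪
            {ω | ω (i, Sum.inr (some 1)) ≠ 0}) := by
          intro ω hω
          simp only [hE₂, Set.mem_compl_iff, Set.mem_iInter, not_forall] at hω
          obtain ⟨i, _, hi⟩ := hω
          refine Set.mem_iUnion.2 ⟨i, ?_⟩
          simp only [Set.mem_inter_iff, Set.mem_ofPred_eq] at hi
          simp only [Set.mem_union, Set.mem_ofPred_eq]
          tauto
        calc R.P E₂ᶜ ≤ ∑' i, R.P ({ω : Noise | ω (i, Sum.inr (some 0)) ≠ 0} ∪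
              {ω | ω (i, Sum.inr (some 1)) ≠ 0}) :=
              (measure_mono hsub).trans (measure_iUnion_le _)
          _ ≤ ∑' i, ENNReal.ofReal (2 * R.ε i) := by
              refine ENNReal.tsum_le_tsum fun i => (measure_union_le _ _).trans ?_
              rw [P_val_ne_zero, P_val_ne_zero, ← ENNReal.ofReal_add (R.ε_pos i).le (R.ε_pos i).le,
                two_mul]
          _ = ENNReal.ofReal (2 * ∑' i, R.ε i) := by
              rw [← tsum_mul_left, ENNReal.ofReal_tsum_of_nonneg
                (fun i => by have := R.ε_pos i; positivity) (R.summable_ε.mul_left 2)]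
          _ ≤ ENNReal.ofReal (1 / 2) :=
              ENNReal.ofReal_le_ofReal (by linarith [R.tsum_ε_le])
      intro h0
      have h1 : R.P E₂ᶜ = 1 := (prob_compl_eq_one_iff hE₂m).2 h0
      rw [h1] at hc
      have : (1 : ENNReal) = ENNReal.ofReal 1 := by simp
      rw [this, ENNReal.ofReal_le_ofReal_iff (by norm_num)] at hc
      norm_num at hc
  · intro ω ω' h
    refine propext (forall₂_congr fun x hx => ?_)
    rw [h x]
    have := (Finset.mem_product.1 hx).1
    simpa using this
  · intro ω ω' h
    simp only [hE₂, Set.mem_iInter, Set.mem_inter_iff, Set.mem_ofPred_eq]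
    refine propext (forall₂_congr fun i hi => ?_)
    rw [h (i, _) hi, h (i, _) hi]

theorem isIrreducibleChain_X : IsIrreducibleChain R.P X states :=
  fun _ hs _ ht => ⟨1, le_rfl, stepProb_one_pos R hs ht⟩

theorem isAperiodicChain_X : IsAperiodicChain R.P X states :=
  fun _ hs _ hd => Nat.dvd_one.1 (hd 1 le_rfl (stepProb_one_pos R hs hs))

/-! ### Symmetry -/

/-- The sign change of all the values of the noise. -/
def flip (ω : Noise) : Noise
  | (i, Sum.inl k) => ω (i, Sum.inl k)
  | (i, Sum.inr o) => -ω (i, Sum.inr o)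

theorem measurePreserving_flip : MeasurePreserving flip R.P R.P := by
  set f : Idx → SignType → SignType := fun x s => if x.2.isLeft then s else -s with hf
  have e : flip = fun ω x => f x (ω x) := by
    funext ω ⟨i, x⟩
    rcases x with k | o <;> simp [flip, hf]
  have hm : ∀ x, Measurable (f x) := fun x => Measurable.of_discrete
  rw [e]
  refine ⟨measurable_pi_iff.2 fun x => (hm x).comp (measurable_pi_apply x), ?_⟩
  rw [Rates.P, Measure.infinitePi_map_pi _ hm]
  congr 1
  funext ⟨i, x⟩
  rcases x with k | o
  · simp [hf]
  · simp only [hf, Rates.noiseLaw, ternaryLaw, Sum.isLeft_inr, Bool.false_eq_true, if_false]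
    rw [Measure.map_add _ _ (by fun_prop), Measure.map_add _ _ (by fun_prop), Measure.map_smul,
      Measure.map_smul, Measure.map_smul, Measure.map_dirac, Measure.map_dirac, Measure.map_dirac]
    simp only [neg_neg, neg_zero]
    rw [add_comm (ENNReal.ofReal (R.ε i / 2) • Measure.dirac (-1 : SignType))]

theorem obs_neg (v : ℕ → SignType) : obs (-v) = -obs v := by
  have h : -v ∈ finSupp ↔ v ∈ finSupp := by simp [finSupp]
  by_cases hv : v ∈ finSupp
  · rw [obs_of_mem hv, obs_of_mem (h.2 hv), code, code, ← tsum_neg]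
    refine tsum_congr fun i => ?_
    cases hvi : v i <;> simp [hvi]
  · rw [obs, obs, if_neg hv, if_neg (fun hc => hv (h.1 hc)), neg_zero]

theorem integral_X_zero : ∫ ω, X 0 ω ∂(R.P) = 0 := by
  have h : ∀ ω, X 0 (flip ω) = -X 0 ω := fun ω => by
    rw [X, X, ← obs_neg]
    rfl
  have h1 : ∫ ω, X 0 (flip ω) ∂(R.P) = ∫ ω, X 0 ω ∂(R.P) := by
    rw [← (measurePreserving_flip R).map_eq, integral_map (measurePreserving_flip R).aemeasurable
      (measurable_X 0).aestronglyMeasurable, (measurePreserving_flip R).map_eq]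
  simp only [h, integral_neg] at h1
  linarith

theorem memLp_X (k : ℤ) : MemLp (X k) 2 R.P :=
  MemLp.of_bound (measurable_X k).aestronglyMeasurable (4 / 3)
    (ae_of_all _ fun _ => abs_obs_le _)

theorem integral_X (k : ℤ) : ∫ ω, X k ω ∂(R.P) = 0 := by
  obtain ⟨T, hT, h⟩ := exists_shift R k
  have e : ∀ ω, X k ω = X 0 (T ω) := fun ω => by simp [X, h]
  simp only [e]
  rw [← integral_X_zero R]
  conv_rhs => rw [← hT.map_eq]
  rw [integral_map hT.aemeasurable (measurable_X 0).aestronglyMeasurable]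

end

section

/-! ### Comparison of the mixing coefficients -/

section Coefficients

variable {Ω : Type*} {𝒜 ℬ mΩ : MeasurableSpace Ω} {P : Measure Ω} [IsProbabilityMeasure P]

theorem IsFinitePartition.sum_inter (h𝒜 : 𝒜 ≤ mΩ) {I : ℕ}
    {A : Fin I → Set Ω} (hA : IsFinitePartition 𝒜 A) (E : Set Ω) :
    ∑ i, P.real (A i ∩ E) = P.real E := by
  have h := measureReal_biUnion_finset (μ := P.restrict E) (s := Finset.univ) (f := A)
    (fun i _ j _ hij => hA.2.1 hij) (fun i _ => h𝒜 _ (hA.1 i))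
  have hr : ∀ i, (P.restrict E).real (A i) = P.real (A i ∩ E) := fun i =>
    measureReal_restrict_apply (h𝒜 _ (hA.1 i))
  simp only [Finset.mem_univ, Set.iUnion_true, hA.2.2, hr] at h
  rw [← h, measureReal_restrict_apply MeasurableSet.univ, Set.univ_inter]

/-- Boundedness guards against the junk value of the supremum that defines `betaDep`. -/
theorem betaDep_bddAbove (h𝒜 : 𝒜 ≤ mΩ) (hℬ : ℬ ≤ mΩ) :
    BddAbove {x : ℝ | ∃ (I J : ℕ) (A : Fin I → Set Ω) (B : Fin J → Set Ω),
      IsFinitePartition 𝒜 A ∧ IsFinitePartition ℬ B ∧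
      x = (1 / 2 : ℝ) * ∑ i, ∑ j, |P.real (A i ∩ B j) - P.real (A i) * P.real (B j)|} := by
  refine ⟨1, ?_⟩
  rintro x ⟨I, J, A, B, hA, hB, rfl⟩
  have hA1 : ∑ i, P.real (A i) = 1 := by simpa using hA.sum_inter (P := P) h𝒜 Set.univ
  have hB1 : ∑ j, P.real (B j) = 1 := by simpa using hB.sum_inter (P := P) hℬ Set.univ
  have h : ∑ i, ∑ j, |P.real (A i ∩ B j) - P.real (A i) * P.real (B j)|
      ≤ ∑ i, ∑ j, (P.real (B j ∩ A i) + P.real (A i) * P.real (B j)) := by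
    refine Finset.sum_le_sum fun i _ => Finset.sum_le_sum fun j _ => ?_
    rw [Set.inter_comm]
    refine (abs_sub _ _).trans_eq ?_
    rw [abs_of_nonneg measureReal_nonneg,
      abs_of_nonneg (mul_nonneg measureReal_nonneg measureReal_nonneg)]
  simp only [Finset.sum_add_distrib, hB.sum_inter hℬ, ← Finset.mul_sum, hB1, mul_one, hA1] at h
  linarith

theorem isFinitePartition_compl {A : Set Ω} (hA : MeasurableSet[𝒜] A) :
    IsFinitePartition 𝒜 ![A, Aᶜ] := by
  refine ⟨fun i => ?_, fun i j hij => ?_, ?_⟩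
  · fin_cases i
    · exact hA
    · exact hA.compl
  · fin_cases i <;> fin_cases j <;>
      first | exact absurd rfl hij | exact disjoint_compl_right | exact disjoint_compl_left
  · ext ω
    simpa [Fin.exists_fin_two] using em (ω ∈ A)

theorem alphaDep_le_betaDep (h𝒜 : 𝒜 ≤ mΩ) (hℬ : ℬ ≤ mΩ) :
    alphaDep P 𝒜 ℬ ≤ betaDep P 𝒜 ℬ := by
  refine csSup_le ⟨_, Set.univ, Set.univ, MeasurableSet.univ, MeasurableSet.univ, rfl⟩ ?_
  rintro x ⟨A, B, hA, hB, rfl⟩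
  refine le_trans ?_ (le_csSup (betaDep_bddAbove h𝒜 hℬ)
    ⟨2, 2, ![A, Aᶜ], ![B, Bᶜ], isFinitePartition_compl hA, isFinitePartition_compl hB, rfl⟩)
  simp only [Fin.sum_univ_two, Matrix.cons_val_zero, Matrix.cons_val_one]
  have hA' := h𝒜 _ hA
  have hB' := hℬ _ hB
  have e1 : P.real (A ∩ Bᶜ) = P.real A - P.real (A ∩ B) := by
    have := measureReal_inter_add_sdiff (μ := P) (s := A) hB'
    rw [Set.sdiff_eq] at this
    linarith
  have e2 : P.real (Aᶜ ∩ B) = P.real B - P.real (A ∩ B) := by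
    have := measureReal_inter_add_sdiff (μ := P) (s := B) hA'
    rw [Set.sdiff_eq, Set.inter_comm B A, Set.inter_comm B] at this
    linarith
  have e3 : P.real (Aᶜ ∩ Bᶜ) = P.real Aᶜ - P.real (Aᶜ ∩ B) := by
    have := measureReal_inter_add_sdiff (μ := P) (s := Aᶜ) hB'
    rw [Set.sdiff_eq] at this
    linarith
  rw [e3, e1, e2, probReal_compl_eq_one_sub hA', probReal_compl_eq_one_sub hB']
  set x := P.real (A ∩ B)
  set a := P.real A
  set b := P.real B
  have h1 : |a - x - a * (1 - b)| = |x - a * b| := by rw [← abs_neg]; ring_nf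
  have h2 : |b - x - (1 - a) * b| = |x - a * b| := by rw [← abs_neg]; ring_nf
  have h3 : |1 - a - (b - x) - (1 - a) * (1 - b)| = |x - a * b| := by ring_nf
  rw [h1, h2, h3]
  linarith [abs_nonneg (x - a * b)]

/-- A coupling bound: if `T` preserves `P`, makes every event of `ℬ` independent of `𝒜`, and
changes no event of `ℬ` off the event `D`, then `β(𝒜, ℬ) ≤ P(D)`. -/
theorem betaDep_le_of_coupling (h𝒜 : 𝒜 ≤ mΩ) (hℬ : ℬ ≤ mΩ)
    {T : Ω → Ω} (hT : MeasurePreserving T P P) {D : Set Ω} (hD : MeasurableSet D)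
    (hind : ∀ A B, MeasurableSet[𝒜] A → MeasurableSet[ℬ] B →
      P (A ∩ T ⁻¹' B) = P A * P (T ⁻¹' B))
    (heq : ∀ B, MeasurableSet[ℬ] B → ∀ ω ∉ D, (T ω ∈ B ↔ ω ∈ B)) :
    betaDep P 𝒜 ℬ ≤ P.real D := by
  refine Real.sSup_le ?_ measureReal_nonneg
  rintro x ⟨I, J, A, B, hA, hB, rfl⟩
  have hB' : IsFinitePartition mΩ fun j => T ⁻¹' B j :=
    ⟨fun j => hT.measurable (hℬ _ (hB.1 j)),
      fun i j hij => (hB.2.1 hij).preimage T, by rw [← Set.preimage_iUnion, hB.2.2]; simp⟩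
  have hterm : ∀ i j, |P.real (A i ∩ B j) - P.real (A i) * P.real (B j)|
      ≤ P.real (B j ∩ (A i ∩ D)) + P.real (T ⁻¹' B j ∩ (A i ∩ D)) := by
    intro i j
    have h1 : P.real (A i) * P.real (B j) = P.real (A i ∩ T ⁻¹' B j) := by
      have hp : P.real (T ⁻¹' B j) = P.real (B j) :=
        hT.measureReal_preimage (hℬ _ (hB.1 j)).nullMeasurableSet
      rw [← hp]
      simp only [measureReal_def, hind _ _ (hA.1 i) (hB.1 j), ENNReal.toReal_mul]
    have h2 := measureReal_inter_add_sdiff (μ := P) (s := (A i ∩ B j)) hD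
    have h3 := measureReal_inter_add_sdiff (μ := P) (s := (A i ∩ T ⁻¹' B j)) hD
    have h4 : (A i ∩ B j) \ D = (A i ∩ T ⁻¹' B j) \ D := by
      ext ω
      simp only [Set.mem_sdiff, Set.mem_inter_iff, Set.mem_preimage]
      exact ⟨fun ⟨⟨a, b⟩, c⟩ => ⟨⟨a, (heq _ (hB.1 j) ω c).2 b⟩, c⟩,
        fun ⟨⟨a, b⟩, c⟩ => ⟨⟨a, (heq _ (hB.1 j) ω c).1 b⟩, c⟩⟩
    have h5 : B j ∩ (A i ∩ D) = A i ∩ B j ∩ D := by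
      rw [← Set.inter_assoc, Set.inter_comm (B j)]
    have h6 : T ⁻¹' B j ∩ (A i ∩ D) = A i ∩ T ⁻¹' B j ∩ D := by
      rw [← Set.inter_assoc, Set.inter_comm (T ⁻¹' B j)]
    rw [h1, h5, h6, ← h2, ← h3, h4, add_sub_add_right_eq_sub]
    refine (abs_sub _ _).trans_eq ?_
    rw [abs_of_nonneg measureReal_nonneg, abs_of_nonneg measureReal_nonneg]
  have h : ∑ i, ∑ j, |P.real (A i ∩ B j) - P.real (A i) * P.real (B j)|
      ≤ ∑ i, ∑ j, (P.real (B j ∩ (A i ∩ D)) + P.real (T ⁻¹' B j ∩ (A i ∩ D))) :=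
    Finset.sum_le_sum fun i _ => Finset.sum_le_sum fun j _ => hterm i j
  simp only [Finset.sum_add_distrib, hB.sum_inter hℬ, hB'.sum_inter le_rfl, hA.sum_inter h𝒜] at h
  linarith

theorem iSup_comap_eq_comap {κ : Type*} (f : κ → Ω → ℝ) :
    (⨆ k, MeasurableSpace.comap (f k) inferInstance)
      = MeasurableSpace.comap (fun ω k => f k ω) MeasurableSpace.pi := by
  simp only [MeasurableSpace.pi, MeasurableSpace.comap_iSup, MeasurableSpace.comap_comp]
  rfl

end Coefficients

/-! ### The mixing rate -/

variable (R : Rates)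

theorem pastSigma_le (j : ℤ) : pastSigma X j ≤ (inferInstance : MeasurableSpace Noise) :=
  iSup_le fun k => (measurable_X k).comap_le

theorem futureSigma_le (j : ℤ) : futureSigma X j ≤ (inferInstance : MeasurableSpace Noise) :=
  iSup_le fun k => (measurable_X k).comap_le

theorem alphaMix_le_betaMix (n : ℕ) : alphaMix R.P X n ≤ betaMix R.P X n :=
  alphaDep_le_betaDep (pastSigma_le 0) (futureSigma_le n)

/-- The exchange of the values at time `0` with the spare values. -/
def spareIdx : Equiv.Perm Idx :=
  (Equiv.refl ℕ).prodCongr ((Equiv.refl ℤ).sumCongr (Equiv.swap none (some 0)))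

/-- The noise in which the values at time `0` are exchanged with the spare values. It makes the
future of the chains independent of their past. -/
def spare (ω : Noise) : Noise := fun x => ω (spareIdx x)

theorem measurePreserving_spare : MeasurePreserving spare R.P R.P := by
  refine measurePreserving_relabel R.noiseLaw spareIdx fun ⟨i, x⟩ => ?_
  rcases x with k | k <;> rfl

theorem spare_zero (ω : Noise) (i : ℕ) :
    spare ω (i, Sum.inr (some 0)) = ω (i, Sum.inr none) := by
  simp [spare, spareIdx]

theorem spare_inr (ω : Noise) (i : ℕ) {k : ℤ} (hk : k ≠ 0) :
    spare ω (i, Sum.inr (some k)) = ω (i, Sum.inr (some k)) := by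
  simp only [spare, spareIdx, Equiv.prodCongr_apply, Prod.map, Equiv.sumCongr_apply, Sum.map_inr]
  rw [Equiv.swap_apply_of_ne_of_ne (by simp) (by simpa using hk)]
  rfl

theorem dependsOn_fwd_spare (n : ℕ) : DependsOn (fun ω => fwd (spare ω) n) (beforeIdx 0)ᶜ := by
  intro ω ω' h
  funext i
  refine fwd_congr (fun j h1 hj => ?_) (fun j hj => ?_)
  · exact h (i, Sum.inl (j : ℤ)) (by rw [Set.mem_compl_iff, inl_mem_beforeIdx]; omega)
  · rcases Nat.eq_zero_or_pos j with rfl | hj0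
    · simp only [Nat.cast_zero, spare_zero]
      exact h _ (by simp [beforeIdx])
    · rw [spare_inr _ _ (by omega), spare_inr _ _ (by omega)]
      exact h _ (by rw [Set.mem_compl_iff, inr_mem_beforeIdx]; omega)

theorem fwd_spare_eq {ω : Noise} {i n : ℕ}
    (h : (∃ j : ℕ, 1 ≤ j ∧ j ≤ n ∧ ω (i, Sum.inl (j : ℤ)) = 1) ∨
      ω (i, Sum.inr none) = ω (i, Sum.inr (some 0))) :
    fwd (spare ω) n i = fwd ω n i := by
  induction n with
  | zero =>
    rcases h with ⟨j, h1, h2, _⟩ | h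
    · omega
    · simpa [fwd, spare_zero] using h
  | succ n ih =>
    have e : ∀ ω', fwd ω' (n + 1) i = if ω' (i, Sum.inl ((n : ℤ) + 1)) = 1
        then ω' (i, Sum.inr (some ((n : ℤ) + 1))) else fwd ω' n i := fun _ => rfl
    rw [e, e, spare_inr _ _ (by omega)]
    by_cases hm : ω (i, Sum.inl ((n : ℤ) + 1)) = 1
    · rw [if_pos hm, if_pos (show spare ω (i, Sum.inl ((n : ℤ) + 1)) = 1 from hm)]
    · rw [if_neg hm, if_neg (show spare ω (i, Sum.inl ((n : ℤ) + 1)) ≠ 1 from hm)]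
      refine ih (h.imp_left fun ⟨j, h1, h2, h3⟩ => ⟨j, h1, ?_, h3⟩)
      by_contra hj
      obtain rfl : j = n + 1 := by omega
      push_cast at h3
      exact hm h3

/-- Some chain has not been resampled between the times `0` and `n`, while its value at time `0`
or its spare value does not vanish. -/
def unmixed (n : ℕ) : Set Noise := ⋃ i : ℕ,
  ({ω | ∀ j : ℕ, 1 ≤ j → j ≤ n → ω (i, Sum.inl (j : ℤ)) ≠ 1} ∩
    ({ω | ω (i, Sum.inr (some 0)) ≠ 0} ∪ {ω | ω (i, Sum.inr none) ≠ 0}))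

theorem measurableSet_unmarked (i n : ℕ) :
    MeasurableSet {ω : Noise | ∀ j : ℕ, 1 ≤ j → j ≤ n → ω (i, Sum.inl (j : ℤ)) ≠ 1} := by
  have : {ω : Noise | ∀ j : ℕ, 1 ≤ j → j ≤ n → ω (i, Sum.inl (j : ℤ)) ≠ 1}
      = ⋂ j : ℕ, ⋂ _ : 1 ≤ j, ⋂ _ : j ≤ n, {ω | ω (i, Sum.inl (j : ℤ)) = 1}ᶜ := by ext; simp
  rw [this]
  exact MeasurableSet.iInter fun j => MeasurableSet.iInter fun _ => MeasurableSet.iInter fun _ =>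
    (measurableSet_coord_eq _ _).compl

theorem P_unmarked (i n : ℕ) :
    R.P {ω : Noise | ∀ j : ℕ, 1 ≤ j → j ≤ n → ω (i, Sum.inl (j : ℤ)) ≠ 1}
      = ENNReal.ofReal ((1 - R.q i) ^ n) := by
  have e : {ω : Noise | ∀ j : ℕ, 1 ≤ j → j ≤ n → ω (i, Sum.inl (j : ℤ)) ≠ 1}
      = Set.pi ((Finset.Icc 1 n).image fun j : ℕ => ((i, Sum.inl (j : ℤ)) : Idx))
        (fun _ => {1}ᶜ) := by
    ext ω
    simp only [Set.mem_ofPred_eq, Set.mem_pi, Finset.coe_image, Set.forall_mem_image,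
      Finset.coe_Icc, Set.mem_Icc, Set.mem_compl_iff, Set.mem_singleton_iff, and_imp]
  have hl : ∀ k : ℤ, R.noiseLaw (i, Sum.inl k) {1}ᶜ = ENNReal.ofReal (1 - R.q i) := fun k => by
    simp [Rates.noiseLaw, ternaryLaw]
  rw [e, Rates.P, Measure.infinitePi_pi _ fun _ _ => MeasurableSet.of_discrete,
    Finset.prod_image (fun a _ b _ h => by simpa using h)]
  simp only [hl, Finset.prod_const, Nat.card_Icc, Nat.add_sub_cancel]
  rw [ENNReal.ofReal_pow (by linarith [R.q_le i])]

theorem measurableSet_unmixed (n : ℕ) : MeasurableSet (unmixed n) :=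
  MeasurableSet.iUnion fun i => (measurableSet_unmarked i n).inter
    ((measurableSet_coord_ne _ _).union (measurableSet_coord_ne _ _))

theorem P_unmixed_le (n : ℕ) :
    R.P (unmixed n) ≤ ∑' i, ENNReal.ofReal ((1 - R.q i) ^ n * (2 * R.ε i)) := by
  refine (measure_iUnion_le _).trans (ENNReal.tsum_le_tsum fun i => ?_)
  rw [ENNReal.ofReal_mul (pow_nonneg (by linarith [R.q_le i]) _), ← P_unmarked, Rates.P,
    measure_inter_of_dependsOn R.noiseLaw (S := {x | x.2.isLeft}) (T := {x | x.2.isRight})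
    (Set.disjoint_left.2 fun ⟨_, x⟩ h h' => by cases x <;> simp at h h')
    (measurableSet_unmarked i n)
    ((measurableSet_coord_ne _ _).union (measurableSet_coord_ne _ _)) ?_ ?_]
  · refine mul_le_mul_right ((measure_union_le _ _).trans_eq ?_) _
    have h1 := P_val_ne_zero R i (some 0)
    have h2 := P_val_ne_zero R i none
    rw [Rates.P] at h1 h2
    rw [h1, h2, two_mul, ENNReal.ofReal_add (R.ε_pos i).le (R.ε_pos i).le]
  · intro ω ω' h
    simp only [Set.mem_ofPred_eq]
    refine propext (forall_congr' fun j => ?_)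
    rw [h (i, Sum.inl (j : ℤ)) (by simp)]
  · intro ω ω' h
    simp only [Set.mem_union, Set.mem_ofPred_eq]
    rw [h (i, Sum.inr (some 0)) (by simp), h (i, Sum.inr none) (by simp)]

/-- The future, run from the spare values in place of the values at time `0`, is a copy that is
independent of the past and differs from the original only on `unmixed n`. -/
theorem betaMix_le (n : ℕ) :
    betaMix R.P X n ≤ ∑' i, (1 - R.q i) ^ n * (2 * R.ε i) := by
  have hnn : ∀ i, 0 ≤ (1 - R.q i) ^ n * (2 * R.ε i) := fun i =>
    mul_nonneg (pow_nonneg (by linarith [R.q_le i]) _) (by linarith [R.ε_pos i])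
  have hsum : Summable fun i => (1 - R.q i) ^ n * (2 * R.ε i) :=
    Summable.of_nonneg_of_le hnn (fun i => mul_le_of_le_one_left (by linarith [R.ε_pos i])
      (pow_le_one₀ (by linarith [R.q_le i]) (by linarith [R.q_pos i]))) (R.summable_ε.mul_left 2)
  have hle : betaMix R.P X n ≤ R.P.real (unmixed n) := by
    refine betaDep_le_of_coupling (pastSigma_le 0) (futureSigma_le n)
      (measurePreserving_spare R) (measurableSet_unmixed n) ?_ ?_
    · intro A B hA hB
      have hA' := pastSigma_le 0 _ hA
      have hB' := futureSigma_le n _ hB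
      rw [pastSigma, iSup_comap_eq_comap (fun k : {k : ℤ // k ≤ 0} => X k)] at hA
      rw [futureSigma, iSup_comap_eq_comap (fun k : {k : ℤ // (n : ℤ) ≤ k} => X k)] at hB
      obtain ⟨A', _, rfl⟩ := hA
      obtain ⟨B', _, rfl⟩ := hB
      refine measure_inter_of_dependsOn R.noiseLaw disjoint_compl_right hA'
        ((measurePreserving_spare R).measurable hB') (S := beforeIdx 0) ?_ ?_
      · intro ω ω' h
        have : (fun k : {k : ℤ // k ≤ 0} => X k ω) = fun k : {k : ℤ // k ≤ 0} => X k ω' :=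
          funext fun k => dependsOn_X le_rfl k.2 h
        simp only [Set.mem_preimage, this]
      · intro ω ω' h
        have : (fun k : {k : ℤ // (n : ℤ) ≤ k} => X k (spare ω))
            = fun k : {k : ℤ // (n : ℤ) ≤ k} => X k (spare ω') := by
          funext ⟨k, hk⟩
          obtain ⟨m, rfl⟩ := Int.eq_ofNat_of_zero_le (show 0 ≤ k by omega)
          simp only [X, chain_natCast]
          exact congrArg obs (dependsOn_fwd_spare m h)
        simp only [Set.mem_preimage, this]
    · intro B hB ω hω
      rw [futureSigma, iSup_comap_eq_comap (fun k : {k : ℤ // (n : ℤ) ≤ k} => X k)] at hB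
      obtain ⟨B', _, rfl⟩ := hB
      have : (fun k : {k : ℤ // (n : ℤ) ≤ k} => X k (spare ω))
          = fun k : {k : ℤ // (n : ℤ) ≤ k} => X k ω := by
        funext ⟨k, hk⟩
        obtain ⟨m, rfl⟩ := Int.eq_ofNat_of_zero_le (show 0 ≤ k by omega)
        simp only [X, chain_natCast]
        refine congrArg obs (funext fun i => fwd_spare_eq ?_)
        simp only [unmixed, Set.mem_iUnion, Set.mem_inter_iff, Set.mem_union, Set.mem_ofPred_eq,
          not_exists, not_and, not_or, not_not] at hω
        by_cases hm : ∃ j : ℕ, 1 ≤ j ∧ j ≤ n ∧ ω (i, Sum.inl (j : ℤ)) = 1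
        · obtain ⟨j, h1, h2, h3⟩ := hm
          exact Or.inl ⟨j, h1, by omega, h3⟩
        · push Not at hm
          obtain ⟨h1, h2⟩ := hω i hm
          exact Or.inr (by rw [h1, h2])
      simp only [Set.mem_preimage, this]
  refine hle.trans ?_
  rw [measureReal_def]
  refine ENNReal.toReal_le_of_le_ofReal (tsum_nonneg hnn) ?_
  rw [ENNReal.ofReal_tsum_of_nonneg hnn hsum]
  exact P_unmixed_le R n

end

/-! ### The transfer recursion of a three-state chain -/

/-- The relative decay rate of the characteristic function of the sums of a chain with resampling
probability `q`, at the frequency `θ`. -/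
def decay (q θ : ℝ) : ℝ :=
  (1 - Real.cos θ) * (2 - q) / (q ^ 2 + 2 * (1 - q) * (1 - Real.cos θ))

section Transfer

variable {q ε θ : ℝ}

theorem decay_nonneg (hq1 : q ≤ 1) : 0 ≤ decay q θ := by
  have := Real.cos_le_one θ
  unfold decay
  apply div_nonneg
  · apply mul_nonneg <;> linarith
  · have := mul_nonneg (sub_nonneg.2 hq1) (sub_nonneg.2 this)
    nlinarith

theorem norm_mul_div_le_one (hq : 0 < q) (hq1 : q ≤ 1) {z : ℂ} (hz : ‖z‖ = 1) :
    1 - (1 - q : ℂ) * z ≠ 0 ∧ ‖(q : ℂ) * z / (1 - (1 - q) * z)‖ ≤ 1 := by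
  have hn : ‖(1 - q : ℂ) * z‖ = 1 - q := by
    rw [norm_mul, hz, mul_one, ← Complex.ofReal_one, ← Complex.ofReal_sub, Complex.norm_real,
      Real.norm_of_nonneg (by linarith)]
  have h : q ≤ ‖1 - (1 - q : ℂ) * z‖ := by
    have := norm_sub_norm_le (1 : ℂ) ((1 - q : ℂ) * z)
    rw [hn, norm_one] at this
    linarith
  have hpos : 0 < ‖1 - (1 - q : ℂ) * z‖ := hq.trans_le h
  refine ⟨norm_pos_iff.1 hpos, ?_⟩
  rw [norm_div, norm_mul, hz, mul_one, Complex.norm_real, Real.norm_of_nonneg hq.le]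
  exact (div_le_one hpos).2 h

theorem average_eq_one_sub_decay (hq : 0 < q) (hq1 : q ≤ 1) {z z' : ℂ} (hz : ‖z‖ = 1)
    (hz' : ‖z'‖ = 1) (hzz : z * z' = 1) (hadd : z + z' = 2 * Real.cos θ) :
    ((q : ℂ) * z / (1 - (1 - q) * z) + (q : ℂ) * z' / (1 - (1 - q) * z')) / 2
      = 1 - decay q θ := by
  have h1 := (norm_mul_div_le_one hq hq1 hz).1
  have h2 := (norm_mul_div_le_one hq hq1 hz').1
  have hD : (1 - (1 - q : ℂ) * z) * (1 - (1 - q) * z')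
      = ((q ^ 2 + 2 * (1 - q) * (1 - Real.cos θ) : ℝ) : ℂ) := by
    push_cast at hadd ⊢
    linear_combination (1 - q : ℂ) ^ 2 * hzz - (1 - q : ℂ) * hadd
  have hD0 : ((q ^ 2 + 2 * (1 - q) * (1 - Real.cos θ) : ℝ) : ℂ) ≠ 0 := by
    rw [← hD]; exact mul_ne_zero h1 h2
  rw [div_add_div _ _ h1 h2, hD, decay, Complex.ofReal_div, div_div, eq_sub_iff_add_eq]
  rw [mul_comm _ (2 : ℂ), ← div_div, ← add_div, div_eq_one_iff_eq hD0]
  push_cast at hadd ⊢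
  linear_combination (-(q : ℂ) * (1 - q)) * hzz + (q / 2 : ℂ) * hadd

/-- Here `u n` is the characteristic function, at the frequency `θ`, of the sum of a three-state
chain over `n` time units, `x n`, `y n` and `y' n` are the conditional ones given that the chain
ends in `0`, `1` and `-1`, and `z = exp (i θ)`.

The recursion has one slow direction, in which it decays by the factor `1 - q ε γ` per step,
where `γ` is `decay q θ`. The deviations of `y` and `y'` from that direction contract by the factor
`1 - q / 2` and are driven by a term of size `q ε γ`, which keeps the error of order `ε` uniformly
in the number of steps. -/
theorem transfer_estimate (hq : 0 < q) (hq1 : q ≤ 1) (hε : 0 < ε) (hε1 : ε ≤ 1 / 4)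
    {z z' : ℂ} (hz : ‖z‖ = 1) (hz' : ‖z'‖ = 1) (hzz : z * z' = 1)
    (hadd : z + z' = 2 * Real.cos θ) {x y y' u : ℕ → ℂ}
    (hu : ∀ n, u n = (1 - ε) * x n + ε / 2 * (y n + y' n))
    (hx0 : x 0 = 1) (hy0 : y 0 = 1) (hy0' : y' 0 = 1)
    (hx : ∀ n, x (n + 1) = (1 - q) * x n + q * u n)
    (hy : ∀ n, y (n + 1) = z * ((1 - q) * y n + q * u n))
    (hy' : ∀ n, y' (n + 1) = z' * ((1 - q) * y' n + q * u n)) (n : ℕ) :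
    ‖u n - ((1 - q * ε * decay q θ : ℝ) : ℂ) ^ n‖ ≤ 10 * ε := by
  have hnc : ∀ r : ℝ, 0 ≤ r → ‖(r : ℂ)‖ = r := fun r hr => by
    rw [Complex.norm_real, Real.norm_of_nonneg hr]
  have hnq : ‖(q : ℂ)‖ = q := hnc q hq.le
  have hnε : ‖(ε : ℂ)‖ = ε := hnc ε hε.le
  have hnq1 : ‖(1 - q : ℂ)‖ = 1 - q := by
    have := hnc (1 - q) (by linarith); push_cast at this; exact this
  have hnε1 : ‖(1 - ε : ℂ)‖ = 1 - ε := by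
    have := hnc (1 - ε) (by linarith); push_cast at this; exact this
  have hnε2 : ‖(ε / 2 : ℂ)‖ = ε / 2 := by
    have := hnc (ε / 2) (by linarith); push_cast at this; exact this
  set γ := decay q θ with hγ
  have hγ0 : 0 ≤ γ := decay_nonneg hq1
  -- In the slow direction, `y = κ x` and `y' = κ' x` to leading order.
  set κ : ℂ := q * z / (1 - (1 - q) * z) with hκ
  set κ' : ℂ := q * z' / (1 - (1 - q) * z') with hκ'
  obtain ⟨hne, hκ1⟩ := norm_mul_div_le_one hq hq1 hz
  obtain ⟨hne', hκ1'⟩ := norm_mul_div_le_one hq hq1 hz'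
  have hκe : κ = (1 - q) * z * κ + q * z := by
    linear_combination div_mul_cancel₀ ((q : ℂ) * z) hne
  have hκe' : κ' = (1 - q) * z' * κ' + q * z' := by
    linear_combination div_mul_cancel₀ ((q : ℂ) * z') hne'
  have hav : (κ + κ') / 2 = 1 - γ := average_eq_one_sub_decay hq hq1 hz hz' hzz hadd
  have hγ2 : γ ≤ 2 := by
    have h1 : ‖(κ + κ') / 2‖ ≤ 1 := by
      rw [norm_div, Complex.norm_ofNat]
      have := norm_add_le κ κ'
      linarith
    rw [hav, ← Complex.ofReal_one, ← Complex.ofReal_sub, Complex.norm_real, Real.norm_eq_abs] at h1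
    linarith [(abs_le.1 h1).1]
  have hbd : ∀ n, ‖x n‖ ≤ 1 ∧ ‖y n‖ ≤ 1 ∧ ‖y' n‖ ≤ 1 := by
    intro n
    induction n with
    | zero => simp [hx0, hy0, hy0']
    | succ n ih =>
      obtain ⟨h1, h2, h3⟩ := ih
      have hun : ‖u n‖ ≤ 1 := by
        rw [hu]
        refine (norm_add_le _ _).trans ?_
        rw [norm_mul, norm_mul, hnε1, hnε2]
        have h4 := norm_add_le (y n) (y' n)
        have h5 := mul_le_mul_of_nonneg_left h1 (show 0 ≤ 1 - ε by linarith)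
        have h6 := mul_le_mul_of_nonneg_left (h4.trans (add_le_add h2 h3))
          (show 0 ≤ ε / 2 by linarith)
        linarith
      have key : ∀ a : ℂ, ‖a‖ ≤ 1 → ‖(1 - q) * a + q * u n‖ ≤ 1 := fun a ha => by
        refine (norm_add_le _ _).trans ?_
        rw [norm_mul, norm_mul, hnq1, hnq]
        have h5 := mul_le_mul_of_nonneg_left ha (show 0 ≤ 1 - q by linarith)
        have h6 := mul_le_mul_of_nonneg_left hun hq.le
        linarith
      refine ⟨by rw [hx]; exact key _ h1, ?_, ?_⟩
      · rw [hy, norm_mul, hz, one_mul]; exact key _ h2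
      · rw [hy', norm_mul, hz', one_mul]; exact key _ h3
  set d : ℕ → ℂ := fun n => y n - κ * x n with hd
  set d' : ℕ → ℂ := fun n => y' n - κ' * x n with hd'
  set w : ℕ → ℂ := fun n => γ * x n - (d n + d' n) / 2 with hw
  set δ : ℕ → ℝ := fun n => (‖d n‖ + ‖d' n‖) / 2 with hδ
  have huw : ∀ n, u n = x n - ε * w n := fun n => by
    simp only [hw, hd, hd', hu]
    linear_combination (ε * x n) * hav
  have hxw : ∀ n, x (n + 1) = x n - q * ε * w n := fun n => by
    rw [hx, huw]; ring
  have hwδ : ∀ n, ‖w n‖ ≤ γ + δ n := fun n => by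
    simp only [hw, hδ]
    refine (norm_sub_le _ _).trans ?_
    rw [norm_mul, norm_div, Complex.norm_ofNat, hnc γ hγ0]
    have h1 := mul_le_mul_of_nonneg_left (hbd n).1 hγ0
    have h2 := norm_add_le (d n) (d' n)
    linarith
  have hstep : ∀ n, ∀ (ζ k D : ℂ), ‖ζ‖ = 1 → ‖k‖ ≤ 1 →
      ‖(1 - q) * ζ * D + (k * (q * ε * w n) - q * ζ * (ε * w n))‖
        ≤ (1 - q) * ‖D‖ + 2 * q * ε * ‖w n‖ := by
    intro n ζ k D hζ hk
    refine (norm_add_le _ _).trans ?_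
    have h1 : ‖(1 - q) * ζ * D‖ = (1 - q) * ‖D‖ := by rw [norm_mul, norm_mul, hnq1, hζ, mul_one]
    have h2 : ‖k * (q * ε * w n)‖ ≤ q * ε * ‖w n‖ := by
      rw [norm_mul, norm_mul, norm_mul, hnq, hnε]
      exact mul_le_of_le_one_left (by positivity) hk
    have h3 : ‖q * ζ * (ε * w n)‖ = q * ε * ‖w n‖ := by
      rw [norm_mul, norm_mul, norm_mul, hnq, hnε, hζ]; ring
    have h4 := norm_sub_le (k * (q * ε * w n)) (q * ζ * (ε * w n))
    linarith
  have hδs : ∀ n, δ (n + 1) ≤ (1 - q / 2) * δ n + 2 * q * ε * γ := by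
    intro n
    have h1 : d (n + 1) = (1 - q) * z * d n + (κ * (q * ε * w n) - q * z * (ε * w n)) := by
      simp only [hd]
      rw [hy, huw, hxw]
      linear_combination (-x n) * hκe
    have h2 : d' (n + 1) = (1 - q) * z' * d' n + (κ' * (q * ε * w n) - q * z' * (ε * w n)) := by
      simp only [hd']
      rw [hy', huw, hxw]
      linear_combination (-x n) * hκe'
    have h3 := hstep n z κ (d n) hz hκ1
    have h4 := hstep n z' κ' (d' n) hz' hκ1'
    rw [← h1] at h3
    rw [← h2] at h4
    have hqε : 0 ≤ 2 * q * ε := by positivity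
    have h5 := mul_le_mul_of_nonneg_left (hwδ n) hqε
    have hδ0 : 0 ≤ δ n := by positivity
    have h6 : 2 * q * ε * δ n ≤ q / 2 * δ n := by
      apply mul_le_mul_of_nonneg_right _ hδ0
      nlinarith
    have h7 : δ (n + 1) ≤ (1 - q) * δ n + 2 * q * ε * ‖w n‖ := by
      simp only [hδ]; linarith
    linarith
  have hδb : ∀ n, δ n ≤ 2 * (1 - q / 2) ^ n + 4 * ε * γ := by
    intro n
    induction n with
    | zero =>
      have h1 : ‖d 0‖ ≤ 2 := by
        simp only [hd, hy0, hx0]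
        refine (norm_sub_le _ _).trans ?_
        rw [norm_one, mul_one]; linarith
      have h2 : ‖d' 0‖ ≤ 2 := by
        simp only [hd', hy0', hx0]
        refine (norm_sub_le _ _).trans ?_
        rw [norm_one, mul_one]; linarith
      have : 0 ≤ 4 * ε * γ := by positivity
      simp only [hδ, pow_zero]
      linarith
    | succ n ih =>
      have h1 := hδs n
      have h2 := mul_le_mul_of_nonneg_left ih (show 0 ≤ 1 - q / 2 by linarith)
      rw [pow_succ]
      nlinarith
  set r : ℝ := 1 - q * ε * γ with hr
  have hqεγ : 0 ≤ q * ε * γ := by positivity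
  have hr0 : 0 ≤ r := by
    have : q * ε * γ ≤ 1 * (1 / 4) * 2 := by gcongr
    linarith
  have hE : ∀ n, ‖x n - (r : ℂ) ^ n‖ ≤ 4 * ε * (1 - (1 - q / 2) ^ n) + 4 * ε := by
    intro n
    induction n with
    | zero => simp [hx0, hε.le]
    | succ n ih =>
      have h1 : x (n + 1) - (r : ℂ) ^ (n + 1)
          = r * (x n - (r : ℂ) ^ n) + q * ε * ((d n + d' n) / 2) := by
        rw [hxw, hr]
        simp only [hw]
        push_cast
        ring
      have h2 : ‖q * ε * ((d n + d' n) / 2)‖ ≤ q * ε * δ n := by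
        rw [norm_mul, norm_mul, hnq, hnε, norm_div, Complex.norm_ofNat]
        have := norm_add_le (d n) (d' n)
        refine mul_le_mul_of_nonneg_left ?_ (by positivity)
        simp only [hδ]
        linarith
      have h3 : ‖x (n + 1) - (r : ℂ) ^ (n + 1)‖ ≤ r * ‖x n - (r : ℂ) ^ n‖ + q * ε * δ n := by
        rw [h1]
        refine (norm_add_le _ _).trans ?_
        rw [norm_mul (r : ℂ), hnc r hr0]
        linarith
      have h4 := mul_le_mul_of_nonneg_left ih hr0
      have h5 := mul_le_mul_of_nonneg_left (hδb n) (show 0 ≤ q * ε by positivity)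
      have hs : (1 - q / 2) ^ n ≤ 1 := pow_le_one₀ (by linarith) (by linarith)
      have h6 : r * (4 * ε * (1 - (1 - q / 2) ^ n)) ≤ 4 * ε * (1 - (1 - q / 2) ^ n) :=
        mul_le_of_le_one_left (mul_nonneg (by positivity) (by linarith)) (by linarith)
      have h7 : r * (4 * ε) = 4 * ε - 4 * q * ε ^ 2 * γ := by rw [hr]; ring
      have hp : (1 - q / 2) ^ (n + 1) = (1 - q / 2) ^ n * (1 - q / 2) := pow_succ _ _
      rw [hp]
      linarith
  have hw2 : ‖ε * w n‖ ≤ 2 * ε := by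
    have h1 : ε * w n = ε * (x n - (y n + y' n) / 2) := by
      simp only [hw, hd, hd']
      linear_combination (ε * x n) * hav
    rw [h1, norm_mul, hnε]
    have h2 := norm_sub_le (x n) ((y n + y' n) / 2)
    rw [norm_div, Complex.norm_ofNat] at h2
    have h3 := norm_add_le (y n) (y' n)
    obtain ⟨h4, h5, h6⟩ := hbd n
    nlinarith
  have h8 : u n - (r : ℂ) ^ n = (x n - (r : ℂ) ^ n) - ε * w n := by rw [huw]; ring
  rw [h8]
  refine (norm_sub_le _ _).trans ?_
  have h9 := hE n
  have h10 : 0 ≤ (1 - q / 2) ^ n := pow_nonneg (by linarith) _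
  nlinarith

end Transfer

section

variable (R : Rates)

/-! ### Sums along a single chain -/

/-- The sum of the `i`-th chain over the times `1, …, n`. -/
def coordSum (i n : ℕ) (ω : Noise) : ℝ := ∑ k ∈ Finset.Icc 1 n, (chain ω (k : ℤ) i : ℝ)

theorem measurable_chain_coord (i : ℕ) (k : ℤ) : Measurable fun ω => chain ω k i :=
  measurable_pi_iff.1 (measurable_chain k) i

theorem measurable_coordSum (i n : ℕ) : Measurable (coordSum i n) :=
  Finset.measurable_sum _ fun k _ =>
    (Measurable.of_discrete (f := fun s : SignType => (s : ℝ))).comp (measurable_chain_coord i k)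

theorem coordSum_succ (i n : ℕ) (ω : Noise) :
    coordSum i (n + 1) ω = coordSum i n ω + (chain ω ((n : ℤ) + 1) i : ℝ) := by
  rw [coordSum, Finset.sum_Icc_succ_top (by omega), coordSum]
  push_cast
  rfl

theorem abs_coordSum_le (i n : ℕ) (ω : Noise) : |coordSum i n ω| ≤ n := by
  refine (Finset.abs_sum_le_sum_abs _ _).trans ((Finset.sum_le_sum fun k _ =>
    abs_signType_le _).trans ?_)
  simp

theorem dependsOn_coordSum (i n : ℕ) : DependsOn (coordSum i n) (beforeIdx n) := by
  intro ω ω' h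
  refine Finset.sum_congr rfl fun k hk => ?_
  have hk' := (Finset.mem_Icc.1 hk).2
  have e : chain ω k = chain ω' k := dependsOn_chain (n := n) (by omega) (by omega) h
  rw [e]

theorem integral_coord {E : Type*} [NormedAddCommGroup E] [NormedSpace ℝ E] (x : Idx)
    (G : SignType → E) : ∫ ω, G (ω x) ∂(R.P) = ∫ s, G s ∂(R.noiseLaw x) := by
  have h := measurePreserving_eval_infinitePi R.noiseLaw x
  rw [← h.map_eq, integral_map h.aemeasurable
    (StronglyMeasurable.of_discrete (f := G)).aestronglyMeasurable]
  rfl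

theorem integral_val {E : Type*} [NormedAddCommGroup E] [NormedSpace ℝ E] [CompleteSpace E]
    (i : ℕ) (o : Option ℤ) (G : SignType → E) : ∫ ω, G (ω (i, Sum.inr o)) ∂(R.P) =
      (R.ε i / 2) • G 1 + (R.ε i / 2) • G (-1) + (1 - R.ε i) • G 0 := by
  have h1 := R.ε_pos i
  have h2 := R.ε_le i
  rw [integral_coord, Rates.noiseLaw, integral_ternaryLaw (by linarith) (by linarith)
    (by linarith)]
  congr 2
  ring

theorem integrable_coord {E : Type*} [NormedAddCommGroup E] (x : Idx) (G : SignType → E) :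
    Integrable (fun ω : Noise => G (ω x)) R.P := by
  refine Integrable.of_bound (C := ‖G 0‖ + ‖G 1‖ + ‖G (-1)‖) ?_ (ae_of_all _ fun ω => ?_)
  · exact (StronglyMeasurable.of_discrete (f := G)).aestronglyMeasurable.comp_measurable
      (measurable_pi_apply x)
  · have h0 := norm_nonneg (G 0)
    have h1 := norm_nonneg (G 1)
    have h2 := norm_nonneg (G (-1))
    change ‖G (ω x)‖ ≤ _
    generalize ω x = s
    have : s = 0 ∨ s = 1 ∨ s = -1 := by revert s; decide
    rcases this with rfl | rfl | rfl <;> linarith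

theorem integral_mul_of_dependsOn {𝕜 : Type*} [RCLike 𝕜] {S T : Set Idx} (hST : Disjoint S T)
    {f g : Noise → 𝕜} (hf : Measurable f) (hg : Measurable g) (hfS : DependsOn f S)
    (hgT : DependsOn g T) :
    ∫ ω, f ω * g ω ∂(R.P) = (∫ ω, f ω ∂(R.P)) * ∫ ω, g ω ∂(R.P) :=
  (indepFun_of_dependsOn R.noiseLaw hST hf hg hfS hgT).integral_fun_mul_eq_mul_integral
    hf.aestronglyMeasurable hg.aestronglyMeasurable

/-- At each step the chain keeps its value with probability `1 - q`, and is otherwise resampled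
independently of its past. -/
theorem integral_mul_chain_succ {𝕜 : Type*} [RCLike 𝕜] (i n : ℕ) {H : Noise → 𝕜}
    (hH : Measurable H) {C : ℝ} (hHC : ∀ ω, ‖H ω‖ ≤ C) (hHn : DependsOn H (beforeIdx n))
    (G : SignType → 𝕜) :
    ∫ ω, H ω * G (chain ω ((n : ℤ) + 1) i) ∂(R.P) =
      (1 - R.q i) • ∫ ω, H ω * G (chain ω n i) ∂(R.P) +
      R.q i • ((∫ ω, H ω ∂(R.P)) *
        ((R.ε i / 2) • G 1 + (R.ε i / 2) • G (-1) + (1 - R.ε i) • G 0)) := by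
  set a : SignType → 𝕜 := fun s => if s = 1 then 1 else 0 with ha
  set b : SignType → 𝕜 := fun s => if s = 1 then 0 else 1 with hb
  set x : Idx := (i, Sum.inl ((n : ℤ) + 1)) with hx
  set y : Idx := (i, Sum.inr (some ((n : ℤ) + 1))) with hy
  have hxb : x ∉ beforeIdx n := by rw [hx, inl_mem_beforeIdx]; omega
  have hyb : y ∉ beforeIdx n := by rw [hy, inr_mem_beforeIdx]; omega
  have hGm : Measurable G := Measurable.of_discrete
  have hcoord : ∀ (z : Idx) (f : SignType → 𝕜), Measurable fun ω : Noise => f (ω z) := fun z f =>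
    (Measurable.of_discrete (f := f)).comp (measurable_pi_apply z)
  have hdz : ∀ (z : Idx) (f : SignType → 𝕜), DependsOn (fun ω : Noise => f (ω z)) {z} :=
    fun z f ω ω' h => by simp only [h z rfl]
  have hGn : Measurable fun ω => G (chain ω n i) := hGm.comp (measurable_chain_coord i n)
  have hsplit : ∀ ω, H ω * G (chain ω ((n : ℤ) + 1) i)
      = (H ω * G (chain ω n i)) * b (ω x) + H ω * (a (ω x) * G (ω y)) := fun ω => by
    rw [chain_succ ω (by omega)]
    by_cases h : ω x = 1
    · simp only [ha, hb, h, ← hx, ← hy, if_true]; ring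
    · simp only [ha, hb, h, ← hx, ← hy, if_false]; ring
  have hintH : ∀ f : Noise → 𝕜, Integrable f R.P → Integrable (fun ω => H ω * f ω) R.P :=
    fun f hf => hf.bdd_mul hH.aestronglyMeasurable (ae_of_all _ hHC)
  have hb1 : ∀ s, ‖b s‖ ≤ 1 := fun s => by simp only [hb]; split_ifs <;> simp
  have ha1 : ∀ s, ‖a s‖ ≤ 1 := fun s => by simp only [ha]; split_ifs <;> simp
  have hGC : ∀ s, ‖G s‖ ≤ ‖G 0‖ + ‖G 1‖ + ‖G (-1)‖ := fun s => by
    have h0 := norm_nonneg (G 0)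
    have h1 := norm_nonneg (G 1)
    have h2 := norm_nonneg (G (-1))
    have : s = 0 ∨ s = 1 ∨ s = -1 := by revert s; decide
    rcases this with rfl | rfl | rfl <;> linarith
  have hi1 : Integrable (fun ω => (H ω * G (chain ω n i)) * b (ω x)) R.P :=
    (hintH _ (Integrable.of_bound hGn.aestronglyMeasurable _ (ae_of_all _ fun ω => hGC _))).mul_bdd
      (c := 1) (hcoord x b).aestronglyMeasurable (ae_of_all _ fun ω => hb1 _)
  have hi2 : Integrable (fun ω => H ω * (a (ω x) * G (ω y))) R.P :=
    hintH _ ((integrable_coord R y G).bdd_mul (hcoord x a).aestronglyMeasurable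
      (ae_of_all _ fun ω => ha1 _))
  have hd1 : DependsOn (fun ω => H ω * G (chain ω n i)) (beforeIdx n) := fun ω ω' h => by
    simp only [hHn h, dependsOn_chain (n := n) (k := n) (by omega) le_rfl h]
  have e1 : ∫ ω, (H ω * G (chain ω n i)) * b (ω x) ∂(R.P)
      = (∫ ω, H ω * G (chain ω n i) ∂(R.P)) * ∫ ω, b (ω x) ∂(R.P) :=
    integral_mul_of_dependsOn R (Set.disjoint_singleton_right.2 hxb) (hH.mul hGn) (hcoord x b) hd1
      (hdz x b)
  have e2 : ∫ ω, H ω * (a (ω x) * G (ω y)) ∂(R.P)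
      = (∫ ω, H ω ∂(R.P)) * ∫ ω, a (ω x) * G (ω y) ∂(R.P) :=
    integral_mul_of_dependsOn R (T := {x, y})
      (Set.disjoint_right.2 fun z hz => by
        rcases hz with rfl | rfl
        · exact hxb
        · exact hyb) hH ((hcoord x a).mul (hcoord y G)) hHn
      (fun ω ω' h => by
        rw [h x (by simp), h y (by simp)])
  have e3 : ∫ ω, a (ω x) * G (ω y) ∂(R.P) = (∫ ω, a (ω x) ∂(R.P)) * ∫ ω, G (ω y) ∂(R.P) :=
    integral_mul_of_dependsOn R (Set.disjoint_singleton.2 (by simp [hx, hy])) (hcoord x a)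
      (hcoord y G) (hdz x a) (hdz y G)
  have hq0 := (R.q_pos i).le
  have hq1 := R.q_le i
  have hib : ∫ ω, b (ω x) ∂(R.P) = ((1 - R.q i : ℝ) : 𝕜) := by
    rw [integral_coord, hx, Rates.noiseLaw, integral_ternaryLaw hq0 le_rfl (by linarith)]
    simp [hb, Algebra.smul_def]
  have hia : ∫ ω, a (ω x) ∂(R.P) = (R.q i : 𝕜) := by
    rw [integral_coord, hx, Rates.noiseLaw, integral_ternaryLaw hq0 le_rfl (by linarith)]
    simp [ha, Algebra.smul_def]
  simp only [hsplit]
  rw [integral_add hi1 hi2, e1, e2, e3, hib, hia, hy, integral_val]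
  simp only [RCLike.real_smul_eq_coe_mul]
  ring

/-- The sums along the `i`-th chain have second moment at most `2 n ε / q`. -/
theorem integral_coordSum_sq_le (i n : ℕ) :
    ∫ ω, coordSum i n ω ^ 2 ∂(R.P) ≤ 2 * n * (R.ε i / R.q i) := by
  have hq0 := R.q_pos i
  have hq1 := R.q_le i
  have hε := R.ε_pos i
  have hsq : ∀ n : ℕ, ∫ ω, ((chain ω n i : SignType) : ℝ) ^ 2 ∂(R.P) = R.ε i := by
    intro n
    induction n with
    | zero =>
      have := integral_val R i (some 0) (fun s => (s : ℝ) ^ 2)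
      simp only [Nat.cast_zero, chain_zero]
      rw [this]
      simp
    | succ n ih =>
      have := integral_mul_chain_succ R i n (H := fun _ => (1 : ℝ)) measurable_const (C := 1)
        (by simp) (fun _ _ _ => rfl) (fun s => (s : ℝ) ^ 2)
      simp only [one_mul, ih] at this
      push_cast
      rw [this]
      simp
      ring
  have hint : ∀ f : Noise → ℝ, Measurable f → ∀ C, (∀ ω, |f ω| ≤ C) → Integrable f R.P :=
    fun f hf C hC => Integrable.of_bound hf.aestronglyMeasurable C (ae_of_all _ hC)
  have hVm : ∀ k : ℤ, Measurable fun ω => ((chain ω k i : SignType) : ℝ) := fun k =>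
    (Measurable.of_discrete (f := fun s : SignType => (s : ℝ))).comp (measurable_chain_coord i k)
  have hmulbd : ∀ (n : ℕ) (k : ℤ) ω, |coordSum i n ω * ((chain ω k i : SignType) : ℝ)| ≤ n :=
    fun n k ω => by
      rw [abs_mul]
      exact (mul_le_of_le_one_right (abs_nonneg _) (abs_signType_le _)).trans
        (abs_coordSum_le _ _ _)
  have hcross : ∀ n, ∫ ω, coordSum i n ω * ((chain ω ((n : ℤ) + 1) i : SignType) : ℝ) ∂(R.P)
      = (1 - R.q i) * ∫ ω, coordSum i n ω * ((chain ω n i : SignType) : ℝ) ∂(R.P) := fun n => by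
    have := integral_mul_chain_succ R i n (measurable_coordSum i n) (abs_coordSum_le i n)
      (dependsOn_coordSum i n) (fun s => (s : ℝ))
    rw [this]
    simp
  have hsqint : ∀ k : ℤ, Integrable (fun ω => ((chain ω k i : SignType) : ℝ) ^ 2) R.P := fun k =>
    hint _ ((hVm k).pow_const 2) 1 fun ω => by
      rw [abs_pow]; exact pow_le_one₀ (abs_nonneg _) (abs_signType_le _)
  have hcint : ∀ (n : ℕ) (k : ℤ),
      Integrable (fun ω => coordSum i n ω * ((chain ω k i : SignType) : ℝ)) R.P := fun n k =>
    hint _ ((measurable_coordSum i n).mul (hVm k)) n (hmulbd n k)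
  have hm : ∀ n : ℕ, ∫ ω, coordSum i n ω * ((chain ω n i : SignType) : ℝ) ∂(R.P)
      ≤ R.ε i / R.q i := by
    intro n
    induction n with
    | zero => simp [coordSum]; positivity
    | succ n ih =>
      have e : ∀ ω, coordSum i (n + 1) ω * ((chain ω ((n + 1 : ℕ) : ℤ) i : SignType) : ℝ)
          = coordSum i n ω * ((chain ω ((n : ℤ) + 1) i : SignType) : ℝ)
            + ((chain ω ((n : ℤ) + 1) i : SignType) : ℝ) ^ 2 := fun ω => by
        rw [coordSum_succ]; push_cast; ring
      have h2 := hsq (n + 1)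
      push_cast at h2
      simp only [e]
      rw [integral_add (hcint _ _) (hsqint _), hcross, h2]
      have h3 := mul_le_mul_of_nonneg_left ih (show 0 ≤ 1 - R.q i by linarith)
      have h4 : (1 - R.q i) * (R.ε i / R.q i) + R.ε i = R.ε i / R.q i := by field_simp; ring
      linarith
  induction n with
  | zero => simp [coordSum]
  | succ n ih =>
    have e : ∀ ω, coordSum i (n + 1) ω ^ 2 = coordSum i n ω ^ 2
        + (2 * (coordSum i n ω * ((chain ω ((n : ℤ) + 1) i : SignType) : ℝ))
          + ((chain ω ((n : ℤ) + 1) i : SignType) : ℝ) ^ 2) := fun ω => by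
      rw [coordSum_succ]; ring
    have h2 := hsq (n + 1)
    push_cast at h2
    have hS : Integrable (fun ω => coordSum i n ω ^ 2) R.P :=
      hint _ ((measurable_coordSum i n).pow_const 2) ((n : ℝ) ^ 2) fun ω => by
        rw [abs_pow]; exact pow_le_pow_left₀ (abs_nonneg _) (abs_coordSum_le _ _ _) 2
    have hadd : Integrable (fun ω =>
        2 * (coordSum i n ω * ((chain ω ((n : ℤ) + 1) i : SignType) : ℝ)) +
        ((chain ω ((n : ℤ) + 1) i : SignType) : ℝ) ^ 2) R.P :=
      ((hcint _ _).const_mul 2).add (hsqint _)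
    simp only [e]
    rw [integral_add hS hadd, integral_add ((hcint _ _).const_mul 2) (hsqint _),
      integral_const_mul, hcross, h2]
    have h3 := mul_le_mul_of_nonneg_left (hm n) (show 0 ≤ 1 - R.q i by linarith)
    have h4 : (1 - R.q i) * (R.ε i / R.q i) + R.ε i = R.ε i / R.q i := by field_simp; ring
    push_cast
    linarith

/-- The characteristic function of the sum of the `i`-th chain over `n` time units is
`(1 - q ε γ) ^ n` up to an error of order `ε`, uniformly in `n` and in the frequency. -/
theorem charFun_coordSum_estimate (i n : ℕ) (θ : ℝ) :
    ‖∫ ω, Complex.exp (θ * coordSum i n ω * Complex.I) ∂(R.P) -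
      ((1 - R.q i * R.ε i * decay (R.q i) θ : ℝ) : ℂ) ^ n‖ ≤ 10 * R.ε i := by
  have hε0 := R.ε_pos i
  have hε1 := R.ε_le i
  have hεc : ((R.ε i : ℝ) : ℂ) ≠ 0 := by exact_mod_cast hε0.ne'
  have h1εc : (1 - (R.ε i : ℂ)) ≠ 0 := by
    have : (1 - R.ε i) ≠ 0 := by linarith
    exact_mod_cast this
  set H : ℕ → Noise → ℂ := fun n ω => Complex.exp (θ * coordSum i n ω * Complex.I) with hH
  have hHm : ∀ n, Measurable (H n) := fun n => by
    have := measurable_coordSum i n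
    simp only [hH]
    fun_prop
  have hHn : ∀ n ω, ‖H n ω‖ ≤ 1 := fun n ω => by
    simp only [hH]
    rw [← Complex.ofReal_mul, Complex.norm_exp_ofReal_mul_I]
  have hHd : ∀ n : ℕ, DependsOn (H n) (beforeIdx n) := fun n ω ω' h => by
    simp only [hH, dependsOn_coordSum i n h]
  set ind : SignType → SignType → ℂ := fun s t => if t = s then 1 else 0 with hind
  set α : SignType → ℕ → ℂ := fun s n => ∫ ω, H n ω * ind s (chain ω n i) ∂(R.P) with hα
  set u : ℕ → ℂ := fun n => ∫ ω, H n ω ∂(R.P) with hu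
  have hαint : ∀ s n, Integrable (fun ω => H n ω * ind s (chain ω n i)) R.P := fun s n => by
    refine Integrable.of_bound (C := 1) ((hHm n).mul ((Measurable.of_discrete (f := ind s)).comp
      (measurable_chain_coord i n))).aestronglyMeasurable (ae_of_all _ fun ω => ?_)
    rw [norm_mul]
    refine mul_le_one₀ (hHn n ω) (norm_nonneg _) ?_
    simp only [hind]
    split_ifs <;> simp
  have hsum : ∀ n, u n = α 0 n + (α 1 n + α (-1) n) := fun n => by
    simp only [hα, hu]
    have hadd : Integrable (fun ω => H n ω * ind 1 (chain ω n i) + H n ω * ind (-1) (chain ω n i))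
      R.P := (hαint 1 n).add (hαint (-1) n)
    rw [← integral_add (hαint 1 n) (hαint (-1) n), ← integral_add (hαint 0 n) hadd]
    refine integral_congr_ae (ae_of_all _ fun ω => ?_)
    simp only [hind]
    rcases chain ω n i with _ | _ | _ <;> simp
  have hrec : ∀ s n, α s (n + 1) = Complex.exp (θ * (s : ℝ) * Complex.I) *
      ((1 - R.q i) * α s n + R.q i * (u n *
        ((R.ε i / 2) * ind s 1 + (R.ε i / 2) * ind s (-1) + (1 - R.ε i) * ind s 0))) := by
    intro s n
    have e : ∀ ω, H (n + 1) ω * ind s (chain ω ((n + 1 : ℕ) : ℤ) i)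
        = Complex.exp (θ * (s : ℝ) * Complex.I) *
          (H n ω * ind s (chain ω ((n : ℤ) + 1) i)) := fun ω => by
      simp only [hH, hind, coordSum_succ]
      push_cast
      split_ifs with h
      · rw [h, mul_one, mul_one, ← Complex.exp_add]
        congr 1
        ring
      · simp
    simp only [hα, e]
    rw [integral_const_mul, integral_mul_chain_succ R i n (hHm n) (hHn n) (hHd n) (ind s)]
    simp only [Complex.real_smul]
    push_cast
    rfl
  have hz : ∀ t : ℝ, ‖Complex.exp (t * Complex.I)‖ = 1 := Complex.norm_exp_ofReal_mul_I
  have h0 : ∀ s, α s 0 = (R.ε i / 2) * ind s 1 + (R.ε i / 2) * ind s (-1)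
      + (1 - R.ε i) * ind s 0 := fun s => by
    have := integral_val R i (some 0) (ind s)
    simp only [Complex.real_smul] at this
    push_cast at this
    rw [← this]
    simp [hα, hH, coordSum, chain_zero]
  refine transfer_estimate (R.q_pos i) (R.q_le i) hε0 hε1 (θ := θ) (hz θ) (hz (-θ)) ?_ ?_
    (x := fun n => α 0 n / (1 - R.ε i)) (y := fun n => α 1 n / (R.ε i / 2))
    (y' := fun n => α (-1) n / (R.ε i / 2)) (u := u) ?_ ?_ ?_ ?_ ?_ ?_ ?_ n
  · rw [← Complex.exp_add]; simp
  · rw [Complex.ofReal_cos, Complex.two_cos]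
    push_cast
    rfl
  · intro n
    rw [hsum]
    field_simp
  · simp [h0, hind, h1εc]
  · simp [h0, hind, hεc]
  · simp [h0, hind, hεc]
  · intro n
    rw [hrec]
    simp [hind]
    field_simp
  · intro n
    rw [hrec]
    simp [hind]
    field_simp
  · intro n
    rw [hrec]
    simp [hind]
    field_simp

end

section

/-! ### Concentration and characteristic functions -/

/-- Smoothing by a Gaussian: the concentration function is bounded by an average of the modulus of
the characteristic function. -/
theorem measureReal_interval_le {Ω : Type*} {mΩ : MeasurableSpace Ω} {P : Measure Ω}
    [IsProbabilityMeasure P] {Y : Ω → ℝ} (hY : Measurable Y) {c : ℝ} (hc : 0 < c) (r : ℝ) :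
    P.real {ω | r - c < Y ω ∧ Y ω < r + c} ≤ Real.exp (1 / 2) *
      ∫ t, ‖∫ ω, Complex.exp (t * Y ω * Complex.I) ∂P‖
        ∂(gaussianReal 0 (Real.toNNReal (c ^ 2)⁻¹)) := by
  set v := Real.toNNReal (c ^ 2)⁻¹ with hv
  set ν := gaussianReal 0 v with hν
  set A := {ω | r - c < Y ω ∧ Y ω < r + c} with hA
  have hvc : (v : ℝ) = (c ^ 2)⁻¹ := Real.coe_toNNReal _ (by positivity)
  have hAm : MeasurableSet A :=
    (measurableSet_lt measurable_const hY).inter (measurableSet_lt hY measurable_const)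
  have hchar : ∀ x : ℝ, ∫ t, Complex.exp (x * t * Complex.I) ∂ν
      = ((Real.exp (-((v : ℝ) * x ^ 2 / 2)) : ℝ) : ℂ) := fun x => by
    rw [← charFun_apply_real, hν, charFun_gaussianReal]
    push_cast
    congr 1
    ring
  have h1 : P.real A ≤ Real.exp (1 / 2) * ∫ ω, Real.exp (-((v : ℝ) * (Y ω - r) ^ 2 / 2)) ∂P := by
    rw [← integral_const_mul, ← integral_indicator_one hAm]
    refine integral_mono_of_nonneg (ae_of_all _ fun ω => Set.indicator_nonneg (by simp) _) ?_
      (ae_of_all _ fun ω => ?_)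
    · refine Integrable.const_mul (Integrable.of_bound (by fun_prop) 1 (ae_of_all _ fun ω => ?_)) _
      rw [Real.norm_of_nonneg (Real.exp_pos _).le, Real.exp_le_one_iff]
      have := v.2
      have : 0 ≤ (v : ℝ) * (Y ω - r) ^ 2 / 2 := by positivity
      linarith
    · change A.indicator 1 ω ≤ Real.exp (1 / 2) * Real.exp (-((v : ℝ) * (Y ω - r) ^ 2 / 2))
      rw [← Real.exp_add]
      by_cases hω : ω ∈ A
      · rw [Set.indicator_of_mem hω, Pi.one_apply]
        refine Real.one_le_exp ?_
        have h2 : (Y ω - r) ^ 2 ≤ c ^ 2 := by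
          obtain ⟨h3, h4⟩ := hω
          exact sq_le_sq' (by linarith) (by linarith)
        have h3 : (v : ℝ) * (Y ω - r) ^ 2 ≤ 1 := by
          rw [hvc, inv_mul_le_iff₀ (by positivity)]; linarith
        linarith
      · rw [Set.indicator_of_notMem hω]
        positivity
  refine h1.trans (mul_le_mul_of_nonneg_left ?_ (Real.exp_pos _).le)
  have h2 : ((∫ ω, Real.exp (-((v : ℝ) * (Y ω - r) ^ 2 / 2)) ∂P : ℝ) : ℂ)
      = ∫ t, Complex.exp (-(r * t) * Complex.I) *
          ∫ ω, Complex.exp (t * Y ω * Complex.I) ∂P ∂ν := by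
    rw [← integral_complex_ofReal]
    simp only [← hchar, ← integral_const_mul]
    rw [integral_integral_swap]
    · refine integral_congr_ae (ae_of_all _ fun t => integral_congr_ae (ae_of_all _ fun ω => ?_))
      simp only
      rw [← Complex.exp_add]
      congr 1
      push_cast
      ring
    · refine Integrable.of_bound (C := 1) ?_ (ae_of_all _ fun p => ?_)
      · have : Measurable fun p : Ω × ℝ =>
            Complex.exp (((Y p.1 - r : ℝ) : ℂ) * (p.2 : ℂ) * Complex.I) := by fun_prop
        exact this.aestronglyMeasurable
      · simp only [Function.uncurry]
        rw [← Complex.ofReal_mul, Complex.norm_exp_ofReal_mul_I]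
  have h3 : ‖((∫ ω, Real.exp (-((v : ℝ) * (Y ω - r) ^ 2 / 2)) ∂P : ℝ) : ℂ)‖
      = ∫ ω, Real.exp (-((v : ℝ) * (Y ω - r) ^ 2 / 2)) ∂P := by
    rw [Complex.norm_real, Real.norm_of_nonneg]
    exact integral_nonneg fun ω => (Real.exp_pos _).le
  rw [← h3, h2]
  refine (norm_integral_le_integral_norm _).trans_eq ?_
  refine integral_congr_ae (ae_of_all _ fun t => ?_)
  simp only
  rw [norm_mul]
  have : (-((r : ℂ) * t) * Complex.I) = ((-(r * t) : ℝ) : ℂ) * Complex.I := by push_cast; ring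
  rw [this, Complex.norm_exp_ofReal_mul_I, one_mul]

/-! ### Asymptotics of the decay rate -/

theorem tendsto_mul_one_sub_cos {κ : Type*} {l : Filter κ} {c θ : κ → ℝ} {L : ℝ}
    (hθ : Tendsto θ l (𝓝 0)) (hc : Tendsto (fun n => c n * θ n ^ 2) l (𝓝 L)) :
    Tendsto (fun n => c n * (1 - Real.cos (θ n))) l (𝓝 (L / 2)) := by
  have h1 : Tendsto (fun n => Real.sinc (θ n / 2)) l (𝓝 1) := by
    have := (Real.continuous_sinc.tendsto 0).comp (by simpa using hθ.div_const 2 :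
      Tendsto (fun n => θ n / 2) l (𝓝 0))
    simpa [Function.comp_def] using this
  have h2 := (hc.div_const 2).mul (h1.pow 2)
  simp only [one_pow, mul_one] at h2
  refine h2.congr fun n => ?_
  have h3 : Real.cos (θ n) = 1 - 2 * Real.sin (θ n / 2) ^ 2 := by
    have h4 := Real.cos_sq_add_sin_sq (θ n / 2)
    have h5 := Real.cos_two_mul (θ n / 2)
    rw [mul_div_cancel₀ _ two_ne_zero] at h5
    linarith
  rw [h3]
  by_cases h0 : θ n = 0
  · simp [h0]
  · rw [Real.sinc_of_ne_zero (by simpa using h0)]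
    field_simp
    ring

theorem decay_le_two {q θ : ℝ} (hq : 0 < q) (hq1 : q ≤ 1) : decay q θ ≤ 2 := by
  have h1 := Real.cos_le_one θ
  have h2 := Real.neg_one_le_cos θ
  unfold decay
  have h3 : 0 ≤ (1 - q) * (1 - Real.cos θ) := mul_nonneg (by linarith) (by linarith)
  rw [div_le_iff₀ (by nlinarith)]
  nlinarith [mul_nonneg (show 0 ≤ 1 - q by linarith) (show 0 ≤ 2 - q by linarith),
    mul_nonneg hq.le (show 0 ≤ 1 + Real.cos θ by linarith),
    mul_nonneg (show 0 ≤ 1 - q by linarith) (show 0 ≤ 1 + Real.cos θ by linarith)]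

theorem measurable_decay (q : ℝ) : Measurable (decay q) := by
  unfold decay
  fun_prop

theorem tendsto_pow_decay {q ε a : ℝ} (hq : 0 < q) (t : ℝ) :
    Tendsto (fun n : ℕ => (1 - q * ε * decay q (t * (√(n : ℝ))⁻¹ * a)) ^ n) atTop
      (𝓝 (Real.exp (-(ε * (2 - q) * a ^ 2 / (2 * q) * t ^ 2)))) := by
  have hsq : Tendsto (fun n : ℕ => (√(n : ℝ))⁻¹) atTop (𝓝 0) :=
    tendsto_inv_atTop_zero.comp (Real.tendsto_sqrt_atTop.comp tendsto_natCast_atTop_atTop)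
  have hθ : Tendsto (fun n : ℕ => t * (√(n : ℝ))⁻¹ * a) atTop (𝓝 0) := by
    simpa using (hsq.const_mul t).mul_const a
  have h1 : Tendsto (fun n : ℕ => (n : ℝ) * (1 - Real.cos (t * (√(n : ℝ))⁻¹ * a))) atTop
      (𝓝 ((t * a) ^ 2 / 2)) := by
    refine tendsto_mul_one_sub_cos hθ (tendsto_const_nhds.congr' ?_)
    filter_upwards [eventually_gt_atTop 0] with n hn
    have hn' : (0 : ℝ) < n := by exact_mod_cast hn
    simp only [mul_pow, inv_pow, Real.sq_sqrt hn'.le]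
    field_simp
  have h2 : Tendsto (fun n : ℕ => q ^ 2 + 2 * (1 - q) * (1 - Real.cos (t * (√(n : ℝ))⁻¹ * a)))
      atTop (𝓝 (q ^ 2)) := by
    have : Tendsto (fun n : ℕ => Real.cos (t * (√(n : ℝ))⁻¹ * a)) atTop (𝓝 1) := by
      simpa [Function.comp_def] using (Real.continuous_cos.tendsto 0).comp hθ
    simpa using ((this.const_sub 1).const_mul (2 * (1 - q))).const_add (q ^ 2)
  have h3 := ((h1.mul_const (2 - q)).div h2 (by positivity)).const_mul (-(q * ε))
  have h4 : Tendsto (fun n : ℕ => (n : ℝ) * (-(q * ε * decay q (t * (√(n : ℝ))⁻¹ * a)))) atTop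
      (𝓝 (-(ε * (2 - q) * a ^ 2 / (2 * q) * t ^ 2))) := by
    have e : -(ε * (2 - q) * a ^ 2 / (2 * q) * t ^ 2)
        = -(q * ε) * ((t * a) ^ 2 / 2 * (2 - q) / q ^ 2) := by field_simp
    rw [e]
    refine h3.congr fun n => ?_
    simp only [decay, Pi.div_apply]
    ring
  simpa only [← sub_eq_add_neg] using Real.tendsto_one_add_pow_exp_of_tendsto h4

/-! ### One chain against the others -/

theorem update_mem_finSupp {v : ℕ → SignType} (hv : v ∈ finSupp) (i : ℕ) :
    Function.update v i 0 ∈ finSupp := by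
  refine Set.Finite.subset hv fun j hj => ?_
  by_cases h : j = i
  · subst h; simp at hj
  · simpa [h] using hj

theorem obs_eq_add_update {v : ℕ → SignType} (hv : v ∈ finSupp) (i : ℕ) :
    obs v = (1 / 4 : ℝ) ^ i * (v i : ℝ) + obs (Function.update v i 0) := by
  rw [obs_of_mem hv, obs_of_mem (update_mem_finSupp hv i), code, code, ← sub_eq_iff_eq_add,
    ← (summable_code _).tsum_sub (summable_code _), tsum_eq_single i fun j hj => by simp [hj]]
  simp

/-- The partial sum of all the chains but the `i`-th. -/
def restSum (i n : ℕ) (ω : Noise) : ℝ :=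
  ∑ k ∈ Finset.Icc 1 n, obs (Function.update (chain ω (k : ℤ)) i 0)

theorem measurable_restSum (i n : ℕ) : Measurable (restSum i n) := by
  refine Finset.measurable_sum _ fun k _ => measurable_obs.comp (measurable_pi_iff.2 fun j => ?_)
  by_cases h : j = i
  · subst h; simp
  · simp only [ne_eq, h, not_false_eq_true, Function.update_of_ne]
    exact measurable_chain_coord j k

theorem dependsOn_restSum (i n : ℕ) : DependsOn (restSum i n) {x | x.1 ≠ i} := by
  intro ω ω' h
  refine Finset.sum_congr rfl fun k _ => congrArg obs (funext fun j => ?_)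
  by_cases hj : j = i
  · subst hj; simp
  · simp only [ne_eq, hj, not_false_eq_true, Function.update_of_ne]
    exact chain_coord_eq_of_eq (fun x => h (j, x) hj) _

theorem dependsOn_coordSum_fst (i n : ℕ) : DependsOn (coordSum i n) {x | x.1 = i} := by
  intro ω ω' h
  refine Finset.sum_congr rfl fun k _ => ?_
  rw [chain_coord_eq_of_eq (fun x => h (i, x) rfl) _]

variable (R : Rates)

theorem partialSum_eq_add_restSum (i : ℕ) : ∀ᵐ ω ∂(R.P), ∀ n,
    partialSum X n ω = (1 / 4 : ℝ) ^ i * coordSum i n ω + restSum i n ω := by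
  filter_upwards [ae_chain_mem_finSupp R] with ω hω n
  rw [partialSum, coordSum, restSum, Finset.mul_sum, ← Finset.sum_add_distrib]
  exact Finset.sum_congr rfl fun k _ => obs_eq_add_update (hω k) i

theorem measurable_partialSum (n : ℕ) : Measurable (partialSum X n) :=
  Finset.measurable_sum _ fun k _ => measurable_X k

/-- The `i`-th chain is independent of the others, so the modulus of the characteristic function of
the partial sum is at most that of the sum of the `i`-th chain. -/
theorem norm_charFun_partialSum_le (i n : ℕ) (t : ℝ) :
    ‖∫ ω, Complex.exp (t * partialSum X n ω * Complex.I) ∂(R.P)‖ ≤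
      10 * R.ε i + (1 - R.q i * R.ε i * decay (R.q i) (t * (1 / 4) ^ i)) ^ n := by
  have hq := R.q_pos i
  have hq1 := R.q_le i
  have hε := R.ε_pos i
  have hε1 := R.ε_le i
  have e : ∫ ω, Complex.exp (t * partialSum X n ω * Complex.I) ∂(R.P)
      = (∫ ω, Complex.exp ((t * (1 / 4) ^ i : ℝ) * coordSum i n ω * Complex.I) ∂(R.P)) *
        ∫ ω, Complex.exp (t * restSum i n ω * Complex.I) ∂(R.P) := by
    have hc := measurable_coordSum i n
    have hr := measurable_restSum i n
    rw [← integral_mul_of_dependsOn R (S := {x | x.1 = i}) (T := {x | x.1 ≠ i})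
      (Set.disjoint_left.2 fun x h h' => h' h) (by fun_prop) (by fun_prop)
      (fun ω ω' h => by simp only [dependsOn_coordSum_fst i n h])
      (fun ω ω' h => by simp only [dependsOn_restSum i n h])]
    refine integral_congr_ae ?_
    filter_upwards [partialSum_eq_add_restSum R i] with ω hω
    rw [hω n, ← Complex.exp_add]
    congr 1
    push_cast
    ring
  have h1 : ‖∫ ω, Complex.exp (t * restSum i n ω * Complex.I) ∂(R.P)‖ ≤ 1 := by
    refine (norm_integral_le_of_norm_le_const (C := 1) (ae_of_all _ fun ω => ?_)).trans (by simp)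
    rw [← Complex.ofReal_mul, Complex.norm_exp_ofReal_mul_I]
  have h2 := charFun_coordSum_estimate R i n (t * (1 / 4) ^ i)
  have h3 : 0 ≤ 1 - R.q i * R.ε i * decay (R.q i) (t * (1 / 4) ^ i) := by
    have h4 := decay_le_two (θ := t * (1 / 4) ^ i) hq hq1
    have h5 := decay_nonneg (q := R.q i) (θ := t * (1 / 4) ^ i) hq1
    have : R.q i * R.ε i * decay (R.q i) (t * (1 / 4) ^ i) ≤ 1 * (1 / 4) * 2 := by gcongr
    linarith
  rw [e, norm_mul]
  refine (mul_le_of_le_one_right (norm_nonneg _) h1).trans ?_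
  have h4 := norm_le_norm_sub_add
    (∫ ω, Complex.exp ((t * (1 / 4) ^ i : ℝ) * coordSum i n ω * Complex.I) ∂(R.P))
    (((1 - R.q i * R.ε i * decay (R.q i) (t * (1 / 4) ^ i) : ℝ) : ℂ) ^ n)
  refine h4.trans (add_le_add h2 ?_)
  rw [norm_pow, Complex.norm_real, Real.norm_of_nonneg h3]

/-! ### Complete dissipation and growth of the variances -/

/-- The single-chain bound is used for a fixed `i` as `n → ∞`, and then `i → ∞`. -/
theorem completelyDissipates_X
    (hR : Tendsto (fun i => (1 / 16 : ℝ) ^ i * (R.ε i / R.q i)) atTop atTop) :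
    CompletelyDissipates R.P X := by
  intro c hc
  set ν := gaussianReal 0 (Real.toNNReal (c ^ 2)⁻¹) with hν
  -- The limit as `i → ∞` fails at the frequency zero, which the Gaussian does not charge.
  have hatom : NullSingletonClass ν := by
    refine nullSingletonClass_gaussianReal ?_
    rw [ne_eq, Real.toNNReal_eq_zero, not_le]
    positivity
  set D : ℕ → ℝ → ℝ := fun i θ => 1 - R.q i * R.ε i * decay (R.q i) θ with hD
  have hD01 : ∀ i θ, 0 ≤ D i θ ∧ D i θ ≤ 1 := fun i θ => by
    have h1 := R.q_pos i
    have h2 := R.q_le i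
    have h3 := R.ε_pos i
    have h4 := R.ε_le i
    have h5 := decay_le_two (θ := θ) h1 h2
    have h6 := decay_nonneg (q := R.q i) (θ := θ) h2
    have h7 : R.q i * R.ε i * decay (R.q i) θ ≤ 1 * (1 / 4) * 2 := by gcongr
    have h8 : 0 ≤ R.q i * R.ε i * decay (R.q i) θ := by positivity
    simp only [hD]
    constructor <;> linarith
  have hDm : ∀ i n : ℕ, Measurable fun t : ℝ =>
      D i (t * (√(n : ℝ))⁻¹ * (1 / 4) ^ i) ^ n := fun i n => by
    have := measurable_decay (R.q i)
    simp only [hD]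
    fun_prop
  set I : ℕ → ℕ → ℝ := fun i n => ∫ t, D i (t * (√(n : ℝ))⁻¹ * (1 / 4) ^ i) ^ n ∂ν with hI
  set B : ℕ → ℝ := fun i => R.ε i * (2 - R.q i) * ((1 / 4) ^ i) ^ 2 / (2 * R.q i) with hB
  have hint : ∀ i n : ℕ, Integrable (fun t : ℝ =>
      D i (t * (√(n : ℝ))⁻¹ * (1 / 4) ^ i) ^ n) ν := fun i n =>
    Integrable.of_bound (C := 1) (hDm i n).aestronglyMeasurable (ae_of_all _ fun t => by
      rw [Real.norm_of_nonneg (pow_nonneg (hD01 _ _).1 _)]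
      exact pow_le_one₀ (hD01 _ _).1 (hD01 _ _).2)
  have hbound : ∀ i (n : ℕ), (⨆ r : ℝ, R.P.real {ω | r - c < (√(n : ℝ))⁻¹ * partialSum X n ω ∧
      (√(n : ℝ))⁻¹ * partialSum X n ω < r + c}) ≤ Real.exp (1 / 2) * (10 * R.ε i + I i n) := by
    intro i n
    refine ciSup_le fun r => ?_
    refine (measureReal_interval_le ((measurable_partialSum n).const_mul _) hc r).trans ?_
    refine mul_le_mul_of_nonneg_left ?_ (Real.exp_pos _).le
    have h1 : 10 * R.ε i + I i n
        = ∫ t, (10 * R.ε i + D i (t * (√(n : ℝ))⁻¹ * (1 / 4) ^ i) ^ n) ∂ν := by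
      rw [integral_add (integrable_const _) (hint i n)]
      simp [hI]
    rw [h1]
    refine integral_mono_of_nonneg (ae_of_all _ fun t => norm_nonneg _)
      ((integrable_const _).add (hint i n)) (ae_of_all _ fun t => ?_)
    have h2 := norm_charFun_partialSum_le R i n (t * (√(n : ℝ))⁻¹)
    refine le_of_eq_of_le ?_ h2
    push_cast
    simp only [mul_assoc]
  have hn : ∀ i, Tendsto (I i) atTop (𝓝 (∫ t, Real.exp (-(B i * t ^ 2)) ∂ν)) := fun i =>
    tendsto_integral_of_dominated_convergence (fun _ => 1)
      (fun n => (hDm i n).aestronglyMeasurable) (integrable_const _)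
      (fun n => ae_of_all _ fun t => by
        rw [Real.norm_of_nonneg (pow_nonneg (hD01 _ _).1 _)]
        exact pow_le_one₀ (hD01 _ _).1 (hD01 _ _).2)
      (ae_of_all _ fun t => tendsto_pow_decay (R.q_pos i) t)
  have hBlim : Tendsto B atTop atTop := by
    refine tendsto_atTop_mono (fun i => ?_) (hR.atTop_div_const (show (0 : ℝ) < 2 by norm_num))
    have h1 := R.q_pos i
    have h2 := R.q_le i
    have h3 := R.ε_pos i
    have h4 : ((1 / 4 : ℝ) ^ i) ^ 2 = (1 / 16) ^ i := by
      rw [← pow_mul, mul_comm, pow_mul]; norm_num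
    have h5 : 0 < (1 / 16 : ℝ) ^ i := by positivity
    simp only [hB]
    rw [h4, ← mul_div_assoc, div_div, mul_comm (R.q i) 2]
    refine div_le_div_of_nonneg_right ?_ (by positivity)
    have : 0 ≤ R.ε i * (1 / 16) ^ i * (1 - R.q i) := mul_nonneg (by positivity) (by linarith)
    linarith
  have hBpos : ∀ i, 0 ≤ B i := fun i => by
    have h1 := R.q_pos i
    have h2 : 0 ≤ 2 - R.q i := by linarith [R.q_le i]
    have h3 := R.ε_pos i
    positivity
  have hi : Tendsto (fun i => ∫ t, Real.exp (-(B i * t ^ 2)) ∂ν) atTop (𝓝 (∫ _, (0 : ℝ) ∂ν)) := by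
    refine tendsto_integral_of_dominated_convergence (fun _ => 1)
      (fun n => by fun_prop) (integrable_const _)
      (fun i => ae_of_all _ fun t => ?_) ?_
    · rw [Real.norm_of_nonneg (Real.exp_pos _).le, Real.exp_le_one_iff]
      have := mul_nonneg (hBpos i) (sq_nonneg t)
      linarith
    · have h0 : ∀ᵐ t ∂ν, t ≠ 0 := by
        rw [ae_iff]
        simp only [ne_eq, not_not, Set.ofPred_eq_eq_singleton]
        exact measure_singleton 0
      filter_upwards [h0] with t ht
      have ht2 : 0 < t ^ 2 := by positivity
      exact Real.tendsto_exp_atBot.comp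
        (tendsto_neg_atTop_atBot.comp (hBlim.atTop_mul_const ht2))
  have htot : Tendsto (fun i => Real.exp (1 / 2) *
      (10 * R.ε i + ∫ t, Real.exp (-(B i * t ^ 2)) ∂ν)) atTop (𝓝 0) := by
    simpa using ((R.summable_ε.tendsto_atTop_zero.const_mul 10).add hi).const_mul
      (Real.exp (1 / 2))
  refine tendsto_order.2 ⟨fun a ha => Eventually.of_forall fun n =>
    ha.trans_le (Real.iSup_nonneg fun r => measureReal_nonneg), fun η hη => ?_⟩
  obtain ⟨i, hiη⟩ := (htot.eventually_lt_const hη).exists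
  have h1 := ((hn i).const_add (10 * R.ε i)).const_mul (Real.exp (1 / 2))
  filter_upwards [h1.eventually_lt_const hiη] with n hnη
  exact (hbound i n).trans_lt hnη

/-- Complete dissipation forces the variances to grow faster than linearly. -/
theorem tendsto_variance_partialSum (hdiss : CompletelyDissipates R.P X) :
    Tendsto (fun n : ℕ => (n : ℝ)⁻¹ * variance (partialSum X n) R.P) atTop atTop := by
  have hmem : ∀ n, MemLp (partialSum X n) 2 R.P := fun n =>
    memLp_finsetSum _ fun k _ => memLp_X R k
  have hmean : ∀ n, ∫ ω, partialSum X n ω ∂(R.P) = 0 := fun n => by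
    simp only [partialSum]
    rw [integral_finsetSum (f := fun (k : ℕ) ω => X (k : ℤ) ω) _ fun k _ =>
      (memLp_X R k).integrable (by norm_num)]
    exact Finset.sum_eq_zero fun k _ => integral_X R k
  refine tendsto_atTop.2 fun M => ?_
  -- The interval `(-c, c)` has probability below `1 / 2`, so the second moment exceeds `c² / 2`.
  set c : ℝ := √(2 * max M 1) with hc
  have hM : 0 < max M 1 := lt_max_of_lt_right one_pos
  have hc0 : 0 < c := Real.sqrt_pos.2 (by linarith)
  filter_upwards [(hdiss c hc0).eventually_lt_const (show (0 : ℝ) < 1 / 2 by norm_num),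
    eventually_gt_atTop 0] with n hn hn0
  set Y : Noise → ℝ := fun ω => (√(n : ℝ))⁻¹ * partialSum X n ω with hY
  have hYm : Measurable Y := (measurable_partialSum n).const_mul _
  have hn0' : (0 : ℝ) < n := by exact_mod_cast hn0
  have h1 : R.P.real {ω | 0 - c < Y ω ∧ Y ω < 0 + c} < 1 / 2 :=
    (le_ciSup (f := fun r : ℝ => R.P.real {ω | r - c < Y ω ∧ Y ω < r + c})
      ⟨1, by rintro _ ⟨r, rfl⟩; exact measureReal_le_one⟩ 0).trans_lt hn
  have hAm : MeasurableSet {ω | 0 - c < Y ω ∧ Y ω < 0 + c} :=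
    (measurableSet_lt measurable_const hYm).inter (measurableSet_lt hYm measurable_const)
  have h2 : (n : ℝ)⁻¹ * variance (partialSum X n) R.P = ∫ ω, Y ω ^ 2 ∂(R.P) := by
    rw [variance_of_integral_eq_zero (hmem n).aestronglyMeasurable.aemeasurable (hmean n),
      ← integral_const_mul]
    simp only [hY, mul_pow, inv_pow, Real.sq_sqrt hn0'.le]
  have hYint : Integrable (fun ω => Y ω ^ 2) R.P := ((hmem n).const_mul _).integrable_sq
  have h3 := mul_meas_ge_le_integral_of_nonneg (ae_of_all _ fun ω => sq_nonneg (Y ω)) hYint (c ^ 2)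
  have h4 : {ω | 0 - c < Y ω ∧ Y ω < 0 + c}ᶜ ⊆ {ω | c ^ 2 ≤ Y ω ^ 2} := fun ω hω => by
    simp only [Set.mem_ofPred_eq]
    by_contra hlt
    have := abs_lt.1 ((sq_lt_sq₀ (abs_nonneg _) hc0.le).1 (by rw [sq_abs]; exact not_le.1 hlt))
    exact hω ⟨by linarith [this.1], by linarith [this.2]⟩
  have h5 : 1 / 2 ≤ R.P.real {ω | c ^ 2 ≤ Y ω ^ 2} := by
    refine le_trans ?_ (measureReal_mono h4)
    rw [probReal_compl_eq_one_sub hAm]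
    linarith
  have hc2 : c ^ 2 = 2 * max M 1 := Real.sq_sqrt (by linarith)
  rw [h2]
  have h6 := mul_le_mul_of_nonneg_left h5 (sq_nonneg c)
  have h7 := le_max_left M 1
  linarith

end

section

/-! ### The characteristic function of the limit law -/

theorem charFun_laplaceLaw (t : ℝ) :
    ∫ x, Complex.exp (t * x * Complex.I) ∂laplaceLaw = ((1 / (1 + t ^ 2) : ℝ) : ℂ) := by
  have h1 : ∫ x, Complex.exp (t * x * Complex.I) ∂laplaceLaw
      = ∫ x : ℝ, (((1 / 2) * Real.exp (-|x|) : ℝ) : ℂ) * Complex.exp (t * x * Complex.I) := by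
    rw [laplaceLaw, integral_withDensity_eq_integral_toReal_smul (by fun_prop)
      (ae_of_all _ fun _ => ENNReal.ofReal_lt_top)]
    refine integral_congr_ae (ae_of_all _ fun x => ?_)
    simp only
    rw [ENNReal.toReal_ofReal (by positivity), Complex.real_smul]
  have hre1 : (-1 + t * Complex.I : ℂ).re < 0 := by simp
  have hre2 : 0 < (1 + t * Complex.I : ℂ).re := by simp
  have e1 : ∀ x ∈ Set.Ioi (0 : ℝ), (((1 / 2) * Real.exp (-|x|) : ℝ) : ℂ) *
      Complex.exp (t * x * Complex.I) = (1 / 2) * Complex.exp ((-1 + t * Complex.I) * x) := by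
    intro x hx
    rw [abs_of_pos hx]
    push_cast
    rw [mul_assoc, ← Complex.exp_add]
    congr 2
    ring
  have e2 : ∀ x ∈ Set.Iic (0 : ℝ), (((1 / 2) * Real.exp (-|x|) : ℝ) : ℂ) *
      Complex.exp (t * x * Complex.I) = (1 / 2) * Complex.exp ((1 + t * Complex.I) * x) := by
    intro x hx
    rw [abs_of_nonpos hx]
    push_cast
    rw [mul_assoc, ← Complex.exp_add]
    congr 2
    ring
  have hi1 : IntegrableOn (fun x : ℝ => (((1 / 2) * Real.exp (-|x|) : ℝ) : ℂ) *
      Complex.exp (t * x * Complex.I)) (Set.Ioi 0) :=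
    IntegrableOn.congr_fun ((integrableOn_exp_mul_complex_Ioi hre1 0).const_mul (1 / 2))
      (fun x hx => (e1 x hx).symm) measurableSet_Ioi
  have hi2 : IntegrableOn (fun x : ℝ => (((1 / 2) * Real.exp (-|x|) : ℝ) : ℂ) *
      Complex.exp (t * x * Complex.I)) (Set.Iic 0) :=
    IntegrableOn.congr_fun ((integrableOn_exp_mul_complex_Iic hre2 0).const_mul (1 / 2))
      (fun x hx => (e2 x hx).symm) measurableSet_Iic
  rw [h1, ← intervalIntegral.integral_Iic_add_Ioi hi2 hi1,
    setIntegral_congr_fun measurableSet_Iic e2, setIntegral_congr_fun measurableSet_Ioi e1,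
    integral_const_mul, integral_const_mul, integral_exp_mul_complex_Ioi hre1,
    integral_exp_mul_complex_Iic hre2]
  have hn1 : (1 + t * Complex.I : ℂ) ≠ 0 := fun h => by
    rw [h] at hre2; simp at hre2
  have hn2 : (-1 + t * Complex.I : ℂ) ≠ 0 := fun h => by
    rw [h] at hre1; simp at hre1
  have hn3 : (1 + (t : ℂ) ^ 2) ≠ 0 := by
    have : (1 + t ^ 2 : ℝ) ≠ 0 := by positivity
    exact_mod_cast this
  have hI := Complex.I_sq
  push_cast
  simp only [mul_zero, Complex.exp_zero]
  field_simp
  linear_combination (-2 * (t : ℂ) ^ 2) * hI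

theorem charFun_sum_laplaceLaw (t : ℝ) (n : ℕ) :
    ∫ η, Complex.exp (t * (∑ k ∈ Finset.range n, η k : ℝ) * Complex.I)
      ∂(Measure.infinitePi fun _ : ℕ => laplaceLaw) = ((1 / (1 + t ^ 2) : ℝ) : ℂ) ^ n := by
  induction n with
  | zero => simp
  | succ n ih =>
    have hind := indepFun_of_dependsOn (fun _ : ℕ => laplaceLaw) (S := {k | k < n}) (T := {n})
      (Set.disjoint_singleton_right.2 (by simp))
      (f := fun η : ℕ → ℝ => Complex.exp (t * (∑ k ∈ Finset.range n, η k : ℝ) * Complex.I))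
      (g := fun η : ℕ → ℝ => Complex.exp (t * (η n : ℝ) * Complex.I)) (by fun_prop) (by fun_prop)
      (fun η η' h => by
        have : ∑ k ∈ Finset.range n, η k = ∑ k ∈ Finset.range n, η' k :=
          Finset.sum_congr rfl fun k hk => h k (Finset.mem_range.1 hk)
        simp only [this])
      (fun η η' h => by simp only [h n rfl])
    have h2 : ∫ η, Complex.exp (t * (η n : ℝ) * Complex.I)
        ∂(Measure.infinitePi fun _ : ℕ => laplaceLaw) = ((1 / (1 + t ^ 2) : ℝ) : ℂ) := by
      have h := measurePreserving_eval_infinitePi (fun _ : ℕ => laplaceLaw) n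
      have h' := integral_map h.aemeasurable
        (f := fun x : ℝ => Complex.exp (t * x * Complex.I)) (by fun_prop)
      rw [h.map_eq, charFun_laplaceLaw] at h'
      exact h'.symm
    have hm1 : Measurable fun η : ℕ → ℝ =>
        Complex.exp (t * (∑ k ∈ Finset.range n, η k : ℝ) * Complex.I) := by fun_prop
    have hm2 : Measurable fun η : ℕ → ℝ => Complex.exp (t * (η n : ℝ) * Complex.I) := by fun_prop
    have h3 := hind.integral_fun_mul_eq_mul_integral hm1.aestronglyMeasurable
      hm2.aestronglyMeasurable
    rw [pow_succ, ← ih, ← h2, ← h3]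
    refine integral_congr_ae (ae_of_all _ fun η => ?_)
    simp only
    rw [Finset.sum_range_succ, ← Complex.exp_add]
    congr 1
    push_cast
    ring

theorem charFun_poissonLaplaceLaw (t : ℝ) :
    charFun poissonLaplaceLaw t = ((Real.exp (-(t ^ 2 / (1 + t ^ 2))) : ℝ) : ℂ) := by
  set φ : ℝ := 1 / (1 + t ^ 2) with hφ
  have hm : Measurable fun p : ℕ × (ℕ → ℝ) =>
      Complex.exp (t * (randomSum p : ℝ) * Complex.I) := by
    have := measurable_randomSum
    fun_prop
  rw [charFun_apply_real, poissonLaplaceLaw, integral_map measurable_randomSum.aemeasurable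
    (by fun_prop), integral_prod _ (Integrable.of_bound hm.aestronglyMeasurable 1
      (ae_of_all _ fun p => by rw [← Complex.ofReal_mul, Complex.norm_exp_ofReal_mul_I]))]
  simp only [randomSum, charFun_sum_laplaceLaw]
  rw [integral_poissonMeasure]
  have hterm : ∀ n : ℕ, (Real.exp (-((1 : NNReal) : ℝ)) * ((1 : NNReal) : ℝ) ^ n / n.factorial) •
      ((φ : ℝ) : ℂ) ^ n = ((Real.exp (-1) * (φ ^ n / n.factorial) : ℝ) : ℂ) := fun n => by
    rw [Complex.real_smul]
    push_cast
    ring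
  refine (tsum_congr hterm).trans ?_
  rw [← Complex.ofReal_tsum, tsum_mul_left]
  have hexp : ∑' n : ℕ, φ ^ n / n.factorial = Real.exp φ := by
    rw [Real.exp_eq_exp_ℝ, NormedSpace.exp_eq_tsum_div]
  rw [hexp, ← Real.exp_add]
  congr 2
  rw [hφ]
  field_simp
  ring

/-! ### The limit law along a subsequence -/

theorem abs_one_sub_pow_sub_exp_le {x : ℝ} (hx0 : 0 ≤ x) (hx1 : x ≤ 1) (n : ℕ) :
    |(1 - x) ^ n - Real.exp (-(n * x))| ≤ n * x ^ 2 := by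
  have h1 : Real.exp (-(n * x)) = Real.exp (-x) ^ n := by
    rw [← Real.exp_nat_mul]; ring_nf
  have h2 : |Real.exp (-x)| ≤ 1 := by
    rw [abs_of_pos (Real.exp_pos _), Real.exp_le_one_iff]; linarith
  have h3 : |1 - x| ≤ 1 := by rw [abs_le]; constructor <;> linarith
  have h4 : |1 - x - Real.exp (-x)| ≤ x ^ 2 := by
    have := Real.abs_exp_sub_one_sub_id_le (x := -x) (by rw [abs_neg, abs_of_nonneg hx0]; exact hx1)
    rw [abs_sub_comm]
    convert this using 1
    · congr 1; ring
    · ring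
  rw [h1]
  refine (abs_pow_sub_pow_le _ _ n).trans ?_
  have h5 : max |1 - x| |Real.exp (-x)| ^ (n - 1) ≤ 1 :=
    pow_le_one₀ (le_max_of_le_left (abs_nonneg _)) (max_le h3 h2)
  calc |1 - x - Real.exp (-x)| * n * max |1 - x| |Real.exp (-x)| ^ (n - 1)
      ≤ |1 - x - Real.exp (-x)| * n * 1 := by gcongr
    _ ≤ x ^ 2 * n * 1 := by gcongr
    _ = n * x ^ 2 := by ring

theorem tendsto_decay {q : ℕ → ℝ} (hq : ∀ i, 0 < q i) (hq0 : Tendsto q atTop (𝓝 0)) (t : ℝ) :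
    Tendsto (fun i => decay (q i) (t * q i)) atTop (𝓝 (t ^ 2 / (1 + t ^ 2))) := by
  have h1 : Tendsto (fun i => ((q i) ^ 2)⁻¹ * (1 - Real.cos (t * q i))) atTop (𝓝 (t ^ 2 / 2)) := by
    refine tendsto_mul_one_sub_cos (by simpa using hq0.const_mul t) (tendsto_const_nhds.congr ?_)
    intro i
    have := (hq i).ne'
    field_simp
  have h2 := (h1.mul (hq0.const_sub 2)).div (((hq0.const_sub 1).const_mul 2).mul h1 |>.const_add 1)
    (by have := sq_nonneg t; simp only [sub_zero]; positivity)
  have e : t ^ 2 / 2 * (2 - 0) / (1 + 2 * (1 - 0) * (t ^ 2 / 2)) = t ^ 2 / (1 + t ^ 2) := by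
    simp only [sub_zero]; congr 1 <;> ring
  rw [e] at h2
  refine h2.congr fun i => ?_
  have := (hq i).ne'
  simp only [decay, Pi.div_apply]
  rw [← mul_div_mul_left _ _ (pow_ne_zero 2 this)]
  congr 1 <;> field_simp

variable (R : Rates)

/-- Over `J i = 1 / (ε i * q i)` time units, the number of blocks of the `i`-th chain with nonzero
value is nearly Poisson of mean one and the block lengths, scaled by `q i`, are nearly
exponential. -/
theorem tendstoInDistribution_coordSum (hq0 : Tendsto R.q atTop (𝓝 0)) (J : ℕ → ℕ)
    (hJ : ∀ i, (J i : ℝ) * (R.ε i * R.q i) = 1) :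
    TendstoInDistribution (fun (i : ℕ) ω => R.q i * coordSum i (J i) ω) atTop
      (id : ℝ → ℝ) (fun _ => R.P) poissonLaplaceLaw := by
  have hm : ∀ i, Measurable fun ω => R.q i * coordSum i (J i) ω := fun i =>
    (measurable_coordSum i (J i)).const_mul _
  have hε0 := R.summable_ε.tendsto_atTop_zero
  refine ⟨fun i => (hm i).aemeasurable, aemeasurable_id,
    ProbabilityMeasure.tendsto_of_tendsto_charFun fun t => ?_⟩
  change Tendsto (fun i => charFun (R.P.map fun ω => R.q i * coordSum i (J i) ω) t) atTop
    (𝓝 (charFun (poissonLaplaceLaw.map id) t))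
  rw [Measure.map_id, charFun_poissonLaplaceLaw]
  have hchar : ∀ i, charFun (R.P.map fun ω => R.q i * coordSum i (J i) ω) t
      = ∫ ω, Complex.exp ((t * R.q i : ℝ) * coordSum i (J i) ω * Complex.I) ∂(R.P) := fun i => by
    rw [charFun_apply_real, integral_map (hm i).aemeasurable (by fun_prop)]
    refine integral_congr_ae (ae_of_all _ fun ω => ?_)
    simp only
    congr 1
    push_cast
    ring
  have hJpos : ∀ i, (0 : ℝ) < J i := fun i => by
    have h1 := mul_pos (R.ε_pos i) (R.q_pos i)
    by_contra h
    have h2 := hJ i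
    rw [le_antisymm (not_lt.1 h) (Nat.cast_nonneg _)] at h2
    simp at h2
  have hx : ∀ i, R.q i * R.ε i = (J i : ℝ)⁻¹ := fun i => by
    have := hJ i
    field_simp [(hJpos i).ne'] at this ⊢
    linarith
  have hJinv : Tendsto (fun i => (J i : ℝ)⁻¹) atTop (𝓝 0) := by
    simpa [hx] using hq0.mul hε0
  -- The power in the estimate of the characteristic function is replaced by an exponential.
  have hγ := tendsto_decay R.q_pos hq0 t
  have hpow : Tendsto (fun i => (1 - R.q i * R.ε i * decay (R.q i) (t * R.q i)) ^ (J i)) atTop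
      (𝓝 (Real.exp (-(t ^ 2 / (1 + t ^ 2))))) := by
    have h1 : Tendsto (fun i => Real.exp (-(decay (R.q i) (t * R.q i)))) atTop
        (𝓝 (Real.exp (-(t ^ 2 / (1 + t ^ 2))))) := (Real.continuous_exp.tendsto _).comp hγ.neg
    have h2 : Tendsto (fun i => (1 - R.q i * R.ε i * decay (R.q i) (t * R.q i)) ^ (J i)
        - Real.exp (-(decay (R.q i) (t * R.q i)))) atTop (𝓝 0) := by
      refine squeeze_zero_norm (fun i => ?_) (by simpa using hJinv.const_mul 4)
      have h3 := decay_nonneg (q := R.q i) (θ := t * R.q i) (R.q_le i)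
      have h4 := decay_le_two (θ := t * R.q i) (R.q_pos i) (R.q_le i)
      have h5 := R.q_pos i
      have h6 := R.ε_pos i
      have h7 : R.q i * R.ε i * decay (R.q i) (t * R.q i) ≤ 1 * (1 / 4) * 2 := by
        have := R.q_le i
        have := R.ε_le i
        gcongr
      have h8 := abs_one_sub_pow_sub_exp_le (x := R.q i * R.ε i * decay (R.q i) (t * R.q i))
        (by positivity) (by linarith) (J i)
      have h9 : (J i : ℝ) * (R.q i * R.ε i * decay (R.q i) (t * R.q i))
          = decay (R.q i) (t * R.q i) := by
        rw [hx, ← mul_assoc, mul_inv_cancel₀ (hJpos i).ne', one_mul]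
      rw [h9] at h8
      refine h8.trans ?_
      have h10 : (J i : ℝ) * (R.q i * R.ε i * decay (R.q i) (t * R.q i)) ^ 2
          = (J i : ℝ)⁻¹ * decay (R.q i) (t * R.q i) ^ 2 := by
        rw [hx]
        have := (hJpos i).ne'
        field_simp
      rw [h10]
      have h11 : decay (R.q i) (t * R.q i) ^ 2 ≤ 4 := by nlinarith
      have h12 : 0 ≤ (J i : ℝ)⁻¹ := inv_nonneg.2 (hJpos i).le
      nlinarith
    simpa using h2.add h1
  have hpowc : Tendsto (fun i => ((1 - R.q i * R.ε i * decay (R.q i) (t * R.q i) : ℝ) : ℂ) ^ (J i))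
      atTop (𝓝 ((Real.exp (-(t ^ 2 / (1 + t ^ 2))) : ℝ) : ℂ)) := by
    have := (Complex.continuous_ofReal.tendsto _).comp hpow
    simpa only [Function.comp_def, Complex.ofReal_pow] using this
  have hdiff : Tendsto (fun i => charFun (R.P.map fun ω => R.q i * coordSum i (J i) ω) t -
      ((1 - R.q i * R.ε i * decay (R.q i) (t * R.q i) : ℝ) : ℂ) ^ (J i)) atTop (𝓝 0) :=
    squeeze_zero_norm (a := fun i => 10 * R.ε i) (fun i => by
      rw [hchar]
      exact_mod_cast charFun_coordSum_estimate R i (J i) (t * R.q i))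
      (by simpa using hε0.const_mul 10)
  simpa using hdiff.add hpowc

/-- Off an event involving only the chains after the `i`-th one, the partial sum involves only the
chains up to the `i`-th one. -/
theorem partialSum_eq_sum_coordSum {ω : Noise} {i n : ℕ}
    (h : ∀ j, i < j → ∀ l ≤ n, ω (j, Sum.inr (some (l : ℤ))) = 0) :
    partialSum X n ω = ∑ j ∈ Finset.range (i + 1), (1 / 4 : ℝ) ^ j * coordSum j n ω := by
  have hz : ∀ j, i < j → ∀ k ≤ n, chain ω (k : ℤ) j = 0 := by
    intro j hj k hk
    by_contra hc
    rw [chain_natCast] at hc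
    obtain ⟨l, hl, hne⟩ := exists_ne_zero_of_fwd_ne_zero hc
    exact hne (h j hj l (hl.trans hk))
  simp only [partialSum, coordSum, Finset.mul_sum]
  rw [Finset.sum_comm]
  refine Finset.sum_congr rfl fun k hk => ?_
  have hk' := (Finset.mem_Icc.1 hk).2
  have hfin : chain ω (k : ℤ) ∈ finSupp := by
    refine (Set.finite_Iic i).subset fun j hj => ?_
    by_contra hc
    exact hj (hz j (not_le.1 hc) k hk')
  rw [X, obs_of_mem hfin, code, tsum_eq_sum (s := Finset.range (i + 1))]
  intro j hj
  rw [hz j (by simpa using hj) k hk']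
  simp

/-- By `hlow` the chains before the `i`-th are negligible in mean square at time `J i`, relative to
`b i = 4⁻ⁱ / q i`, and by `hhigh` those after it most likely vanish up to time `J i`. -/
theorem tendstoInDistribution_partialSum (hq0 : Tendsto R.q atTop (𝓝 0)) (J : ℕ → ℕ)
    (hJ : ∀ i, (J i : ℝ) * (R.ε i * R.q i) = 1)
    (hlow : Tendsto (fun i : ℕ => (i : ℝ) * (∑ j ∈ Finset.range i, (1 / 16 : ℝ) ^ j *
      (R.ε j / R.q j)) / ((1 / 16 : ℝ) ^ i * (R.ε i / R.q i))) atTop (𝓝 0))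
    (hhigh : Tendsto (fun i => ((J i : ℝ) + 1) * ∑' j, R.ε (i + 1 + j)) atTop (𝓝 0)) :
    TendstoInDistribution (fun (i : ℕ) ω => ((1 / 4 : ℝ) ^ i / R.q i)⁻¹ * partialSum X (J i) ω)
      atTop (id : ℝ → ℝ) (fun _ => R.P) poissonLaplaceLaw := by
  refine tendstoInDistribution_of_tendstoInMeasure_sub _ _
    (tendstoInDistribution_coordSum R hq0 J hJ) ?_
    (fun i => ((measurable_partialSum (J i)).const_mul _).aemeasurable)
  refine tendstoInMeasure_iff_measureReal_norm.2 fun δ hδ => ?_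
  set b : ℕ → ℝ := fun i => (1 / 4 : ℝ) ^ i / R.q i with hb
  have hbpos : ∀ i, 0 < b i := fun i => div_pos (by positivity) (R.q_pos i)
  set L : ℕ → Noise → ℝ := fun i ω =>
    ∑ j ∈ Finset.range i, (1 / 4 : ℝ) ^ j * coordSum j (J i) ω with hL
  set E : ℕ → Set Noise := fun i =>
    ⋃ j : ℕ, {ω | ∃ l ≤ J i, ω (i + 1 + j, Sum.inr (some (l : ℤ))) ≠ 0} with hE
  have hLm : ∀ i, Measurable (L i) := fun i =>
    Finset.measurable_sum _ fun j _ => (measurable_coordSum j (J i)).const_mul _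
  have hsub : ∀ i, {ω | δ ≤ ‖((fun (i : ℕ) ω => (b i)⁻¹ * partialSum X (J i) ω) -
      fun (i : ℕ) ω => R.q i * coordSum i (J i) ω) i ω - (0 : ℕ → Noise → ℝ) i ω‖}
      ⊆ E i ∪ {ω | (δ * b i) ^ 2 ≤ L i ω ^ 2} := by
    intro i ω hω
    by_cases hE' : ω ∈ E i
    · exact Or.inl hE'
    refine Or.inr ?_
    simp only [hE, Set.mem_iUnion, Set.mem_ofPred_eq, not_exists, not_and, not_not] at hE'
    have hS := partialSum_eq_sum_coordSum (ω := ω) (i := i) (n := J i) fun j hj l hl => by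
      have := hE' (j - (i + 1)) l hl
      rwa [show i + 1 + (j - (i + 1)) = j by omega] at this
    simp only [Pi.sub_apply, Pi.zero_apply, sub_zero, Real.norm_eq_abs, Set.mem_ofPred_eq] at hω ⊢
    have hb4 : (b i)⁻¹ * ((1 / 4 : ℝ) ^ i * coordSum i (J i) ω) = R.q i * coordSum i (J i) ω := by
      have := (R.q_pos i).ne'
      simp only [hb]
      field_simp
    rw [hS, Finset.sum_range_succ, mul_add, hb4, add_sub_cancel_right, abs_mul,
      abs_of_pos (inv_pos.2 (hbpos i)), inv_mul_eq_div, le_div_iff₀ (hbpos i)] at hω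
    rw [← sq_abs (L i ω)]
    exact pow_le_pow_left₀ (mul_pos hδ (hbpos i)).le hω 2
  have hPE : ∀ i, R.P.real (E i) ≤ ((J i : ℝ) + 1) * ∑' j, R.ε (i + 1 + j) := fun i => by
    have hsum : Summable fun j => R.ε (i + 1 + j) := by
      have := (summable_nat_add_iff (i + 1)).2 R.summable_ε
      simpa only [add_comm] using this
    have h0 : 0 ≤ ∑' j, R.ε (i + 1 + j) := tsum_nonneg fun j => (R.ε_pos _).le
    refine ENNReal.toReal_le_of_le_ofReal (by positivity) ?_
    refine (measure_iUnion_le _).trans ((ENNReal.tsum_le_tsum fun j =>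
      P_exists_val_ne_zero_le R (i + 1 + j) (J i)).trans_eq ?_)
    rw [ENNReal.tsum_mul_left, ← ENNReal.ofReal_tsum_of_nonneg (fun j => (R.ε_pos _).le) hsum,
      ENNReal.ofReal_mul (by positivity), ENNReal.ofReal_add (by positivity) zero_le_one]
    simp
  have hcint : ∀ j n, Integrable (fun ω => coordSum j n ω ^ 2) R.P := fun j n =>
    Integrable.of_bound ((measurable_coordSum j n).pow_const 2).aestronglyMeasurable ((n : ℝ) ^ 2)
      (ae_of_all _ fun ω => by
        rw [Real.norm_eq_abs, abs_pow]
        exact pow_le_pow_left₀ (abs_nonneg _) (abs_coordSum_le _ _ _) 2)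
  have hLsq : ∀ i ω, L i ω ^ 2 ≤ i * ∑ j ∈ Finset.range i,
      (1 / 16 : ℝ) ^ j * coordSum j (J i) ω ^ 2 := fun i ω => by
    have h1 := sq_sum_le_card_mul_sum_sq (s := Finset.range i)
      (f := fun j => (1 / 4 : ℝ) ^ j * coordSum j (J i) ω)
    rw [Finset.card_range] at h1
    refine h1.trans_eq ?_
    congr 1
    refine Finset.sum_congr rfl fun j _ => ?_
    rw [mul_pow, ← pow_mul, mul_comm j 2, pow_mul]
    norm_num
  have hLint : ∀ i, ∫ ω, L i ω ^ 2 ∂(R.P) ≤ 2 * J i * (i * ∑ j ∈ Finset.range i,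
      (1 / 16 : ℝ) ^ j * (R.ε j / R.q j)) := fun i => by
    have hint : Integrable (fun ω => (i : ℝ) * ∑ j ∈ Finset.range i,
        (1 / 16 : ℝ) ^ j * coordSum j (J i) ω ^ 2) R.P :=
      (integrable_finsetSum _ fun j _ => (hcint j (J i)).const_mul _).const_mul _
    refine (integral_mono_of_nonneg (ae_of_all _ fun ω => sq_nonneg _) hint
      (ae_of_all _ (hLsq i))).trans ?_
    rw [integral_const_mul, integral_finsetSum _ fun j _ => (hcint j (J i)).const_mul _]
    have h2 : ∑ j ∈ Finset.range i, ∫ ω, (1 / 16 : ℝ) ^ j * coordSum j (J i) ω ^ 2 ∂(R.P)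
        ≤ ∑ j ∈ Finset.range i, 2 * J i * ((1 / 16 : ℝ) ^ j * (R.ε j / R.q j)) := by
      refine Finset.sum_le_sum fun j _ => ?_
      rw [integral_const_mul]
      have h3 := mul_le_mul_of_nonneg_left (integral_coordSum_sq_le R j (J i))
        (show (0 : ℝ) ≤ (1 / 16) ^ j by positivity)
      linarith
    rw [← Finset.mul_sum] at h2
    have h3 := mul_le_mul_of_nonneg_left h2 (Nat.cast_nonneg (α := ℝ) i)
    linarith
  have hPL : ∀ i, R.P.real {ω | (δ * b i) ^ 2 ≤ L i ω ^ 2} ≤ 2 / δ ^ 2 *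
      ((i : ℝ) * (∑ j ∈ Finset.range i, (1 / 16 : ℝ) ^ j * (R.ε j / R.q j)) /
        ((1 / 16 : ℝ) ^ i * (R.ε i / R.q i))) := fun i => by
    have hLi : Integrable (fun ω => L i ω ^ 2) R.P := by
      refine Integrable.mono' ((integrable_finsetSum (Finset.range i) fun j _ =>
        (hcint j (J i)).const_mul ((1 / 16 : ℝ) ^ j)).const_mul (i : ℝ))
        ((hLm i).pow_const 2).aestronglyMeasurable (ae_of_all _ fun ω => ?_)
      rw [Real.norm_of_nonneg (sq_nonneg _)]
      exact hLsq i ω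
    have h1 := mul_meas_ge_le_integral_of_nonneg (ae_of_all _ fun ω => sq_nonneg (L i ω)) hLi
      ((δ * b i) ^ 2)
    have h2 := h1.trans (hLint i)
    have hδb : 0 < (δ * b i) ^ 2 := by have := hbpos i; positivity
    rw [← le_div_iff₀' hδb] at h2
    refine h2.trans_eq ?_
    have hq := (R.q_pos i).ne'
    have hε := (R.ε_pos i).ne'
    have hJ' : (J i : ℝ) = (R.ε i * R.q i)⁻¹ := eq_inv_of_mul_eq_one_left (hJ i)
    have h16 : (1 / 16 : ℝ) ^ i = ((1 / 4 : ℝ) ^ i) ^ 2 := by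
      rw [← pow_mul, mul_comm, pow_mul]; norm_num
    have h4 : ((1 / 4 : ℝ) ^ i) ≠ 0 := by positivity
    rw [h16, hJ']
    simp only [hb]
    generalize (∑ j ∈ Finset.range i, (1 / 16 : ℝ) ^ j * (R.ε j / R.q j)) = σ
    generalize (1 / 4 : ℝ) ^ i = a at h4
    field_simp
  refine squeeze_zero (fun i => measureReal_nonneg) (fun i => (measureReal_mono (hsub i)).trans
    ((measureReal_union_le _ _).trans (add_le_add (hPE i) (hPL i)))) ?_
  simpa using hhigh.add (hlow.const_mul (2 / δ ^ 2))

end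

/-! ### The choice of the rates -/

/-- The ratio `ε i / q i` of the rates chosen below. -/
def ratio (i : ℕ) : ℕ := 16 ^ i * i.factorial ^ 4

theorem ratio_pos (i : ℕ) : 0 < ratio i := by
  have := i.factorial_pos
  unfold ratio
  positivity

/-- The reciprocal of the rate `ε i`. The factor `N i` serves the mixing rate, the factor
`(ratio (i - 1) * scale (i - 1)) ^ 2` makes `ε i` small against the reciprocal of the earlier
horizons, and the powers of `4` make `∑ ε i` small. -/
def scale (N : ℕ → ℕ) : ℕ → ℕ
  | 0 => 16 * N 0
  | i + 1 => 16 * 4 ^ (i + 1) * N (i + 1) * (ratio i * scale N i) ^ 2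

/-- The time `1 / (ε i * q i)`, at which the `i`-th chain dominates the partial sum. -/
def horizon (N : ℕ → ℕ) (i : ℕ) : ℕ := ratio i * scale N i ^ 2

section

variable {N : ℕ → ℕ}

theorem scale_pos (hN : ∀ i, 1 ≤ N i) (i : ℕ) : 0 < scale N i := by
  induction i with
  | zero => have := hN 0; simp only [scale]; omega
  | succ i ih =>
    have := hN (i + 1)
    have := ratio_pos i
    simp only [scale]
    positivity

theorem le_scale (hN : ∀ i, 1 ≤ N i) (i : ℕ) : 16 * 4 ^ i * N i ≤ scale N i := by
  cases i with
  | zero => simp [scale]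
  | succ i => exact Nat.le_mul_of_pos_right _ (pow_pos (mul_pos (ratio_pos i) (scale_pos hN i)) 2)

theorem pow_le_scale (hN : ∀ i, 1 ≤ N i) (i : ℕ) : 16 * 4 ^ i ≤ scale N i :=
  (Nat.le_mul_of_pos_right _ (hN i)).trans (le_scale hN i)

theorem horizon_pos (hN : ∀ i, 1 ≤ N i) (i : ℕ) : 0 < horizon N i :=
  mul_pos (ratio_pos i) (pow_pos (scale_pos hN i) 2)

theorem pow_mul_horizon_le (hN : ∀ i, 1 ≤ N i) (i : ℕ) :
    4 ^ (i + 1) * horizon N i ≤ scale N (i + 1) := by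
  have h1 : horizon N i ≤ (ratio i * scale N i) ^ 2 := by
    rw [horizon, mul_pow]
    exact Nat.mul_le_mul_right _ (Nat.le_self_pow two_ne_zero _)
  have h2 : 4 ^ (i + 1) ≤ 16 * 4 ^ (i + 1) * N (i + 1) := by
    have := hN (i + 1)
    nlinarith [pow_pos (show 0 < 4 by norm_num) (i + 1)]
  exact Nat.mul_le_mul h2 h1

theorem strictMono_horizon (hN : ∀ i, 1 ≤ N i) : StrictMono (horizon N) := by
  refine strictMono_nat_of_lt_succ fun i => ?_
  have h1 := horizon_pos hN i
  have h2 : horizon N i < 4 ^ (i + 1) * horizon N i :=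
    lt_mul_of_one_lt_left h1 (Nat.one_lt_pow (Nat.succ_ne_zero i) (by norm_num))
  refine (h2.trans_le (pow_mul_horizon_le hN i)).trans_le ?_
  exact (Nat.le_self_pow two_ne_zero _).trans (Nat.le_mul_of_pos_left _ (ratio_pos _))

theorem inv_scale_le (hN : ∀ i, 1 ≤ N i) (i : ℕ) : (scale N i : ℝ)⁻¹ ≤ 1 / 16 * (1 / 4) ^ i := by
  have h : (16 * 4 ^ i : ℝ) ≤ scale N i := by exact_mod_cast pow_le_scale hN i
  calc (scale N i : ℝ)⁻¹ ≤ (16 * 4 ^ i : ℝ)⁻¹ := by gcongr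
    _ = 1 / 16 * (1 / 4) ^ i := by rw [mul_inv, one_div, one_div, inv_pow]

theorem summable_inv_scale (hN : ∀ i, 1 ≤ N i) : Summable fun i => (scale N i : ℝ)⁻¹ :=
  Summable.of_nonneg_of_le (fun i => by positivity) (inv_scale_le hN)
    ((summable_geometric_of_lt_one (by norm_num) (by norm_num)).mul_left _)

end

/-- The rates `ε i = 1 / scale i` and `q i = 1 / (ratio i * scale i)`. -/
def rates (N : ℕ → ℕ) (hN : ∀ i, 1 ≤ N i) : Rates where
  q i := ((ratio i : ℝ) * scale N i)⁻¹
  ε i := (scale N i : ℝ)⁻¹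
  q_pos i := by
    have := ratio_pos i
    have := scale_pos hN i
    positivity
  q_le i := by
    have h1 := ratio_pos i
    have h2 := scale_pos hN i
    exact inv_le_one_of_one_le₀ (by exact_mod_cast Nat.mul_pos h1 h2)
  ε_pos i := by
    have := scale_pos hN i
    positivity
  ε_le i := by
    have h : (1 / 4 : ℝ) ^ i ≤ 1 := pow_le_one₀ (by norm_num) (by norm_num)
    linarith [inv_scale_le hN i]
  summable_ε := summable_inv_scale hN
  tsum_ε_le := by
    have hg : Summable fun i : ℕ => 1 / 16 * (1 / 4 : ℝ) ^ i :=
      (summable_geometric_of_lt_one (by norm_num) (by norm_num)).mul_left _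
    refine ((summable_inv_scale hN).tsum_le_tsum (inv_scale_le hN) hg).trans ?_
    rw [tsum_mul_left, tsum_geometric_of_lt_one (by norm_num) (by norm_num)]
    norm_num

section

variable {N : ℕ → ℕ} (hN : ∀ i, 1 ≤ N i)

theorem rates_div (i : ℕ) : (rates N hN).ε i / (rates N hN).q i = ratio i := by
  have : (scale N i : ℝ) ≠ 0 := by exact_mod_cast (scale_pos hN i).ne'
  have : (ratio i : ℝ) ≠ 0 := by exact_mod_cast (ratio_pos i).ne'
  simp only [rates]
  field_simp

theorem pow_mul_rates_div (i : ℕ) :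
    (1 / 16 : ℝ) ^ i * ((rates N hN).ε i / (rates N hN).q i) = (i.factorial : ℝ) ^ 4 := by
  rw [rates_div, ratio]
  push_cast
  rw [← mul_assoc, ← mul_pow]
  norm_num

theorem horizon_mul_rates (i : ℕ) :
    (horizon N i : ℝ) * ((rates N hN).ε i * (rates N hN).q i) = 1 := by
  have : (scale N i : ℝ) ≠ 0 := by exact_mod_cast (scale_pos hN i).ne'
  have : (ratio i : ℝ) ≠ 0 := by exact_mod_cast (ratio_pos i).ne'
  simp only [rates, horizon]
  push_cast
  field_simp

theorem tendsto_rates_q : Tendsto (rates N hN).q atTop (𝓝 0) := by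
  refine squeeze_zero (fun i => ((rates N hN).q_pos i).le) (fun i => ?_)
    (rates N hN).summable_ε.tendsto_atTop_zero
  have h1 : (1 : ℝ) ≤ ratio i := by exact_mod_cast ratio_pos i
  have h2 : (0 : ℝ) < scale N i := by exact_mod_cast scale_pos hN i
  exact inv_anti₀ h2 (le_mul_of_one_le_left h2.le h1)

theorem tendsto_pow_mul_rates_div :
    Tendsto (fun i => (1 / 16 : ℝ) ^ i * ((rates N hN).ε i / (rates N hN).q i)) atTop atTop := by
  simp only [pow_mul_rates_div]
  refine tendsto_atTop_mono (fun i => ?_) tendsto_natCast_atTop_atTop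
  exact_mod_cast i.self_le_factorial.trans (Nat.le_self_pow four_ne_zero _)

/-- The chains before the `i`-th one contribute negligibly to the variance at time `horizon i`. -/
theorem tendsto_sum_rates_div : Tendsto (fun i : ℕ => (i : ℝ) * (∑ j ∈ Finset.range i,
      (1 / 16 : ℝ) ^ j * ((rates N hN).ε j / (rates N hN).q j)) /
    ((1 / 16 : ℝ) ^ i * ((rates N hN).ε i / (rates N hN).q i))) atTop (𝓝 0) := by
  simp only [pow_mul_rates_div]
  refine squeeze_zero (fun i => by positivity) (fun i => ?_) tendsto_inv_atTop_nhds_zero_nat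
  rcases i with _ | i
  · simp
  have hf : (0 : ℝ) < i.factorial := by exact_mod_cast i.factorial_pos
  have h1 : ∑ j ∈ Finset.range (i + 1), (j.factorial : ℝ) ^ 4
      ≤ (i + 1) * (i.factorial : ℝ) ^ 4 := by
    refine (Finset.sum_le_card_nsmul _ _ ((i.factorial : ℝ) ^ 4) fun j hj => ?_).trans_eq ?_
    · have : j.factorial ≤ i.factorial := Nat.factorial_le (Nat.lt_succ_iff.1 (by simpa using hj))
      gcongr
    · simp
  rw [div_le_iff₀ (by positivity), Nat.factorial_succ]
  push_cast
  have h2 : ((i : ℝ) + 1)⁻¹ * (((i : ℝ) + 1) * i.factorial) ^ 4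
      = ((i : ℝ) + 1) ^ 3 * (i.factorial : ℝ) ^ 4 := by
    field_simp
  rw [h2]
  have h3 : ((i : ℝ) + 1) ^ 2 ≤ ((i : ℝ) + 1) ^ 3 :=
    pow_le_pow_right₀ (by linarith [Nat.cast_nonneg (α := ℝ) i]) (by norm_num)
  calc ((i : ℝ) + 1) * ∑ j ∈ Finset.range (i + 1), (j.factorial : ℝ) ^ 4
      ≤ ((i : ℝ) + 1) * ((i + 1) * (i.factorial : ℝ) ^ 4) := by gcongr
    _ = ((i : ℝ) + 1) ^ 2 * (i.factorial : ℝ) ^ 4 := by ring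
    _ ≤ _ := by gcongr

/-- The chains after the `i`-th one most likely stay at zero up to time `horizon i`. -/
theorem tendsto_horizon_mul_tsum : Tendsto (fun i => ((horizon N i : ℝ) + 1) *
    ∑' j, (rates N hN).ε (i + 1 + j)) atTop (𝓝 0) := by
  have hbound : ∀ i j, (rates N hN).ε (i + 1 + j) ≤
      (horizon N i : ℝ)⁻¹ * ((1 / 4) ^ (i + 1) * (1 / 4) ^ j) := fun i j => by
    have h1 : 4 ^ (i + 1 + j) * horizon N i ≤ scale N (i + 1 + j) := by
      refine le_trans ?_ ((pow_mul_horizon_le hN (i + j)).trans_eq (by congr 1; omega))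
      rw [show i + j + 1 = i + 1 + j by omega]
      exact Nat.mul_le_mul_left _ ((strictMono_horizon hN).monotone (Nat.le_add_right i j))
    have h2 : (4 ^ (i + 1 + j) * horizon N i : ℝ) ≤ scale N (i + 1 + j) := by exact_mod_cast h1
    have h3 : (0 : ℝ) < horizon N i := by exact_mod_cast horizon_pos hN i
    calc (scale N (i + 1 + j) : ℝ)⁻¹ ≤ (4 ^ (i + 1 + j) * horizon N i : ℝ)⁻¹ := by gcongr
      _ = _ := by rw [mul_inv, ← pow_add, one_div, inv_pow, mul_comm]
  have hgeo : Summable fun j : ℕ => (1 / 4 : ℝ) ^ j :=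
    summable_geometric_of_lt_one (by norm_num) (by norm_num)
  refine squeeze_zero (g := fun i : ℕ => (1 / 4 : ℝ) ^ i) (fun i => ?_) (fun i => ?_)
    (tendsto_pow_atTop_nhds_zero_of_lt_one (by norm_num) (by norm_num))
  · exact mul_nonneg (by positivity) (tsum_nonneg fun j => ((rates N hN).ε_pos _).le)
  · have hs : Summable fun j => (rates N hN).ε (i + 1 + j) := by
      have := (summable_nat_add_iff (i + 1)).2 (rates N hN).summable_ε
      simpa only [add_comm] using this
    have h1 := hs.tsum_le_tsum (hbound i) ((hgeo.mul_left _).mul_left _)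
    rw [tsum_mul_left, tsum_mul_left, tsum_geometric_of_lt_one (by norm_num) (by norm_num)] at h1
    have h3 : (1 : ℝ) ≤ horizon N i := by exact_mod_cast horizon_pos hN i
    calc ((horizon N i : ℝ) + 1) * ∑' j, (rates N hN).ε (i + 1 + j)
        ≤ ((horizon N i : ℝ) + horizon N i) *
          ((horizon N i : ℝ)⁻¹ * ((1 / 4) ^ (i + 1) * (1 - 1 / 4)⁻¹)) := by
          gcongr
          exact tsum_nonneg fun j => ((rates N hN).ε_pos _).le
      _ = 2 * (1 / 4) ^ (i + 1) * (1 - 1 / 4)⁻¹ := by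
          have : (horizon N i : ℝ) ≠ 0 := by positivity
          field_simp
          ring
      _ ≤ (1 / 4) ^ i := by
          rw [pow_succ]
          have : (0 : ℝ) ≤ (1 / 4) ^ i := by positivity
          norm_num
          linarith

theorem tendsto_norming :
    Tendsto (fun i => (1 / 4 : ℝ) ^ i / (rates N hN).q i) atTop atTop := by
  refine tendsto_atTop_mono (fun i => ?_) tendsto_natCast_atTop_atTop
  have h1 : i * 4 ^ i ≤ ratio i * scale N i := by
    have h2 : i ≤ ratio i := i.self_le_factorial.trans ((Nat.le_self_pow four_ne_zero _).trans
      (Nat.le_mul_of_pos_left _ (by positivity)))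
    have h3 := pow_le_scale hN i
    exact Nat.mul_le_mul h2 (by omega)
  have h4 : (i * 4 ^ i : ℝ) ≤ ratio i * scale N i := by exact_mod_cast h1
  simp only [rates]
  rw [div_inv_eq_mul, one_div, inv_pow, inv_mul_eq_div, le_div_iff₀ (by positivity)]
  exact h4

/-! ### The mixing rate -/

theorem mul_mul_one_sub_pow_le {q : ℝ} (h0 : 0 ≤ q) (h1 : q ≤ 1) (n : ℕ) :
    n * q * (1 - q) ^ n ≤ 1 := by
  have h2 := one_add_mul_le_pow (show (-2 : ℝ) ≤ q by linarith) n
  have h3 : 0 ≤ (1 - q) ^ n := pow_nonneg (by linarith) n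
  calc n * q * (1 - q) ^ n ≤ (1 + q) ^ n * (1 - q) ^ n := by gcongr; linarith
    _ = (1 - q ^ 2) ^ n := by rw [← mul_pow]; ring
    _ ≤ 1 := pow_le_one₀ (by nlinarith) (by nlinarith)

/-- For `n ≥ N i` the `i`-th chain mixes at rate at most `ratio i / n`; for `n < N i` its
contribution is at most `ε i`, hence of order `1 / n` as well. -/
theorem betaMix_rates_le {g : ℕ → ℝ} (hgN : ∀ i n, N i ≤ n → (2 : ℝ) ^ (i + 1) * ratio i ≤ g n)
    {n : ℕ} (hn : 0 ≤ g n) :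
    n * betaMix (rates N hN).P X n ≤ 2 * (g n + 1) := by
  set R := rates N hN with hR
  have hterm : ∀ i, n * ((1 - R.q i) ^ n * (2 * R.ε i)) ≤ (g n + 1) * (1 / 2 : ℝ) ^ i := fun i => by
    have hq0 := R.q_pos i
    have hq1 := R.q_le i
    have hε := R.ε_pos i
    have h2 : (0 : ℝ) < 2 ^ (i + 1) := by positivity
    suffices h : n * ((1 - R.q i) ^ n * R.ε i) * 2 ^ (i + 1) ≤ g n + 1 by
      have h3 : (1 / 2 : ℝ) ^ i * 2 ^ (i + 1) = 2 := by
        rw [pow_succ, ← mul_assoc, ← mul_pow]; norm_num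
      nlinarith
    rcases le_or_gt (N i) n with h | h
    · have h4 := mul_mul_one_sub_pow_le hq0.le hq1 n
      have h5 : R.ε i = ratio i * R.q i := by
        rw [← rates_div hN i, div_mul_cancel₀ _ hq0.ne']
      calc n * ((1 - R.q i) ^ n * R.ε i) * 2 ^ (i + 1)
          = n * R.q i * (1 - R.q i) ^ n * (2 ^ (i + 1) * ratio i) := by rw [h5]; ring
        _ ≤ 1 * g n := by gcongr; exact hgN i n h
        _ ≤ g n + 1 := by linarith
    · have h4 : (1 - R.q i) ^ n ≤ 1 := pow_le_one₀ (by linarith) (by linarith)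
      have h5 : n * 2 ^ (i + 1) ≤ scale N i := by
        refine le_trans ?_ (le_scale hN i)
        rw [mul_comm]
        refine Nat.mul_le_mul ?_ h.le
        rw [pow_succ]
        have := Nat.pow_le_pow_left (show 2 ≤ 4 by norm_num) i
        omega
      have h6 : (n * 2 ^ (i + 1) : ℝ) ≤ scale N i := by exact_mod_cast h5
      have h7 : (0 : ℝ) < scale N i := by exact_mod_cast scale_pos hN i
      calc n * ((1 - R.q i) ^ n * R.ε i) * 2 ^ (i + 1)
          ≤ n * (1 * R.ε i) * 2 ^ (i + 1) := by gcongr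
        _ = n * 2 ^ (i + 1) * (scale N i : ℝ)⁻¹ := by simp only [hR, rates]; ring
        _ ≤ scale N i * (scale N i : ℝ)⁻¹ := by gcongr
        _ = 1 := mul_inv_cancel₀ h7.ne'
        _ ≤ g n + 1 := by linarith
  have hgeo : Summable fun i : ℕ => (g n + 1) * (1 / 2 : ℝ) ^ i :=
    (summable_geometric_of_lt_one (by norm_num) (by norm_num)).mul_left _
  have hnn : ∀ i, 0 ≤ n * ((1 - R.q i) ^ n * (2 * R.ε i)) := fun i => by
    have := pow_nonneg (sub_nonneg.2 (R.q_le i)) n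
    have := R.ε_pos i
    positivity
  calc n * betaMix R.P X n ≤ n * ∑' i, (1 - R.q i) ^ n * (2 * R.ε i) := by
        gcongr; exact betaMix_le R n
    _ = ∑' i, n * ((1 - R.q i) ^ n * (2 * R.ε i)) := tsum_mul_left.symm
    _ ≤ ∑' i, (g n + 1) * (1 / 2 : ℝ) ^ i :=
        (Summable.of_nonneg_of_le hnn hterm hgeo).tsum_le_tsum hterm hgeo
    _ = 2 * (g n + 1) := by rw [tsum_mul_left, tsum_geometric_two, mul_comm]

theorem betaMix_nonneg {Ω : Type*} [MeasurableSpace Ω] (P : Measure Ω) (Y : ℤ → Ω → ℝ) (n : ℕ) :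
    0 ≤ betaMix P Y n := by
  refine Real.sSup_nonneg ?_
  rintro x ⟨I, J, A, B, -, -, rfl⟩
  positivity

theorem isBigO_betaMix {g : ℕ → ℝ} (hg : Tendsto g atTop atTop)
    (hgN : ∀ i n, N i ≤ n → (2 : ℝ) ^ (i + 1) * ratio i ≤ g n) :
    betaMix (rates N hN).P X =O[atTop] fun n : ℕ => g n / n := by
  refine Asymptotics.IsBigO.of_bound 4 ?_
  filter_upwards [hg.eventually_ge_atTop 1, eventually_gt_atTop 0] with n hn hn0
  have hn0' : (0 : ℝ) < n := by exact_mod_cast hn0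
  have hgn : 0 ≤ g n := zero_le_one.trans hn
  rw [Real.norm_of_nonneg (betaMix_nonneg _ _ _), Real.norm_of_nonneg (by positivity),
    ← mul_div_assoc, le_div_iff₀ hn0']
  have := betaMix_rates_le hN hgN hgn
  linarith

end

end

end ReversibleChain

open ReversibleChain

theorem theorem4p4 (g : ℕ → ℝ) (hg_pos : ∀ n : ℕ, 1 ≤ n → 0 < g n)
    (hg : Tendsto g atTop atTop) :
    ∃ (Ω : Type) (_ : MeasurableSpace Ω) (P : Measure Ω) (_ : IsProbabilityMeasure P)
      (X : ℤ → Ω → ℝ) (S : Set ℝ),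
      IsCountableStateMarkovChain P X S ∧ IsStrictlyStationary P X ∧
      IsIrreducibleChain P X S ∧ IsAperiodicChain P X S ∧ IsReversible P X ∧
      -- boundedness
      (∃ C : ℝ, 0 < C ∧ P {ω | |X 0 ω| ≤ C} = 1) ∧
      -- mixing rate
      (∀ n : ℕ, 1 ≤ n → alphaMix P X n ≤ betaMix P X n) ∧
      betaMix P X =O[atTop] (fun n : ℕ => g n / n) ∧
      -- moments, growth of variances, complete dissipation
      (MemLp (X 0) 2 P ∧ ∫ ω, X 0 ω ∂P = 0) ∧
      Tendsto (fun n : ℕ => (n : ℝ)⁻¹ * variance (partialSum X n) P) atTop atTop ∧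
      CompletelyDissipates P X ∧
      -- partial limit law
      (∃ (J : ℕ → ℕ) (b : ℕ → ℝ), StrictMono J ∧ (∀ n, 1 ≤ J n) ∧ (∀ n, 0 < b n) ∧
        Tendsto b atTop atTop ∧
        TendstoInDistribution (fun (n : ℕ) ω => (b n)⁻¹ * partialSum X (J n) ω) atTop
          (id : ℝ → ℝ) (fun _ => P) poissonLaplaceLaw) := by
  have hex : ∀ i : ℕ, ∃ M : ℕ, 1 ≤ M ∧
      ∀ n, M ≤ n → (2 : ℝ) ^ (i + 1) * ratio i ≤ g n := fun i => by
    obtain ⟨M, hM⟩ := eventually_atTop.1 (hg.eventually_ge_atTop ((2 : ℝ) ^ (i + 1) * ratio i))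
    exact ⟨max M 1, le_max_right _ _, fun n hn => hM n ((le_max_left _ _).trans hn)⟩
  choose N hN hgN using hex
  have hdiss := completelyDissipates_X (rates N hN) (tendsto_pow_mul_rates_div hN)
  refine ⟨Noise, inferInstance, (rates N hN).P, inferInstance, X, states,
    isCountableStateMarkovChain_X _, isStrictlyStationary_X _, isIrreducibleChain_X _,
    isAperiodicChain_X _, isReversible_X _, ⟨4 / 3, by norm_num, ?_⟩,
    fun n _ => alphaMix_le_betaMix _ n, isBigO_betaMix hN hg hgN,
    ⟨memLp_X _ 0, integral_X _ 0⟩, tendsto_variance_partialSum _ hdiss, hdiss,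
    horizon N, fun i => (1 / 4 : ℝ) ^ i / (rates N hN).q i, strictMono_horizon hN,
    horizon_pos hN, fun i => div_pos (by positivity) ((rates N hN).q_pos i), tendsto_norming hN,
    tendstoInDistribution_partialSum _ (tendsto_rates_q hN) _ (horizon_mul_rates hN)
      (tendsto_sum_rates_div hN) (tendsto_horizon_mul_tsum hN)⟩
  have huniv : {ω : Noise | |X 0 ω| ≤ 4 / 3} = Set.univ :=
    Set.eq_univ_of_forall fun ω => abs_obs_le _
  rw [huniv, measure_univ]
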